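/- **Parameters and integrals.** Let $\boldsymbol h=(h_0,h_{-1};h_1,\dots,h_6)$ be integers and put $$e_{0j}=h_j-1,\quad \overline e_{0j}=h_j+h_{-1}-h_0-1\ (1\le j\le 6),\qquad e_{jk}=h_0-h_j-h_k\ (1\le j<k\le 6).$$ Call $\boldsymbol h$ *admissible* if these 27 integers are all nonnegative (e.g. if all $h_j$ are positive and $h_0-h_{-1}<h_j<\frac12h_0$ for $1\le j\le6$), and *balanced* if $$h_{-1}=2+3h_0-(h_1+\dots+h_6).\tag{B}$$ For admissible $\boldsymbol h$ let $F(\boldsymbol h)=\gamma(\boldsymbol h)F_6'(\boldsymbol h)$, where $$F_6'(\boldsymbol h)=\frac1{2\pi i}\int_{c-i\infty}^{c+i\infty}(h_0+2t)\frac{\prod_{j=-1}^6\Gamma(h_j+t)\cdot\Gamma(h_{-1}-h_0-t)\Gamma(-t)}{\prod_{j=1}^6\Gamma(1+h_0-h_j+t)}\,dt,\qquad c=\tfrac13-\min_{1\le j\le6}h_j,$$ $$\gamma(\boldsymbol h)=\frac{e_{24}!\,e_{13}!\,e_{46}!\,e_{35}!}{e_{01}!\,e_{02}!\,\overline e_{05}!\,\overline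 e_{06}!}.$$ The numbers $e$ determine $\boldsymbol h$; write $H(\boldsymbol e)=F(\boldsymbol h)$. For integers $\boldsymbol a=(a_0;a_1,\dots,a_6)$, $\boldsymbol b=(b_0;b_1,\dots,b_6)$ with $b_j\le a_k$ whenever $j,k\ge 1$ have the same parity, $b_0-a_0-2\ge(a_1+a_3+a_5)-(b_1+b_3+b_5)$ and $b_0-a_0-2\ge(a_2+a_4+a_6)-(b_2+b_4+b_6)$, let $$G(\boldsymbol a,\boldsymbol b)=\frac1{(2\pi i)^2}\int_{\operatorname{Re}t=c_2}\int_{\operatorname{Re}s=c_1} \prod_{j=2,4,6}\frac{(t+b_j)_{a_j-b_j}}{(a_j-b_j)!}\Bigl(\frac{\pi}{\sin\pi t}\Bigr)^3 \prod_{j=1,3,5}\frac{(s+b_j)_{a_j-b_j}}{(a_j-b_j)!}\Bigl(\frac{\pi}{\sin\pi s}\Bigr)^3 \frac{(b_0-a_0-1)!}{(t+s+a_0)_{b_0-a_0}}\frac{\sin\pi(s+t)}{\pi}\,ds\,dt,$$ with $c_1=\frac13-\min\{a_1,a_3,a_5\}$, $c_2=\frac13-\min\{a_2,a_4,a_6\}$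 and both lines directed upwards. Assign to $\boldsymbol h$ the parameters $$a_0=1+h_0-h_{-1},\ a_j=h_j\ (1\le j\le6),\ b_0=1+h_0,\ b_1=b_2=1,\ b_5=b_6=1+h_0-h_{-1},\ b_3=h_1+h_3+h_5-h_0,\ b_4=h_2+h_4+h_6-h_0.$$ **$(\boldsymbol a,\boldsymbol b)$-trivial transformations.** These are the elements of the group of transformations of $(\boldsymbol a,\boldsymbol b)$ generated by the permutations of the $a_j$, and those of the $b_j$, that permute the indices $1,3,5$ among themselves and $2,4,6$ among themselves (fixing the index $0$); by the involution $a_j\leftrightarrow a_{7-j}$, $b_j\leftrightarrow b_{7-j}$ ($1\le j\le6$); and by the simultaneous shifts by any integer of $a_j,b_j$, $j\in\{0,1,3,5\}$, and of $a_j,b_j$, $j\in\{0,2,4,6\}$. A transformation $g$ of the balanced parameters $\boldsymbol h$ is called $(\boldsymbol a,\boldsymbol b)$-trivial if for every balanced $\boldsymbol h$ the parameters $(\boldsymbol a,\boldsymbol b)$ assigned to $g\boldsymbol h$ arise from those assigned to $\boldsymbol h$ by an $(\boldsymbol a,\boldsymbol b)$-trivial transformation. **The group $\mathfrak G$.** For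 a three-element set $S\subset\{1,\dots,6\}$ let Bailey's transformation $\mathfrak b_S$ of the balanced parameters add $1+h_0-\sum_{j\in S}h_j$ to $h_0$ and to $h_j$, $j\in S$, and leave the other parameters unchanged. The group $\mathfrak G$ is generated by the permutations of $h_1,\dots,h_6$ and all $\mathfrak b_S$, acting on balanced integer parameters $\boldsymbol h$ or, equivalently, as the induced group of permutations of the 27 numbers $e$. **Statement.** 1. If $\boldsymbol h$ is admissible, then $(\boldsymbol a,\boldsymbol b)$ satisfies the conditions imposed above and $F(\boldsymbol h)=(-1)^{1+h_{-1}+h_0+h_1+\dots+h_6}G(\boldsymbol a,\boldsymbol b)$; in particular $F(\boldsymbol h)=-G(\boldsymbol a,\boldsymbol b)$ if $\boldsymbol h$ is also balanced. The conditions on $(\boldsymbol a,\boldsymbol b)$ and the quantity $\prod_{j=1}^6(a_j-b_j)!\cdot G(\boldsymbol a,\boldsymbol b)$ are preserved by the $(\boldsymbol a,\boldsymbol b)$-trivial transformations. 2. On balanced $\boldsymbol h$ the transformation $\mathfrak b_{135}$ acts on $(\boldsymbol a,\boldsymbol b)$ as the composition of the shift of $a_0,a_1,a_3,a_5,b_0,b_1,b_3,b_5$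 by $1+h_0-h_1-h_3-h_5$ and the permutation $(b_1\,b_3)(b_4\,b_6)$; so it is $(\boldsymbol a,\boldsymbol b)$-trivial. It induces on the numbers $e$ the permutation $\mathfrak b=(e_{01}\,e_{35})(e_{03}\,e_{15})(e_{05}\,e_{13})(\overline e_{02}\,e_{46})(\overline e_{04}\,e_{26})(\overline e_{06}\,e_{24})$. 3. The permutations of $h_1,\dots,h_6$ together with $\mathfrak b_{135}$ generate $\mathfrak G$ (as transformations of $\boldsymbol h$; the permutations of the 27 numbers $e$ which they induce generate $\mathfrak G$ as a permutation group, and the two groups are isomorphic through "$g$ induces $\pi$"). The order of $\mathfrak G$ is $51840$. 4. For admissible balanced $\boldsymbol h$, the quantity $H(\boldsymbol e)/\Pi(\boldsymbol e)$, where $$\Pi(\boldsymbol e)=e_{03}!\,e_{04}!\,e_{05}!\,e_{06}!\,\overline e_{01}!\,\overline e_{02}!\,\overline e_{03}!\,\overline e_{04}!\,e_{13}!\,e_{24}!\,e_{35}!\,e_{46}!,$$ is invariant under $\mathfrak G$. 5. The subgroup of all $(\boldsymbol a,\boldsymbol b)$-trivial elements of $\mathfrak G$ has order $432=3!^3\cdot2!$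 and is generated by $(h_1\,h_3)$, $(h_3\,h_5)$, $(h_2\,h_4)$, $(h_4\,h_6)$, $\mathfrak b_{135}$ and $\mathfrak i=(h_1\,h_6)(h_2\,h_5)(h_3\,h_4)$. It is isomorphic to a semidirect product $\mathfrak S_3^3\rtimes\mathfrak S_2$: the three factors $\mathfrak S_3$ are generated by $(h_1\,h_3),(h_3\,h_5)$, by $(h_6\,h_4),(h_4\,h_2)$ and by $\mathfrak b_{135},\mathfrak b_{246}$ (in each case the two elements correspond to the transpositions $(1\,2),(2\,3)$), and the factor $\mathfrak S_2$ is generated by $\mathfrak i$, which acts by $(x,y,z)\mapsto(y,x,\tau z\tau^{-1})$ with $\tau=(1\,3)$. 6. This subgroup has index $120$ in $\mathfrak G$. For generic balanced $\boldsymbol h$ (that is, whenever a certain nonzero polynomial in $h_0,\dots,h_6$ does not vanish) the parameter sets $(\boldsymbol a,\boldsymbol b)$ assigned to $g\boldsymbol h$, $g\in\mathfrak G$, form exactly $120$ classes modulo $(\boldsymbol a,\boldsymbol b)$-trivial transformations. -/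

import Mathlib

open Equiv

namespace ZetaFour

/-! ### Parameters -/

/-- A set of integer parameters `(h₀, h₋₁; h₁, …, h₆)`: `hm` is `h₋₁` and `h j` is `h_j`. -/
@[ext]
structure HParams where
  hm : ℤ
  h : Fin 7 → ℤ

/-- A set of integer parameters `𝐚 = (a₀; a₁, …, a₆)`, `𝐛 = (b₀; b₁, …, b₆)`. -/
@[ext]
structure ABParams where
  a : Fin 7 → ℤ
  b : Fin 7 → ℤ

/-- The identification `(𝐚, 𝐛)` of `𝐡`. -/
def toAB (p : HParams) : ABParams where
  a := ![1 + p.h 0 - p.hm, p.h 1, p.h 2, p.h 3, p.h 4, p.h 5, p.h 6]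
  b := ![1 + p.h 0, 1, 1, p.h 1 + p.h 3 + p.h 5 - p.h 0, p.h 2 + p.h 4 + p.h 6 - p.h 0,
    1 + p.h 0 - p.hm, 1 + p.h 0 - p.hm]

/-- The 27 labels: `e j k` stands for `e_{jk}` with `0 ≤ j < k ≤ 6`, and `ebar j` for
`ē_{0j}` with `1 ≤ j ≤ 6`. -/
inductive Label where
  | e (j k : Fin 7) (hjk : j < k) : Label
  | ebar (j : Fin 7) (hj : j ≠ 0) : Label
  deriving DecidableEq

/-- `e_{0j} = h_j - 1`, `e_{jk} = h₀ - h_j - h_k` for `1 ≤ j < k`, and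
`ē_{0j} = h_j + h₋₁ - h₀ - 1`. -/
def eVal (p : HParams) : Label → ℤ
  | .e j k _ => if j = 0 then p.h k - 1 else p.h 0 - p.h j - p.h k
  | .ebar j _ => p.h j + p.hm - p.h 0 - 1

/-- All 27 integers `e` are nonnegative. This holds in particular for positive integers with
`h₀ - h₋₁ < h_j < h₀ / 2` for `1 ≤ j ≤ 6`. -/
def HParams.Admissible (p : HParams) : Prop := ∀ x : Label, 0 ≤ eVal p x

/-- The condition `h₋₁ = 2 + 3 h₀ - (h₁ + ⋯ + h₆)`. -/
def HParams.Balanced (p : HParams) : Prop :=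
  p.hm = 2 + 3 * p.h 0 - ∑ j ∈ Finset.univ.erase (0 : Fin 7), p.h j

/-- The parameter sets subject to the balancing condition. -/
abbrev BParams : Type := {p : HParams // p.Balanced}

/-! ### The integrals -/

noncomputable section

/-- `(1 / 2πi) ∫_{c - i∞}^{c + i∞} f(z) dz`. -/
def vline (c : ℝ) (f : ℂ → ℂ) : ℂ :=
  1 / (2 * (Real.pi : ℂ)) * ∫ y : ℝ, f ((c : ℂ) + (y : ℂ) * Complex.I)

/-- `n!` for a nonnegative integer `n`. -/
def fact (n : ℤ) : ℂ := (n.toNat.factorial : ℂ)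

/-- The Pochhammer symbol `(z)_n = z (z + 1) ⋯ (z + n - 1)` for a nonnegative integer `n`. -/
def poch (z : ℂ) (n : ℤ) : ℂ := (ascPochhammer ℂ n.toNat).eval z

/-- The smallest of `h₁, …, h₆`. -/
def hMin (p : HParams) : ℤ :=
  Finset.univ.inf' ⟨(0 : Fin 6), Finset.mem_univ _⟩ fun j : Fin 6 => p.h j.succ

/-- The very-well-poised integral `F₆'(𝐡)`. For admissible parameters the path
`Re t = 1/3 - min {h₁, …, h₆}` separates the poles of `Γ(h_j + t)`, `-1 ≤ j ≤ 6`, from those of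
`Γ(h₋₁ - h₀ - t) Γ(-t)`. -/
def F6' (p : HParams) : ℂ :=
  vline (1 / 3 - (hMin p : ℝ)) fun t =>
    ((p.h 0 : ℂ) + 2 * t) *
      (Complex.Gamma ((p.hm : ℂ) + t) * ∏ j : Fin 7, Complex.Gamma ((p.h j : ℂ) + t)) *
      Complex.Gamma ((p.hm : ℂ) - (p.h 0 : ℂ) - t) * Complex.Gamma (-t) /
      ∏ j : Fin 6, Complex.Gamma (1 + (p.h 0 : ℂ) - (p.h j.succ : ℂ) + t)

/-- The normalising factor `γ(𝐡)`. -/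
def gammaFactor (p : HParams) : ℂ :=
  (fact (p.h 0 - p.h 2 - p.h 4) * fact (p.h 0 - p.h 1 - p.h 3) *
      fact (p.h 0 - p.h 4 - p.h 6) * fact (p.h 0 - p.h 3 - p.h 5)) /
    (fact (p.h 1 - 1) * fact (p.h 2 - 1) *
      fact (p.h 5 + p.hm - p.h 0 - 1) * fact (p.h 6 + p.hm - p.h 0 - 1))

/-- `F(𝐡) = γ(𝐡) F₆'(𝐡)`. -/
def F (p : HParams) : ℂ := gammaFactor p * F6' p

/-- The standing conditions on `(𝐚, 𝐛)`. -/
def ABParams.Admissible (q : ABParams) : Prop :=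
  (q.a 1 + q.a 3 + q.a 5) - (q.b 1 + q.b 3 + q.b 5) ≤ q.b 0 - q.a 0 - 2 ∧
  (q.a 2 + q.a 4 + q.a 6) - (q.b 2 + q.b 4 + q.b 6) ≤ q.b 0 - q.a 0 - 2 ∧
  max (q.b 1) (max (q.b 3) (q.b 5)) ≤ min (q.a 1) (min (q.a 3) (q.a 5)) ∧
  max (q.b 2) (max (q.b 4) (q.b 6)) ≤ min (q.a 2) (min (q.a 4) (q.a 6))

/-- The factor `(z + b_j)_{a_j - b_j} / (a_j - b_j)!`. -/
def pochFactor (q : ABParams) (j : Fin 7) (z : ℂ) : ℂ :=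
  poch (z + (q.b j : ℂ)) (q.a j - q.b j) / fact (q.a j - q.b j)

/-- The double integral `G(𝐚, 𝐛)`, over `Re s = 1/3 - min {a₁, a₃, a₅}` and
`Re t = 1/3 - min {a₂, a₄, a₆}`. -/
def G (q : ABParams) : ℂ :=
  vline (1 / 3 - ((min (q.a 2) (min (q.a 4) (q.a 6)) : ℤ) : ℝ)) fun t =>
    pochFactor q 2 t * pochFactor q 4 t * pochFactor q 6 t *
      ((Real.pi : ℂ) / Complex.sin (Real.pi * t)) ^ 3 *
      vline (1 / 3 - ((min (q.a 1) (min (q.a 3) (q.a 5)) : ℤ) : ℝ)) fun s =>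
        pochFactor q 1 s * pochFactor q 3 s * pochFactor q 5 s *
          ((Real.pi : ℂ) / Complex.sin (Real.pi * s)) ^ 3 *
          (fact (q.b 0 - q.a 0 - 1) / poch (t + s + (q.a 0 : ℂ)) (q.b 0 - q.a 0)) *
          (Complex.sin (Real.pi * (s + t)) / Real.pi)

/-- The quantity `∏_{j=1}^6 (a_j - b_j)! · G(𝐚, 𝐛)`. -/
def normG (q : ABParams) : ℂ :=
  (∏ j : Fin 6, fact (q.a j.succ - q.b j.succ)) * G q

/-- The parameters `𝐡` recovered from the 27 numbers `e`. -/
def hOf (e : Label → ℤ) : HParams where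
  hm := e (.ebar 1 (by decide)) - (e (.e 0 1 (by decide)) + 1) +
    (e (.e 1 2 (by decide)) + (e (.e 0 1 (by decide)) + 1) + (e (.e 0 2 (by decide)) + 1)) + 1
  h := fun j =>
    if hj : 0 < j then e (.e 0 j hj) + 1
    else e (.e 1 2 (by decide)) + (e (.e 0 1 (by decide)) + 1) + (e (.e 0 2 (by decide)) + 1)

/-- `H(𝐞) = F(𝐡)`. -/
def H (e : Label → ℤ) : ℂ := F (hOf e)

/-- `Π(𝐞)`. -/
def bigPi (e : Label → ℤ) : ℂ :=
  fact (e (.e 0 3 (by decide))) * fact (e (.e 0 4 (by decide))) *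
  fact (e (.e 0 5 (by decide))) * fact (e (.e 0 6 (by decide))) *
  fact (e (.ebar 1 (by decide))) * fact (e (.ebar 2 (by decide))) *
  fact (e (.ebar 3 (by decide))) * fact (e (.ebar 4 (by decide))) *
  fact (e (.e 1 3 (by decide))) * fact (e (.e 2 4 (by decide))) *
  fact (e (.e 3 5 (by decide))) * fact (e (.e 4 6 (by decide)))

end

/-! ### The `(𝐚, 𝐛)`-trivial action -/

/-- Permutation of `a₀, …, a₆`. -/
def aPerm (σ : Perm (Fin 7)) : Perm ABParams where
  toFun q := ⟨q.a ∘ σ.symm, q.b⟩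
  invFun q := ⟨q.a ∘ σ, q.b⟩
  left_inv q := by ext <;> simp
  right_inv q := by ext <;> simp

/-- Permutation of `b₀, …, b₆`. -/
def bPerm (σ : Perm (Fin 7)) : Perm ABParams where
  toFun q := ⟨q.a, q.b ∘ σ.symm⟩
  invFun q := ⟨q.a, q.b ∘ σ⟩
  left_inv q := by ext <;> simp
  right_inv q := by ext <;> simp

/-- The shift by `m` of `a_j, b_j` for all `j ∈ s`. -/
def abShift (s : Finset (Fin 7)) (m : ℤ) : Perm ABParams where
  toFun q := ⟨fun j => if j ∈ s then q.a j + m else q.a j,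
    fun j => if j ∈ s then q.b j + m else q.b j⟩
  invFun q := ⟨fun j => if j ∈ s then q.a j - m else q.a j,
    fun j => if j ∈ s then q.b j - m else q.b j⟩
  left_inv q := by ext j <;> by_cases hj : j ∈ s <;> simp [hj]
  right_inv q := by ext j <;> by_cases hj : j ∈ s <;> simp [hj]

/-- The index permutation `j ↦ 7 - j` of `1, …, 6`. -/
def flipIdx : Perm (Fin 7) := swap 1 6 * swap 2 5 * swap 3 4

/-- `σ` permutes `1, 3, 5` among themselves and `2, 4, 6` among themselves. -/
def KeepsParity (σ : Perm (Fin 7)) : Prop :=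
  σ 0 = 0 ∧ (∀ j ∈ ({1, 3, 5} : Finset (Fin 7)), σ j ∈ ({1, 3, 5} : Finset (Fin 7))) ∧
    ∀ j ∈ ({2, 4, 6} : Finset (Fin 7)), σ j ∈ ({2, 4, 6} : Finset (Fin 7))

/-- The group of `(𝐚, 𝐛)`-trivial transformations, generated by the `𝐚`-trivial and the
`𝐛`-trivial permutations, the involution `a_j ↔ a_{7-j}, b_j ↔ b_{7-j}`, and the shifts of
`a₀, a₁, a₃, a₅, b₀, b₁, b₃, b₅` and of `a₀, a₂, a₄, a₆, b₀, b₂, b₄, b₆`. -/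
def abTrivial : Subgroup (Perm ABParams) :=
  Subgroup.closure
    ({τ | ∃ σ, KeepsParity σ ∧ (τ = aPerm σ ∨ τ = bPerm σ)} ∪ {aPerm flipIdx * bPerm flipIdx} ∪
      {τ | ∃ m : ℤ, τ = abShift {0, 1, 3, 5} m ∨ τ = abShift {0, 2, 4, 6} m})

/-! ### Transformations of the parameters `𝐡` and permutations of the 27 labels -/

/-- The `𝐡`-trivial transformation given by a permutation `σ` of the indices `1, …, 6`. -/
def relabel (σ : {σ : Perm (Fin 7) // σ 0 = 0}) : Perm BParams where
  toFun p := ⟨⟨p.1.hm, p.1.h ∘ σ.1.symm⟩, by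
    have h0 : σ.1.symm 0 = 0 := by rw [Equiv.symm_apply_eq]; exact σ.2.symm
    have hp := p.2
    unfold HParams.Balanced at hp ⊢
    rw [Finset.sum_erase_eq_sub (Finset.mem_univ _)] at hp ⊢
    simp only [Function.comp_apply, h0]
    rw [Equiv.sum_comp σ.1.symm p.1.h]
    exact hp⟩
  invFun p := ⟨⟨p.1.hm, p.1.h ∘ σ.1⟩, by
    have h0 : σ.1 0 = 0 := σ.2
    have hp := p.2
    unfold HParams.Balanced at hp ⊢
    rw [Finset.sum_erase_eq_sub (Finset.mem_univ _)] at hp ⊢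
    simp only [Function.comp_apply, h0]
    rw [Equiv.sum_comp σ.1 p.1.h]
    exact hp⟩
  left_inv p := by ext <;> simp
  right_inv p := by ext <;> simp

/-- The transposition `(h_j h_k)`, for `1 ≤ j, k ≤ 6`. -/
def hSwap (j k : Fin 7) (hj : 0 ≠ j) (hk : 0 ≠ k) : Perm BParams :=
  relabel ⟨swap j k, swap_apply_of_ne_of_ne hj hk⟩

/-- The involution `(h₁ h₆)(h₂ h₅)(h₃ h₄)`. -/
def hFlip : Perm BParams := relabel ⟨flipIdx, by decide⟩

/-- A set of three of the indices `1, …, 6`. -/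
abbrev Triple : Type := {s : Finset (Fin 7) // 0 ∉ s ∧ s.card = 3}

/-- The shift of `h₀` and of `h_j`, `j ∈ s`, by `d = 1 + h₀ - ∑_{j ∈ s} h_j`. -/
def baileyFun (s : Triple) (p : HParams) : HParams where
  hm := p.hm
  h := fun j => if j ∈ insert 0 s.1 then p.h j + (1 + p.h 0 - ∑ i ∈ s.1, p.h i) else p.h j

theorem baileyFun_sum (s : Triple) (p : HParams) :
    ∑ i ∈ s.1, (baileyFun s p).h i
      = ∑ i ∈ s.1, p.h i + 3 * (1 + p.h 0 - ∑ i ∈ s.1, p.h i) := by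
  have h1 : ∀ i ∈ s.1, (baileyFun s p).h i = p.h i + (1 + p.h 0 - ∑ i ∈ s.1, p.h i) := by
    intro i hi
    simp [baileyFun, hi]
  rw [Finset.sum_congr rfl h1, Finset.sum_add_distrib, Finset.sum_const, s.2.2]
  simp

theorem baileyFun_balanced (s : Triple) (p : HParams) (hp : p.Balanced) :
    (baileyFun s p).Balanced := by
  have hsub : s.1 ⊆ Finset.univ.erase (0 : Fin 7) := by
    intro i hi
    refine Finset.mem_erase.2 ⟨?_, Finset.mem_univ _⟩
    rintro rfl
    exact s.2.1 hi
  have h2 : ∑ i ∈ Finset.univ.erase 0 \ s.1, (baileyFun s p).h i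
      = ∑ i ∈ Finset.univ.erase 0 \ s.1, p.h i := by
    refine Finset.sum_congr rfl fun i hi => ?_
    rw [Finset.mem_sdiff, Finset.mem_erase] at hi
    simp [baileyFun, hi.1.1, hi.2]
  have h3 : (baileyFun s p).h 0 = p.h 0 + (1 + p.h 0 - ∑ i ∈ s.1, p.h i) := by
    simp [baileyFun]
  have h4 : (baileyFun s p).hm = p.hm := rfl
  unfold HParams.Balanced at hp ⊢
  rw [← Finset.sum_sdiff hsub] at hp ⊢
  rw [h2, baileyFun_sum, h3, h4, hp]
  ring

theorem baileyFun_involutive (s : Triple) : Function.Involutive (baileyFun s) := by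
  intro p
  have h1 := baileyFun_sum s p
  have h3 : (baileyFun s p).h 0 = p.h 0 + (1 + p.h 0 - ∑ i ∈ s.1, p.h i) := by
    simp [baileyFun]
  ext j
  · rfl
  · change (if j ∈ insert 0 s.1 then (baileyFun s p).h j +
      (1 + (baileyFun s p).h 0 - ∑ i ∈ s.1, (baileyFun s p).h i) else (baileyFun s p).h j) = p.h j
    rw [h1, h3]
    by_cases hj : j ∈ insert 0 s.1
    · simp only [baileyFun, if_pos hj]
      ring
    · simp only [baileyFun, if_neg hj]

/-- Bailey's transformation `𝔟_s` attached to a triple `s` of indices. -/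
def bailey (s : Triple) : Perm BParams where
  toFun p := ⟨baileyFun s p.1, baileyFun_balanced s p.1 p.2⟩
  invFun p := ⟨baileyFun s p.1, baileyFun_balanced s p.1 p.2⟩
  left_inv p := Subtype.ext (baileyFun_involutive s p.1)
  right_inv p := Subtype.ext (baileyFun_involutive s p.1)

/-- The transformation `𝔟₁₃₅`. -/
def b135 : Perm BParams := bailey ⟨{1, 3, 5}, by decide⟩

/-- The transformation `𝔟₂₄₆`. -/
def b246 : Perm BParams := bailey ⟨{2, 4, 6}, by decide⟩

/-- The transformation `g` of the parameters `𝐡` induces the permutation `π` of the 27 numbers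
`e`: the `π x`-th number for `g 𝐡` is the `x`-th number for `𝐡`. -/
def Induces (g : Perm BParams) (π : Perm Label) : Prop :=
  ∀ (p : BParams) (x : Label), eVal (g p).1 (π x) = eVal p.1 x

/-- The permutation `(e₀₁ e₃₅)(e₀₃ e₁₅)(e₀₅ e₁₃)(ē₀₂ e₄₆)(ē₀₄ e₂₆)(ē₀₆ e₂₄)`. -/
def bLabel : Perm Label :=
  swap (.e 0 1 (by decide)) (.e 3 5 (by decide)) *
  swap (.e 0 3 (by decide)) (.e 1 5 (by decide)) *
  swap (.e 0 5 (by decide)) (.e 1 3 (by decide)) *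
  swap (.ebar 2 (by decide)) (.e 4 6 (by decide)) *
  swap (.ebar 4 (by decide)) (.e 2 6 (by decide)) *
  swap (.ebar 6 (by decide)) (.e 2 4 (by decide))

/-- The permutations of the 27 labels induced by the `𝐡`-trivial transformations. -/
def hLabels : Set (Perm Label) := {π | ∃ σ, Induces (relabel σ) π}

/-- The permutations of the 27 labels induced by Bailey's transformations. -/
def baileyLabels : Set (Perm Label) := {π | ∃ s, Induces (bailey s) π}

/-- The group `𝔊`, as a group of permutations of the 27 numbers `e`: it is generated by the
permutations of `h₁, …, h₆` and Bailey's transformations. -/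
def permGroup : Subgroup (Perm Label) := Subgroup.closure (hLabels ∪ baileyLabels)

/-- The group `𝔊`, as a group of transformations of the parameters `𝐡`. -/
def transGroup : Subgroup (Perm BParams) :=
  Subgroup.closure (Set.range relabel ∪ Set.range bailey)

/-- The subgroup of all `g ∈ 𝔊` that are `(𝐚, 𝐛)`-trivial: for every `𝐡`, the parameters
`(𝐚, 𝐛)` of `g 𝐡` arise from those of `𝐡` by an `(𝐚, 𝐛)`-trivial transformation. -/
def trivialSubgroup : Subgroup (Perm BParams) where
  carrier := {g | g ∈ transGroup ∧
    ∀ p : BParams, ∃ τ ∈ abTrivial, toAB (g p).1 = τ (toAB p.1)}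
  one_mem' := ⟨one_mem _, fun _ => ⟨1, one_mem _, rfl⟩⟩
  mul_mem' := by
    rintro g₁ g₂ ⟨m₁, k₁⟩ ⟨m₂, k₂⟩
    refine ⟨mul_mem m₁ m₂, fun p => ?_⟩
    obtain ⟨τ₂, t₂, q₂⟩ := k₂ p
    obtain ⟨τ₁, t₁, q₁⟩ := k₁ (g₂ p)
    exact ⟨τ₁ * τ₂, mul_mem t₁ t₂, by rw [Perm.mul_apply, q₁, q₂, Perm.mul_apply]⟩
  inv_mem' := by
    rintro g ⟨m, k⟩
    refine ⟨inv_mem m, fun p => ?_⟩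
    obtain ⟨τ, t, q⟩ := k (g⁻¹ p)
    refine ⟨τ⁻¹, inv_mem t, ?_⟩
    have h1 : g (g⁻¹ p) = p := g.apply_symm_apply p
    rw [h1] at q
    rw [q]
    exact (τ.symm_apply_apply _).symm

/-- The class of `(𝐚, 𝐛)` modulo `(𝐚, 𝐛)`-trivial transformations. -/
def abClass (q : ABParams) : Set ABParams := {q' | ∃ τ ∈ abTrivial, q' = τ q}

end ZetaFour

open ZetaFour

/-!
The analytic heart is the identity `F = ± G` (`F_eq_G`). The factor `Γ(x + τ) Γ(y + τ) Γ(w + τ) /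
(Γ(1 + n - x + τ) Γ(1 + n - y + τ) Γ(1 + n - w + τ))`, `n = h₀`, of the very-well-poised integrand
is, up to factorials and a sign, the transform of `Γ(x + s) Γ(y + s) Γ(w + s) / Γ(x + y + w - n +
s) · π / sin πs` by the kernel `Γ(τ - s) / Γ(1 + n + τ + s)` (`saal_transform`). Expanding in this
way the factors with indices `1, 3, 5` and those with indices `2, 4, 6`, and interchanging the
integrations, leaves for fixed `s, t` a very-well-poised integral over `τ` with four parameters,
which has a closed form (`wilson_eval`, `wp_integral`); the result is `G` after the reflection
formula. Both evaluations are proved by contiguous relations. A function `U` with suitable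
difference `U(z + 1) ∓ U(z)` is integrated along two lines at distance `1`; this relates the
integrals for neighbouring parameters, and the initial cases reduce to the residue of `φ(z) (π /
sin πz)²` at an integer, which is `φ'` there. The growth estimates need no Stirling formula:
quotients of Gamma functions are Beta integrals up to shifts of the argument
(`stripPoly_Gamma_mul_inv`).

That `∏ (a_j - b_j)! · G` is preserved by the trivial transformations (`preservesNormG_of_mem`) is
visible once `(z + b)_{a - b}` is written as `Γ(z + a) / Γ(z + b)`: permutations permute factors,
shifts translate the lines, and the involution reverses the order of integration. As `𝔟₁₃₅` is
trivial, and the quotient of `γ(𝐡)` by `Π(𝐞)` is symmetric in `h₁, …, h₆` (`F_div_bigPi`), this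
gives the invariance of `H(𝐞) / Π(𝐞)`.

The group `𝔊` acts on the linear forms in `h₀ - 2, h₁ - 1, …, h₆ - 1` as the Weyl group of type
`E₆` acts on the Picard lattice of a cubic surface. The orbit of `h₀ - 2` consists of 72 forms
(`card_isLineClass`, `IsLineClass.exists_trans`) and its stabiliser is the group of the `720`
permutations of `h₁, …, h₆` (`exists_relabel`), so the order is `72 · 720 = 51840`. An element of
`𝔊` is determined by its value at any parameter set whose 27 numbers are distinct
(`eq_of_apply_eq`).

For balanced parameters `b₁, b₃, b₅` and `b₆, b₄, b₂` are, up to sign and shift, the same triple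
`0, α, α + β` (`toAB_b`). Hence a trivial transformation between two parameter sets that come from
balanced `𝐡` is given by independent permutations of `h₁, h₃, h₅`, of `h₂, h₄, h₆` and of this
triple, and possibly the involution (`eq_semiHom_of_abTrivial`). This identifies the trivial
subgroup with `𝔖₃³ ⋊ 𝔖₂` (`trivialSubgroup_eq`), and shows that for generic `𝐡`, where the 27
numbers are distinct, the classes correspond to its cosets (`abClass_toAB_eq_iff`). The
nonvanishing polynomial is the product of the differences of the 27 numbers.
-/

namespace ZetaFour

open Filter Topology MeasureTheory Set

/-! ### Integrals over vertical lines -/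

/-- At most exponential growth of rate `r` (up to powers of `|Im z|`) for `f` at the two ends
`|Im z| ≥ 1` of the vertical strip `c ≤ Re z ≤ d`. -/
def StripGrowth (f : ℂ → ℂ) (c d r : ℝ) : Prop :=
  ∃ (C : ℝ) (N : ℕ), ∀ z : ℂ, c ≤ z.re → z.re ≤ d → 1 ≤ |z.im| →
    ‖f z‖ ≤ C * (1 + |z.im|) ^ N * Real.exp (r * |z.im|)

theorem StripGrowth.mul {f g : ℂ → ℂ} {c d r s : ℝ} (hf : StripGrowth f c d r)
    (hg : StripGrowth g c d s) : StripGrowth (fun z => f z * g z) c d (r + s) := by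
  obtain ⟨C, N, h⟩ := hf
  obtain ⟨D, M, k⟩ := hg
  refine ⟨C * D, N + M, fun z h1 h2 h3 => ?_⟩
  rw [norm_mul]
  calc ‖f z‖ * ‖g z‖ ≤ (C * (1 + |z.im|) ^ N * Real.exp (r * |z.im|)) *
        (D * (1 + |z.im|) ^ M * Real.exp (s * |z.im|)) :=
        mul_le_mul (h z h1 h2 h3) (k z h1 h2 h3) (norm_nonneg _)
          ((norm_nonneg _).trans (h z h1 h2 h3))
    _ = C * D * (1 + |z.im|) ^ (N + M) * Real.exp ((r + s) * |z.im|) := by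
        rw [add_mul, Real.exp_add, pow_add]; ring

theorem StripGrowth.add {f g : ℂ → ℂ} {c d r : ℝ} (hf : StripGrowth f c d r)
    (hg : StripGrowth g c d r) : StripGrowth (fun z => f z + g z) c d r := by
  obtain ⟨C, N, h⟩ := hf
  obtain ⟨D, M, k⟩ := hg
  refine ⟨|C| + |D|, N + M, fun z h1 h2 h3 => ?_⟩
  have e1 : (1 : ℝ) ≤ 1 + |z.im| := by linarith
  have a1 : C * (1 + |z.im|) ^ N * Real.exp (r * |z.im|) ≤
      |C| * (1 + |z.im|) ^ (N + M) * Real.exp (r * |z.im|) := by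
    gcongr
    · exact le_abs_self C
    · exact Nat.le_add_right N M
  have a2 : D * (1 + |z.im|) ^ M * Real.exp (r * |z.im|) ≤
      |D| * (1 + |z.im|) ^ (N + M) * Real.exp (r * |z.im|) := by
    gcongr
    · exact le_abs_self D
    · exact Nat.le_add_left M N
  calc ‖f z + g z‖ ≤ ‖f z‖ + ‖g z‖ := norm_add_le _ _
    _ ≤ _ := add_le_add ((h z h1 h2 h3).trans a1) ((k z h1 h2 h3).trans a2)
    _ = _ := by ring

theorem StripGrowth.rate {f : ℂ → ℂ} {c d r s : ℝ} (hf : StripGrowth f c d r) (h : r = s) :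
    StripGrowth f c d s := h ▸ hf

theorem StripGrowth.congr {f g : ℂ → ℂ} {c d r : ℝ} (hf : StripGrowth f c d r)
    (h : ∀ z : ℂ, c ≤ z.re → z.re ≤ d → 1 ≤ |z.im| → g z = f z) : StripGrowth g c d r := by
  obtain ⟨C, N, k⟩ := hf
  exact ⟨C, N, fun z h1 h2 h3 => by rw [h z h1 h2 h3]; exact k z h1 h2 h3⟩

theorem stripGrowth_const (a : ℂ) (c d : ℝ) : StripGrowth (fun _ => a) c d 0 :=
  ⟨‖a‖, 0, fun z _ _ _ => by simp⟩

theorem stripGrowth_id (c d : ℝ) : StripGrowth (fun z => z) c d 0 := by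
  refine ⟨1 + |c| + |d|, 1, fun z h1 h2 h3 => ?_⟩
  have h4 : |z.re| ≤ |c| + |d| := by
    rw [abs_le]
    constructor
    · linarith [neg_abs_le c, abs_nonneg d]
    · linarith [le_abs_self d, abs_nonneg c]
  have h5 := Complex.norm_le_abs_re_add_abs_im z
  rw [zero_mul, Real.exp_zero, pow_one, mul_one]
  nlinarith [abs_nonneg c, abs_nonneg d]

theorem StripGrowth.pow {f : ℂ → ℂ} {c d : ℝ} (hf : StripGrowth f c d 0) (n : ℕ) :
    StripGrowth (fun z => f z ^ n) c d 0 := by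
  induction n with
  | zero => simpa using stripGrowth_const 1 c d
  | succ k ih => simpa [pow_succ] using (ih.mul hf)

theorem stripGrowth_add_const (a : ℂ) (c d : ℝ) : StripGrowth (fun z => z + a) c d 0 :=
  (stripGrowth_id c d).add (stripGrowth_const a c d)

/-- Negative growth rate gives quadratic decay. -/
theorem StripGrowth.quadratic_decay {f : ℂ → ℂ} {c d r : ℝ} (hf : StripGrowth f c d r)
    (hr : r < 0) : ∃ C : ℝ, ∀ z : ℂ, c ≤ z.re → z.re ≤ d → 1 ≤ |z.im| →
      ‖f z‖ ≤ C / (1 + z.im ^ 2) := by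
  obtain ⟨C, N, h⟩ := hf
  have ht : Tendsto (fun x : ℝ => x ^ (N + 2) * Real.exp (-(-r) * x)) atTop (𝓝 0) := by
    have h1 := tendsto_rpow_mul_exp_neg_mul_atTop_nhds_zero ((N + 2 : ℕ) : ℝ) (-r) (by linarith)
    simpa only [Real.rpow_natCast] using h1
  have hbd : ∃ D : ℝ, ∀ x : ℝ, 1 ≤ x → x ^ (N + 2) * Real.exp (r * x) ≤ D := by
    obtain ⟨a, ha⟩ := (ht.eventually (gt_mem_nhds one_pos)).exists_forall_of_atTop
    have hcont : ContinuousOn (fun x : ℝ => x ^ (N + 2) * Real.exp (r * x)) (Icc 1 (max 1 a)) := by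
      fun_prop
    obtain ⟨D, hD⟩ := (isCompact_Icc.image_of_continuousOn hcont).bddAbove
    refine ⟨max D 1, fun x hx => ?_⟩
    by_cases h1 : x ≤ max 1 a
    · exact (hD ⟨x, ⟨hx, h1⟩, rfl⟩).trans (le_max_left _ _)
    · have := ha x ((le_max_right 1 a).trans (not_le.1 h1).le)
      rw [neg_neg] at this
      exact this.le.trans (le_max_right _ _)
  obtain ⟨D, hD⟩ := hbd
  refine ⟨|C| * 2 ^ (N + 1) * D, fun z h1 h2 h3 => (h z h1 h2 h3).trans ?_⟩
  set x := |z.im| with hx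
  have hx2 : z.im ^ 2 = x ^ 2 := by rw [hx, sq_abs]
  have hd := hD x h3
  rw [hx2, le_div_iff₀ (by positivity)]
  have e1 : (1 + x) ^ N ≤ (2 * x) ^ N := by gcongr; linarith
  have e2 : 1 + x ^ 2 ≤ 2 * x ^ 2 := by nlinarith
  calc C * (1 + x) ^ N * Real.exp (r * x) * (1 + x ^ 2)
      ≤ |C| * (2 * x) ^ N * Real.exp (r * x) * (2 * x ^ 2) := by
        gcongr
        exact le_abs_self C
    _ = |C| * 2 ^ (N + 1) * (x ^ (N + 2) * Real.exp (r * x)) := by ring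
    _ ≤ _ := by gcongr

theorem line_re (c y : ℝ) : ((c : ℂ) + (y : ℂ) * Complex.I).re = c := by simp

theorem line_im (c y : ℝ) : ((c : ℂ) + (y : ℂ) * Complex.I).im = y := by simp

theorem continuous_line {f : ℂ → ℂ} {c : ℝ} (hf : ∀ z : ℂ, z.re = c → ContinuousAt f z) :
    Continuous fun y : ℝ => f ((c : ℂ) + (y : ℂ) * Complex.I) := by
  rw [continuous_iff_continuousAt]
  intro y
  have h2 : ContinuousAt (fun y : ℝ => (c : ℂ) + (y : ℂ) * Complex.I) y := by fun_prop
  exact ContinuousAt.comp (f := fun y : ℝ => (c : ℂ) + (y : ℂ) * Complex.I)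
    (hf _ (line_re c y)) h2

theorem integrable_of_quadratic_decay {f : ℝ → ℂ} (hc : Continuous f) {C : ℝ}
    (h : ∀ y : ℝ, 1 ≤ |y| → ‖f y‖ ≤ C / (1 + y ^ 2)) : Integrable f := by
  obtain ⟨M, hM⟩ := (isCompact_Icc (a := (-1 : ℝ)) (b := 1)).exists_bound_of_continuousOn
    hc.continuousOn
  refine Integrable.mono' (g := fun y => (|C| + 2 * |M|) * (1 + y ^ 2)⁻¹)
    (integrable_inv_one_add_sq.const_mul _) hc.aestronglyMeasurable
    (Eventually.of_forall fun y => ?_)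
  have h0 : (0 : ℝ) < 1 + y ^ 2 := by positivity
  have hM0 := abs_nonneg M
  have hC0 := abs_nonneg C
  rw [← div_eq_mul_inv, le_div_iff₀ h0]
  by_cases hy : 1 ≤ |y|
  · have h1 := h y hy
    rw [le_div_iff₀ h0] at h1
    linarith [le_abs_self C]
  · have h2 := abs_lt.1 (not_le.1 hy)
    have h1 := (hM y ⟨h2.1.le, h2.2.le⟩).trans (le_abs_self M)
    have h3 : y ^ 2 ≤ 1 := by nlinarith
    nlinarith [norm_nonneg (f y)]

/-- Integrability along the vertical line `Re z = c`. -/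
def LineIntegrable (f : ℂ → ℂ) (c : ℝ) : Prop :=
  Integrable fun y : ℝ => f ((c : ℂ) + (y : ℂ) * Complex.I)

theorem StripGrowth.lineIntegrable {f : ℂ → ℂ} {c d r a : ℝ} (hf : StripGrowth f c d r)
    (hr : r < 0) (h1 : c ≤ a) (h2 : a ≤ d) (hc : ∀ z : ℂ, z.re = a → ContinuousAt f z) :
    LineIntegrable f a := by
  obtain ⟨C, h⟩ := hf.quadratic_decay hr
  refine integrable_of_quadratic_decay (continuous_line hc) (C := C) fun y hy => ?_
  have := h ((a : ℂ) + (y : ℂ) * Complex.I) (by simpa using h1) (by simpa using h2)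
    (by simpa using hy)
  simpa using this

/-- Cauchy's theorem on long rectangles in a vertical strip. -/
theorem tendsto_line_sub_line {f : ℂ → ℂ} {c d : ℝ} (hcd : c ≤ d)
    (hf : ∀ z : ℂ, c ≤ z.re → z.re ≤ d → DifferentiableAt ℂ f z)
    {C : ℝ} (hC : ∀ z : ℂ, c ≤ z.re → z.re ≤ d → 1 ≤ |z.im| → ‖f z‖ ≤ C / |z.im|) :
    Tendsto (fun T : ℝ => (∫ y in (-T)..T, f ((d : ℂ) + (y : ℂ) * Complex.I)) -
      ∫ y in (-T)..T, f ((c : ℂ) + (y : ℂ) * Complex.I)) atTop (𝓝 0) := by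
  have hbound : ∀ T : ℝ, 1 ≤ T → ‖(∫ y in (-T)..T, f ((d : ℂ) + (y : ℂ) * Complex.I)) -
      ∫ y in (-T)..T, f ((c : ℂ) + (y : ℂ) * Complex.I)‖ ≤ 2 * (C / T * |d - c|) := by
    intro T hT
    have hrect := Complex.integral_boundary_rect_eq_zero_of_differentiableOn f
      ((c : ℂ) + ((-T : ℝ) : ℂ) * Complex.I) ((d : ℂ) + (T : ℂ) * Complex.I) (by
        intro z hz
        rw [Complex.mem_reProdIm] at hz
        simp only [line_re, line_im, uIcc_of_le hcd] at hz
        exact (hf z hz.1.1 hz.1.2).differentiableWithinAt)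
    simp only [line_re, line_im] at hrect
    have hI : ∀ S : ℝ, |S| = T → ‖∫ x in c..d, f ((x : ℂ) + (S : ℂ) * Complex.I)‖
        ≤ C / T * |d - c| := by
      intro S hS
      refine intervalIntegral.norm_integral_le_of_norm_le_const fun x hx => ?_
      rw [uIoc_of_le hcd] at hx
      have := hC ((x : ℂ) + (S : ℂ) * Complex.I) (by simpa using hx.1.le) (by simpa using hx.2)
        (by simpa [hS] using hT)
      simpa [hS] using this
    have h1 := hI (-T) (by rw [abs_neg, abs_of_nonneg (by linarith)])
    have h2 := hI T (abs_of_nonneg (by linarith))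
    set A := ∫ y in (-T)..T, f ((d : ℂ) + (y : ℂ) * Complex.I)
    set B := ∫ y in (-T)..T, f ((c : ℂ) + (y : ℂ) * Complex.I)
    set P := ∫ x in c..d, f ((x : ℂ) + ((-T : ℝ) : ℂ) * Complex.I)
    set Q := ∫ x in c..d, f ((x : ℂ) + (T : ℂ) * Complex.I)
    have h3 : Complex.I * (A - B) = Q - P := by
      simp only [smul_eq_mul] at hrect
      linear_combination hrect
    have h4 : ‖A - B‖ = ‖Q - P‖ := by
      rw [← h3, norm_mul, Complex.norm_I, one_mul]
    rw [h4]
    calc ‖Q - P‖ ≤ ‖Q‖ + ‖P‖ := norm_sub_le _ _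
      _ ≤ _ := by linarith
  refine squeeze_zero_norm' (a := fun T : ℝ => 2 * (C / T * |d - c|)) ?_ ?_
  · filter_upwards [eventually_ge_atTop 1] with T hT using hbound T hT
  · have : Tendsto (fun T : ℝ => C / T) atTop (𝓝 0) := tendsto_const_nhds.div_atTop tendsto_id
    simpa using (this.mul_const |d - c|).const_mul 2

theorem line_ne_zero {a : ℝ} (ha : a ≠ 0) (y : ℝ) : (a : ℂ) + (y : ℂ) * Complex.I ≠ 0 := by
  intro h
  have := congrArg Complex.re h
  simp at this
  exact ha this

theorem integral_inv_line {a : ℝ} (ha : 0 < a) (T : ℝ) :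
    ∫ y in (-T)..T, ((a : ℂ) + (y : ℂ) * Complex.I)⁻¹ = ((2 * Real.arctan (T / a) : ℝ) : ℂ) := by
  have hd : ∀ y : ℝ, HasDerivAt (fun y : ℝ => ((Real.arctan (y / a) : ℝ) : ℂ) -
      Complex.I * ((1 / 2 * Real.log (a ^ 2 + y ^ 2) : ℝ) : ℂ))
      ((a : ℂ) + (y : ℂ) * Complex.I)⁻¹ y := by
    intro y
    have hp : (0 : ℝ) < a ^ 2 + y ^ 2 := by positivity
    have h1 : HasDerivAt (fun y : ℝ => Real.arctan (y / a)) (a / (a ^ 2 + y ^ 2)) y := by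
      refine (((hasDerivAt_id y).div_const a).arctan).congr_deriv ?_
      simp only [id]
      field_simp
    have h2 : HasDerivAt (fun y : ℝ => 1 / 2 * Real.log (a ^ 2 + y ^ 2))
        (y / (a ^ 2 + y ^ 2)) y := by
      refine ((((hasDerivAt_pow 2 y).const_add (a ^ 2)).log hp.ne').const_mul (1 / 2)).congr_deriv
        ?_
      push_cast
      ring
    refine (h1.ofReal_comp.sub (h2.ofReal_comp.const_mul Complex.I)).congr_deriv ?_
    rw [inv_eq_one_div, eq_div_iff (line_ne_zero ha.ne' y)]
    have hp' : (a : ℂ) ^ 2 + (y : ℂ) ^ 2 ≠ 0 := by exact_mod_cast hp.ne'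
    push_cast
    field_simp
    linear_combination (-(y : ℂ) ^ 2) * Complex.I_sq
  rw [intervalIntegral.integral_eq_sub_of_hasDerivAt (fun y _ => hd y)]
  · simp only [neg_div, Real.arctan_neg, neg_sq]
    push_cast
    ring
  · apply Continuous.intervalIntegrable
    exact Continuous.inv₀ (by fun_prop) (line_ne_zero ha.ne')

theorem tendsto_integral_inv_line {a : ℝ} (ha : 0 < a) :
    Tendsto (fun T : ℝ => ∫ y in (-T)..T, ((a : ℂ) + (y : ℂ) * Complex.I)⁻¹) atTop
      (𝓝 (Real.pi : ℂ)) := by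
  have h1 : Tendsto (fun T : ℝ => 2 * Real.arctan (T / a)) atTop (𝓝 Real.pi) := by
    have h2 : Tendsto (fun T : ℝ => Real.arctan (T / a)) atTop (𝓝 (Real.pi / 2)) :=
      (Real.tendsto_arctan_atTop.mono_right nhdsWithin_le_nhds).comp
        (tendsto_id.atTop_div_const ha)
    simpa [mul_div_cancel₀] using h2.const_mul 2
  simp_rw [integral_inv_line ha]
  exact (Complex.continuous_ofReal.tendsto _).comp h1

theorem tendsto_integral_inv_line_neg {a : ℝ} (ha : a < 0) :
    Tendsto (fun T : ℝ => ∫ y in (-T)..T, ((a : ℂ) + (y : ℂ) * Complex.I)⁻¹) atTop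
      (𝓝 (-(Real.pi : ℂ))) := by
  have h := (tendsto_integral_inv_line (neg_pos.2 ha)).neg
  refine h.congr fun T => ?_
  rw [← intervalIntegral.integral_neg]
  have h2 := intervalIntegral.integral_comp_neg (a := -T) (b := T)
    (fun y : ℝ => ((a : ℂ) + (y : ℂ) * Complex.I)⁻¹)
  rw [neg_neg] at h2
  rw [← h2]
  refine intervalIntegral.integral_congr fun y _ => ?_
  rw [← inv_neg]
  congr 1
  push_cast
  ring

theorem tendsto_integral_inv_sq_line {a : ℝ} (ha : a ≠ 0) :
    Tendsto (fun T : ℝ => ∫ y in (-T)..T, (((a : ℂ) + (y : ℂ) * Complex.I) ^ 2)⁻¹) atTop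
      (𝓝 0) := by
  have hd : ∀ y : ℝ, HasDerivAt (fun y : ℝ => Complex.I * ((a : ℂ) + (y : ℂ) * Complex.I)⁻¹)
      (((a : ℂ) + (y : ℂ) * Complex.I) ^ 2)⁻¹ y := by
    intro y
    have h0 := line_ne_zero ha y
    have h1 : HasDerivAt (fun y : ℝ => (a : ℂ) + (y : ℂ) * Complex.I) Complex.I y := by
      simpa using ((Complex.ofRealCLM.hasDerivAt (x := y)).mul_const Complex.I).const_add (a : ℂ)
    refine ((h1.inv h0).const_mul Complex.I).congr_deriv ?_
    rw [mul_div_assoc', mul_neg, Complex.I_mul_I, neg_neg, one_div]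
  have he : ∀ T : ℝ, ∫ y in (-T)..T, (((a : ℂ) + (y : ℂ) * Complex.I) ^ 2)⁻¹ =
      Complex.I * ((a : ℂ) + (T : ℂ) * Complex.I)⁻¹ -
        Complex.I * ((a : ℂ) + ((-T : ℝ) : ℂ) * Complex.I)⁻¹ := by
    intro T
    refine intervalIntegral.integral_eq_sub_of_hasDerivAt (fun y _ => hd y) ?_
    apply Continuous.intervalIntegrable
    exact Continuous.inv₀ (by fun_prop) fun y => pow_ne_zero _ (line_ne_zero ha y)
  simp_rw [he]
  have hb : ∀ f : ℝ → ℝ, Tendsto (fun T => |f T|) atTop atTop →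
      Tendsto (fun T : ℝ => Complex.I * ((a : ℂ) + (f T : ℂ) * Complex.I)⁻¹) atTop (𝓝 0) := by
    intro f hf
    have h1 : Tendsto (fun T : ℝ => ‖(a : ℂ) + (f T : ℂ) * Complex.I‖) atTop atTop := by
      refine tendsto_atTop_mono (fun T => ?_) hf
      simpa using Complex.abs_im_le_norm ((a : ℂ) + (f T : ℂ) * Complex.I)
    have h2 := tendsto_zero_iff_norm_tendsto_zero.2
      ((h1.inv_tendsto_atTop).congr fun T => (norm_inv _).symm)
    simpa using h2.const_mul Complex.I
  have h1 := (hb (fun T => T) tendsto_abs_atTop_atTop).sub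
    (hb (fun T => -T) (by simpa using tendsto_abs_atTop_atTop))
  simpa using h1

/-- The double-pole residue formula in a strip: if `g` is holomorphic and `f = g / (z - m)²`
decays at both ends of the strip, the integrals of `f` along its two sides differ by `g' m`. -/
theorem vline_sub_vline {f g : ℂ → ℂ} {c d r m : ℝ} (hc : c < m) (hd : m < d) (hr : r < 0)
    (hg : ∀ z : ℂ, c ≤ z.re → z.re ≤ d → DifferentiableAt ℂ g z)
    (hfg : ∀ z : ℂ, c ≤ z.re → z.re ≤ d → z ≠ m → f z = g z / (z - m) ^ 2)
    (hf : StripGrowth f c d r) :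
    vline d f - vline c f = deriv g m := by
  have hcd : c ≤ d := (hc.trans hd).le
  have hmg : DifferentiableAt ℂ g m := hg m (by simpa using hc.le) (by simpa using hd.le)
  set g1 := dslope g (m : ℂ) with hg1
  set g2 := dslope g1 (m : ℂ) with hg2
  have hs : {z : ℂ | c < z.re ∧ z.re < d} ∈ 𝓝 (m : ℂ) := by
    refine IsOpen.mem_nhds ?_ ?_
    · exact (isOpen_lt continuous_const Complex.continuous_re).inter
        (isOpen_lt Complex.continuous_re continuous_const)
    · simpa using ⟨hc, hd⟩
  have hd1 : ∀ h : ℂ → ℂ, (∀ z : ℂ, c ≤ z.re → z.re ≤ d → DifferentiableAt ℂ h z) →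
      ∀ z : ℂ, c ≤ z.re → z.re ≤ d → DifferentiableAt ℂ (dslope h (m : ℂ)) z := by
    intro h hh z h1 h2
    by_cases hz : z = m
    · subst hz
      have := (Complex.differentiableOn_dslope hs).2 fun z hz =>
        (hh z hz.1.le hz.2.le).differentiableWithinAt
      exact this.differentiableAt hs
    · exact (differentiableAt_dslope_of_ne hz).2 (hh z h1 h2)
  have hg2d := hd1 _ (hd1 _ hg)
  have hexp : ∀ z : ℂ, z ≠ m → c ≤ z.re → z.re ≤ d →
      f z = g2 z + (g m * ((z - m) ^ 2)⁻¹ + deriv g m * (z - m)⁻¹) := by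
    intro z hz h1 h2
    have hz' : z - m ≠ 0 := sub_ne_zero.2 hz
    rw [hfg z h1 h2 hz, hg2, dslope_of_ne _ hz, slope_def_field, hg1, dslope_same,
      dslope_of_ne _ hz, slope_def_field]
    field_simp
    ring
  have hline : ∀ a y : ℝ, a ≠ m → (a : ℂ) + (y : ℂ) * Complex.I ≠ m := by
    intro a y ha h
    have := congrArg Complex.re h
    simp at this
    exact ha this
  have hsub : ∀ a y : ℝ, (a : ℂ) + (y : ℂ) * Complex.I - m
      = ((a - m : ℝ) : ℂ) + (y : ℂ) * Complex.I := by
    intro a y; push_cast; ring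
  have hint : ∀ a : ℝ, c ≤ a → a ≤ d → a ≠ m →
      Integrable (fun y : ℝ => f ((a : ℂ) + (y : ℂ) * Complex.I)) ∧
      ∀ T : ℝ, ∫ y in (-T)..T, f ((a : ℂ) + (y : ℂ) * Complex.I) =
        (∫ y in (-T)..T, g2 ((a : ℂ) + (y : ℂ) * Complex.I)) +
        (g m * (∫ y in (-T)..T, ((((a - m : ℝ) : ℂ) + (y : ℂ) * Complex.I) ^ 2)⁻¹) +
        deriv g m * ∫ y in (-T)..T, (((a - m : ℝ) : ℂ) + (y : ℂ) * Complex.I)⁻¹) := by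
    intro a h1 h2 ha
    have ham : a - m ≠ 0 := sub_ne_zero.2 ha
    have c1 : Continuous fun y : ℝ => g2 ((a : ℂ) + (y : ℂ) * Complex.I) :=
      continuous_line fun z hz => (hg2d z (hz ▸ h1) (hz ▸ h2)).continuousAt
    have c2 : Continuous fun y : ℝ => g m * ((((a - m : ℝ) : ℂ) + (y : ℂ) * Complex.I) ^ 2)⁻¹ :=
      continuous_const.mul
        (Continuous.inv₀ (by fun_prop) fun y => pow_ne_zero _ (line_ne_zero ham y))
    have c3 : Continuous fun y : ℝ => deriv g m * (((a - m : ℝ) : ℂ) + (y : ℂ) * Complex.I)⁻¹ :=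
      continuous_const.mul (Continuous.inv₀ (by fun_prop) (line_ne_zero ham))
    have c23 : Continuous fun y : ℝ =>
        g m * ((((a - m : ℝ) : ℂ) + (y : ℂ) * Complex.I) ^ 2)⁻¹ +
        deriv g m * (((a - m : ℝ) : ℂ) + (y : ℂ) * Complex.I)⁻¹ := c2.add c3
    have he : (fun y : ℝ => f ((a : ℂ) + (y : ℂ) * Complex.I)) = fun y : ℝ =>
        g2 ((a : ℂ) + (y : ℂ) * Complex.I) +
        (g m * ((((a - m : ℝ) : ℂ) + (y : ℂ) * Complex.I) ^ 2)⁻¹ +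
        deriv g m * (((a - m : ℝ) : ℂ) + (y : ℂ) * Complex.I)⁻¹) := by
      funext y
      rw [hexp _ (hline a y ha) (by simpa using h1) (by simpa using h2), hsub]
    refine ⟨?_, fun T => ?_⟩
    · obtain ⟨C, hC⟩ := hf.quadratic_decay hr
      refine integrable_of_quadratic_decay (C := C) ?_ fun y hy => ?_
      · rw [he]; exact c1.add c23
      · have := hC ((a : ℂ) + (y : ℂ) * Complex.I) (by simpa using h1) (by simpa using h2)
          (by simpa using hy)
        simpa using this
    · rw [he, intervalIntegral.integral_add (c1.intervalIntegrable _ _)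
        (c23.intervalIntegrable _ _), intervalIntegral.integral_add
        (c2.intervalIntegrable _ _) (c3.intervalIntegrable _ _),
        intervalIntegral.integral_const_mul, intervalIntegral.integral_const_mul]
  obtain ⟨ic, ec⟩ := hint c le_rfl hcd hc.ne
  obtain ⟨id', ed⟩ := hint d hcd le_rfl hd.ne'
  obtain ⟨C, hC⟩ := hf.quadratic_decay hr
  have hg2C : ∀ z : ℂ, c ≤ z.re → z.re ≤ d → 1 ≤ |z.im| →
      ‖g2 z‖ ≤ (|C| + ‖g m‖ + ‖deriv g m‖) / |z.im| := by
    intro z h1 h2 h3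
    have h0 : (0 : ℝ) < |z.im| := by linarith
    have hz : z ≠ m := by
      rintro rfl
      simp at h3
      linarith
    have h4 : |z.im| ≤ ‖z - m‖ := by simpa using Complex.abs_im_le_norm (z - m)
    have h5 : g2 z = f z - g m * ((z - m) ^ 2)⁻¹ - deriv g m * (z - m)⁻¹ := by
      rw [hexp z hz h1 h2]; ring
    have h6 : ‖(z - m)⁻¹‖ ≤ |z.im|⁻¹ := by
      rw [norm_inv]; exact inv_anti₀ h0 h4
    have h7 : ‖((z - m) ^ 2)⁻¹‖ ≤ |z.im|⁻¹ := by
      rw [norm_inv, norm_pow]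
      refine inv_anti₀ h0 ?_
      nlinarith
    have h8 : ‖f z‖ ≤ |C| * |z.im|⁻¹ := by
      refine (hC z h1 h2 h3).trans ?_
      rw [← div_eq_mul_inv]
      refine div_le_div₀ (abs_nonneg C) (le_abs_self C) h0 ?_
      rw [← sq_abs]
      nlinarith
    rw [h5]
    calc ‖f z - g m * ((z - m) ^ 2)⁻¹ - deriv g m * (z - m)⁻¹‖
        ≤ ‖f z‖ + ‖g m * ((z - m) ^ 2)⁻¹‖ + ‖deriv g m * (z - m)⁻¹‖ :=
          (norm_sub_le _ _).trans (add_le_add_left (norm_sub_le _ _) _)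
      _ ≤ |C| * |z.im|⁻¹ + ‖g m‖ * |z.im|⁻¹ + ‖deriv g m‖ * |z.im|⁻¹ := by
          rw [norm_mul, norm_mul]
          gcongr
      _ = _ := by ring
  have hlim := intervalIntegral_tendsto_integral id' tendsto_neg_atTop_atBot tendsto_id
  have hlim' := hlim.sub (intervalIntegral_tendsto_integral ic tendsto_neg_atTop_atBot tendsto_id)
  have hlim2 := ((tendsto_line_sub_line hcd hg2d hg2C).add
    (((tendsto_integral_inv_sq_line (sub_ne_zero.2 hd.ne')).sub
      (tendsto_integral_inv_sq_line (sub_ne_zero.2 hc.ne))).const_mul (g m))).add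
    (((tendsto_integral_inv_line (sub_pos.2 hd)).sub
      (tendsto_integral_inv_line_neg (sub_neg.2 hc))).const_mul (deriv g m))
  have hkey := tendsto_nhds_unique hlim' (hlim2.congr fun T => by
    simp only [id]
    rw [ed, ec]
    ring)
  have hpi : (Real.pi : ℂ) ≠ 0 := by exact_mod_cast Real.pi_ne_zero
  rw [vline, vline, ← mul_sub, hkey]
  field_simp
  ring

/-- Moving a vertical line of integration inside a strip of holomorphy. -/
theorem vline_eq_vline {f : ℂ → ℂ} {c d r : ℝ} (hcd : c ≤ d) (hr : r < 0)
    (hd : ∀ z : ℂ, c ≤ z.re → z.re ≤ d → DifferentiableAt ℂ f z)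
    (hf : StripGrowth f c d r) : vline d f = vline c f := by
  rcases hcd.eq_or_lt with rfl | hlt
  · rfl
  set m : ℝ := (c + d) / 2 with hm
  have h := vline_sub_vline (f := f) (g := fun z => f z * (z - m) ^ 2) (m := m) (c := c) (d := d)
    (by rw [hm]; linarith) (by rw [hm]; linarith) hr
    (fun z h1 h2 => (hd z h1 h2).mul (by fun_prop)) (fun z _ _ hz => by
      have : z - m ≠ 0 := sub_ne_zero.2 hz
      field_simp) hf
  have hfm : DifferentiableAt ℂ f m :=
    hd m (by simp [hm]; linarith) (by simp [hm]; linarith)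
  have h2 : HasDerivAt (fun z : ℂ => f z * (z - m) ^ 2) 0 (m : ℂ) := by
    refine (hfm.hasDerivAt.mul (((hasDerivAt_id (m : ℂ)).sub_const (m : ℂ)).pow 2)).congr_deriv ?_
    simp
  rw [h2.deriv] at h
  exact sub_eq_zero.1 h

theorem vline_add {f g : ℂ → ℂ} {c : ℝ} (hf : LineIntegrable f c) (hg : LineIntegrable g c) :
    vline c (fun z => f z + g z) = vline c f + vline c g := by
  simp only [vline]
  rw [integral_add hf hg, mul_add]

theorem vline_sub {f g : ℂ → ℂ} {c : ℝ} (hf : LineIntegrable f c) (hg : LineIntegrable g c) :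
    vline c (fun z => f z - g z) = vline c f - vline c g := by
  simp only [vline]
  rw [integral_sub hf hg, mul_sub]

theorem LineIntegrable.add {f g : ℂ → ℂ} {c : ℝ} (hf : LineIntegrable f c)
    (hg : LineIntegrable g c) : LineIntegrable (fun z => f z + g z) c :=
  Integrable.add hf hg

theorem LineIntegrable.const_mul {f : ℂ → ℂ} {c : ℝ} (hf : LineIntegrable f c) (a : ℂ) :
    LineIntegrable (fun z => a * f z) c :=
  Integrable.const_mul hf a

theorem vline_neg (f : ℂ → ℂ) (c : ℝ) : vline c (fun z => -f z) = -vline c f := by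
  simp only [vline]
  rw [integral_neg, mul_neg]

theorem vline_const_mul (a : ℂ) (f : ℂ → ℂ) (c : ℝ) :
    vline c (fun z => a * f z) = a * vline c f := by
  simp only [vline]
  rw [integral_const_mul]
  ring

theorem vline_congr {f g : ℂ → ℂ} {c : ℝ} (h : ∀ z : ℂ, z.re = c → f z = g z) :
    vline c f = vline c g := by
  simp only [vline]
  congr 2
  funext y
  exact h _ (line_re c y)

/-- Translation of the variable. -/
theorem vline_comp_add (f : ℂ → ℂ) (c a : ℝ) :
    vline c (fun z => f (z + a)) = vline (c + a) f := by
  simp only [vline]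
  congr 2
  funext y
  congr 1
  push_cast
  ring

/-! ### Growth of the sine and of quotients of Gamma functions -/

/-- The sine grows exponentially away from the real axis. -/
theorem exp_le_norm_sin {z : ℂ} (hz : 1 ≤ |z.im|) :
    Real.exp (Real.pi * |z.im|) ≤ 4 * ‖Complex.sin (Real.pi * z)‖ := by
  have h2 : 2 * ‖Complex.sin (Real.pi * z)‖ =
      ‖Complex.exp (-(Real.pi * z) * Complex.I) - Complex.exp ((Real.pi * z) * Complex.I)‖ := by
    rw [Complex.sin]
    simp only [norm_mul, norm_div, Complex.norm_I, mul_one, Complex.norm_ofNat]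
    ring
  have h3 : ‖Complex.exp (-(Real.pi * z) * Complex.I)‖ = Real.exp (Real.pi * z.im) := by
    rw [Complex.norm_exp]; simp
  have h4 : ‖Complex.exp ((Real.pi * z) * Complex.I)‖ = Real.exp (-(Real.pi * z.im)) := by
    rw [Complex.norm_exp]; simp
  have h5 := abs_norm_sub_norm_le (Complex.exp (-(Real.pi * z) * Complex.I))
    (Complex.exp ((Real.pi * z) * Complex.I))
  rw [h3, h4, ← h2] at h5
  have hpi : (1 : ℝ) ≤ Real.pi := by linarith [Real.pi_gt_three]
  have h6 : Real.exp (-(Real.pi * |z.im|)) ≤ Real.exp (Real.pi * |z.im|) / 2 := by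
    have : Real.exp (Real.pi * |z.im|) * Real.exp (-(Real.pi * |z.im|)) = 1 := by
      rw [← Real.exp_add]; simp
    have h7 : (2 : ℝ) ≤ Real.exp (Real.pi * |z.im|) := by
      have := Real.add_one_le_exp (Real.pi * |z.im|)
      nlinarith
    nlinarith [Real.exp_pos (-(Real.pi * |z.im|))]
  rcases abs_cases z.im with ⟨h, -⟩ | ⟨h, -⟩ <;> rw [h] at h6 ⊢
  · linarith [le_abs_self (Real.exp (Real.pi * z.im) - Real.exp (-(Real.pi * z.im)))]
  · rw [mul_neg, neg_neg] at h6
    rw [mul_neg]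
    linarith [neg_abs_le (Real.exp (Real.pi * z.im) - Real.exp (-(Real.pi * z.im)))]

theorem stripGrowth_pi_div_sin (c d : ℝ) :
    StripGrowth (fun z => Real.pi / Complex.sin (Real.pi * z)) c d (-Real.pi) := by
  refine ⟨4 * Real.pi, 0, fun z _ _ h => ?_⟩
  have h1 := exp_le_norm_sin h
  have h0 : 0 < Real.exp (Real.pi * |z.im|) := Real.exp_pos _
  have h2 : 0 < ‖Complex.sin (Real.pi * z)‖ := by linarith
  rw [norm_div, Complex.norm_real, Real.norm_of_nonneg Real.pi_pos.le, pow_zero, mul_one,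
    neg_mul, Real.exp_neg, div_le_iff₀ h2]
  have h3 : 1 ≤ 4 * (Real.exp (Real.pi * |z.im|))⁻¹ * ‖Complex.sin (Real.pi * z)‖ := by
    rw [mul_right_comm, ← div_eq_mul_inv, le_div_iff₀ h0]
    linarith
  nlinarith [Real.pi_pos]

/-- Polynomial boundedness in a vertical strip. -/
def StripPoly (f : ℂ → ℂ) (c d : ℝ) : Prop :=
  ∃ (C : ℝ) (N : ℕ), ∀ z : ℂ, c ≤ z.re → z.re ≤ d → ‖f z‖ ≤ C * (1 + |z.im|) ^ N

theorem StripPoly.mul {f g : ℂ → ℂ} {c d : ℝ} (hf : StripPoly f c d)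
    (hg : StripPoly g c d) : StripPoly (fun z => f z * g z) c d := by
  obtain ⟨C, N, h⟩ := hf
  obtain ⟨D, M, k⟩ := hg
  refine ⟨C * D, N + M, fun z h1 h2 => ?_⟩
  rw [norm_mul]
  calc ‖f z‖ * ‖g z‖ ≤ (C * (1 + |z.im|) ^ N) * (D * (1 + |z.im|) ^ M) :=
        mul_le_mul (h z h1 h2) (k z h1 h2) (norm_nonneg _) ((norm_nonneg _).trans (h z h1 h2))
    _ = _ := by rw [pow_add]; ring

theorem StripPoly.growth {f : ℂ → ℂ} {c d : ℝ} (hf : StripPoly f c d) : StripGrowth f c d 0 := by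
  obtain ⟨C, N, h⟩ := hf
  exact ⟨C, N, fun z h1 h2 _ => by simpa using h z h1 h2⟩

theorem stripPoly_add_const (a : ℂ) (c d : ℝ) : StripPoly (fun z => z + a) c d := by
  refine ⟨1 + |c| + |d| + ‖a‖, 1, fun z h1 h2 => ?_⟩
  have h4 : |z.re| ≤ |c| + |d| := by
    rw [abs_le]
    constructor
    · linarith [neg_abs_le c, abs_nonneg d]
    · linarith [le_abs_self d, abs_nonneg c]
  have h5 := Complex.norm_le_abs_re_add_abs_im z
  have h6 := norm_add_le z a
  rw [pow_one]
  nlinarith [abs_nonneg c, abs_nonneg d, norm_nonneg a, abs_nonneg z.im]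

theorem norm_betaIntegral_le {ε δ : ℝ} (hε : 0 < ε) (hδ : 0 < δ) :
    ∃ K : ℝ, ∀ u v : ℂ, ε ≤ u.re → δ ≤ v.re → ‖Complex.betaIntegral u v‖ ≤ K := by
  have hcv := Complex.betaIntegral_convergent (u := (ε : ℂ)) (v := (δ : ℂ)) (by simpa) (by simpa)
  refine ⟨∫ x in (0 : ℝ)..1, ‖(x : ℂ) ^ ((ε : ℂ) - 1) * (1 - (x : ℂ)) ^ ((δ : ℂ) - 1)‖,
    fun u v hu hv => ?_⟩
  rw [Complex.betaIntegral]
  refine intervalIntegral.norm_integral_le_of_norm_le zero_le_one ?_ hcv.norm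
  have hne : ∀ᵐ x : ℝ, x ≠ 1 := by
    simp [ae_iff, measure_singleton]
  filter_upwards [hne] with x hx1 hx
  have h0 : 0 < x := hx.1
  have h1 : 0 < 1 - x := sub_pos.2 (lt_of_le_of_ne hx.2 hx1)
  have e1 : (1 : ℂ) - (x : ℂ) = ((1 - x : ℝ) : ℂ) := by push_cast; ring
  rw [norm_mul, norm_mul, e1, Complex.norm_cpow_eq_rpow_re_of_pos h0,
    Complex.norm_cpow_eq_rpow_re_of_pos h1, Complex.norm_cpow_eq_rpow_re_of_pos h0,
    Complex.norm_cpow_eq_rpow_re_of_pos h1]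
  have r1 : x ^ (u - 1).re ≤ x ^ ((ε : ℂ) - 1).re :=
    Real.rpow_le_rpow_of_exponent_ge h0 hx.2 (by simpa using hu)
  have r2 : (1 - x) ^ (v - 1).re ≤ (1 - x) ^ ((δ : ℂ) - 1).re :=
    Real.rpow_le_rpow_of_exponent_ge h1 (by linarith) (by simpa using hv)
  exact mul_le_mul r1 r2 (Real.rpow_nonneg h1.le _) (Real.rpow_nonneg h0.le _)

/-- Quotients of Gamma functions are polynomially bounded: after raising the denominator by
the functional equation, the quotient is a Beta integral up to a constant factor. -/
theorem stripPoly_Gamma_mul_inv (α β : ℂ) {c d : ℝ} (h : 0 < c + α.re) :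
    StripPoly (fun z => Complex.Gamma (z + α) * (Complex.Gamma (z + β))⁻¹) c d := by
  have step : ∀ n : ℕ, ∀ β : ℂ, (β + n - α).re > 0 →
      StripPoly (fun z => Complex.Gamma (z + α) * (Complex.Gamma (z + β))⁻¹) c d := by
    intro n
    induction n with
    | zero =>
      intro β hβ
      rw [Nat.cast_zero, add_zero] at hβ
      obtain ⟨K, hK⟩ := norm_betaIntegral_le h hβ
      refine ⟨K * ‖(Complex.Gamma (β - α))⁻¹‖, 0, fun z h1 h2 => ?_⟩
      have hz : 0 < (z + α).re := by rw [Complex.add_re]; linarith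
      have hB := Complex.Gamma_mul_Gamma_eq_betaIntegral hz hβ
      rw [show z + α + (β - α) = z + β by ring] at hB
      have hzβ : 0 < (z + β).re := by
        rw [Complex.add_re]; rw [Complex.add_re] at hz; rw [gt_iff_lt, Complex.sub_re] at hβ
        linarith
      have n1 := Complex.Gamma_ne_zero_of_re_pos hzβ
      have n2 := Complex.Gamma_ne_zero_of_re_pos hβ
      have e : Complex.Gamma (z + α) * (Complex.Gamma (z + β))⁻¹ =
          Complex.betaIntegral (z + α) (β - α) * (Complex.Gamma (β - α))⁻¹ := by
        field_simp
        linear_combination hB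
      simp only [e]
      rw [norm_mul, pow_zero, mul_one]
      gcongr
      exact hK _ _ (by rw [Complex.add_re]; linarith) le_rfl
    | succ k ih =>
      intro β hβ
      have h1 := ih (β + 1) (by
        have : β + 1 + (k : ℂ) - α = β + ((k + 1 : ℕ) : ℂ) - α := by push_cast; ring
        rw [this]; exact hβ)
      have h2 := h1.mul (stripPoly_add_const β c d)
      have e : (fun z => Complex.Gamma (z + α) * (Complex.Gamma (z + β))⁻¹) = fun z =>
          Complex.Gamma (z + α) * (Complex.Gamma (z + (β + 1)))⁻¹ * (z + β) := by
        funext z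
        rw [Complex.one_div_Gamma_eq_self_mul_one_div_Gamma_add_one (z + β),
          show z + β + 1 = z + (β + 1) by ring]
        ring
      rw [e]
      exact h2
  -- `n` steps of the functional equation bring the second argument to the right of the first
  obtain ⟨n, hn⟩ := exists_nat_gt (-(β - α).re)
  refine step n β ?_
  simp only [Complex.sub_re, Complex.add_re, Complex.natCast_re] at hn ⊢
  linarith

theorem stripGrowth_Gamma_mul_Gamma_sub (a b : ℝ) {c d : ℝ} (h : 0 < c + a) :
    StripGrowth (fun z => Complex.Gamma (z + a) * Complex.Gamma (b - z)) c d (-Real.pi) := by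
  have h1 := (stripPoly_Gamma_mul_inv (a : ℂ) (1 - b : ℂ) (c := c) (d := d) (by simpa)).growth
  have h2 : StripGrowth (fun z : ℂ => Real.pi / Complex.sin (Real.pi * (b - z))) c d
      (-Real.pi) := by
    obtain ⟨C, N, hC⟩ := stripGrowth_pi_div_sin (b - d) (b - c)
    refine ⟨C, N, fun z h1 h2 h3 => ?_⟩
    have := hC (b - z) (by simp only [Complex.sub_re, Complex.ofReal_re]; linarith)
      (by simp only [Complex.sub_re, Complex.ofReal_re]; linarith) (by simpa using h3)
    simpa using this
  refine ((h1.mul h2).rate (by ring)).congr fun z _ _ hz => ?_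
  have h3 := Complex.Gamma_mul_Gamma_one_sub ((b : ℂ) - z)
  rw [show 1 - ((b : ℂ) - z) = z + (1 - b) by ring] at h3
  have h4 : Complex.Gamma (z + (1 - (b : ℂ))) ≠ 0 := by
    refine Complex.Gamma_ne_zero fun m hm => ?_
    have := congrArg Complex.im hm
    simp at this
    rw [this] at hz
    norm_num at hz
  rw [← h3]
  field_simp

theorem mul_inv_eq_mul_inv_of_mul_eq {x y z b : ℂ} (hy : y ≠ 0) (hz : z ≠ 0)
    (h : x * y = z * b) : x * z⁻¹ = b * y⁻¹ := by
  field_simp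
  linear_combination h

/-- A bound for the kernel `Γ(τ - s) / Γ(M + τ + s)` that is uniform in `Im τ`: the kernel is
`B(τ - s, M + 2 s) / Γ(M + 2 s)`, and the duplication formula compares `Γ(M + 2 s)` with
`Γ(s + a) Γ(s + b)`. -/
theorem norm_kernel_le (a b M : ℝ) {c d e : ℝ} (hde : d < e) (hM : 0 < M + 2 * c)
    (ha : 0 < c + a) (hb : 0 < c + b) :
    ∃ (C : ℝ) (N : ℕ), ∀ s τ : ℂ, c ≤ s.re → s.re ≤ d → e ≤ τ.re →
      ‖Complex.Gamma (s + a) * Complex.Gamma (s + b) *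
        (Complex.Gamma (τ - s) * (Complex.Gamma (M + τ + s))⁻¹)‖ ≤ C * (1 + |s.im|) ^ N := by
  obtain ⟨K, hK⟩ := norm_betaIntegral_le (sub_pos.2 hde) hM
  obtain ⟨C, N, hC⟩ := (stripPoly_Gamma_mul_inv (a : ℂ) ((M / 2 : ℝ) : ℂ) (c := c) (d := d)
    (by simpa)).mul (stripPoly_Gamma_mul_inv (b : ℂ) ((M / 2 + 1 / 2 : ℝ) : ℂ) (c := c) (d := d)
    (by simpa))
  refine ⟨C * (K * (2 ^ (1 - M - 2 * c) * Real.sqrt Real.pi)), N, fun s τ h1 h2 h3 => ?_⟩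
  have q1 : 0 < (τ - s).re := by rw [Complex.sub_re]; linarith
  have q2 : 0 < ((M : ℂ) + 2 * s).re := by simp; linarith
  have q3 : 0 < ((M : ℂ) + τ + s).re := by simp at q2 ⊢; linarith
  have q4 : 0 < (s + ((M / 2 : ℝ) : ℂ)).re := by simp at q2 ⊢; linarith
  have q5 : 0 < (s + ((M / 2 + 1 / 2 : ℝ) : ℂ)).re := by
    simp only [Complex.add_re, Complex.ofReal_re] at q4 ⊢; linarith
  have hB := Complex.Gamma_mul_Gamma_eq_betaIntegral q1 q2
  rw [show τ - s + (M + 2 * s) = (M : ℂ) + τ + s by ring] at hB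
  -- the duplication formula at `s + M / 2`
  have hD := Complex.Gamma_mul_Gamma_add_half (s + ((M / 2 : ℝ) : ℂ))
  rw [show s + ((M / 2 : ℝ) : ℂ) + 1 / 2 = s + ((M / 2 + 1 / 2 : ℝ) : ℂ) by push_cast; ring,
    show 2 * (s + ((M / 2 : ℝ) : ℂ)) = (M : ℂ) + 2 * s by push_cast; ring,
    show 1 - (M + 2 * s) = 1 - (M : ℂ) - 2 * s by ring] at hD
  have n2 := Complex.Gamma_ne_zero_of_re_pos q2
  have n3 := Complex.Gamma_ne_zero_of_re_pos q3
  have n4 := Complex.Gamma_ne_zero_of_re_pos q4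
  have n5 := Complex.Gamma_ne_zero_of_re_pos q5
  have e : Complex.Gamma (s + a) * Complex.Gamma (s + b) *
      (Complex.Gamma (τ - s) * (Complex.Gamma (M + τ + s))⁻¹) =
      (Complex.Gamma (s + a) * (Complex.Gamma (s + ((M / 2 : ℝ) : ℂ)))⁻¹ *
        (Complex.Gamma (s + b) * (Complex.Gamma (s + ((M / 2 + 1 / 2 : ℝ) : ℂ)))⁻¹)) *
      (Complex.betaIntegral (τ - s) (M + 2 * s) *
        ((2 : ℂ) ^ (1 - (M : ℂ) - 2 * s) * (Real.sqrt Real.pi : ℂ))) := by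
    have e1 : Complex.Gamma (τ - s) * (Complex.Gamma (M + τ + s))⁻¹ =
        Complex.betaIntegral (τ - s) (M + 2 * s) * (Complex.Gamma (M + 2 * s))⁻¹ := by
      exact mul_inv_eq_mul_inv_of_mul_eq n2 n3 hB
    have e2 : (Complex.Gamma (M + 2 * s))⁻¹ =
        ((2 : ℂ) ^ (1 - (M : ℂ) - 2 * s) * (Real.sqrt Real.pi : ℂ)) *
        ((Complex.Gamma (s + ((M / 2 : ℝ) : ℂ)))⁻¹ *
          (Complex.Gamma (s + ((M / 2 + 1 / 2 : ℝ) : ℂ)))⁻¹) := by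
      rw [eq_comm, ← mul_eq_one_iff_eq_inv₀ n2, mul_comm]
      calc _ = (Complex.Gamma (M + 2 * s) * (2 : ℂ) ^ (1 - (M : ℂ) - 2 * s) *
            (Real.sqrt Real.pi : ℂ)) * ((Complex.Gamma (s + ((M / 2 : ℝ) : ℂ)))⁻¹ *
            (Complex.Gamma (s + ((M / 2 + 1 / 2 : ℝ) : ℂ)))⁻¹) := by ring
        _ = 1 := by rw [← hD, ← mul_inv, mul_inv_cancel₀ (mul_ne_zero n4 n5)]
    rw [e1, e2]
    ring
  have h2s : ‖(2 : ℂ) ^ (1 - (M : ℂ) - 2 * s)‖ ≤ 2 ^ (1 - M - 2 * c) := by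
    have := Complex.norm_cpow_eq_rpow_re_of_pos (x := 2) two_pos (1 - (M : ℂ) - 2 * s)
    rw [Complex.ofReal_ofNat] at this
    rw [this]
    refine Real.rpow_le_rpow_of_exponent_le one_le_two ?_
    simp
    linarith
  rw [e, norm_mul, norm_mul (Complex.betaIntegral _ _), norm_mul ((2 : ℂ) ^ _), Complex.norm_real,
    Real.norm_of_nonneg (Real.sqrt_nonneg _)]
  have hK' := hK (τ - s) (M + 2 * s) (by rw [Complex.sub_re]; linarith) (by simp; linarith)
  have hC' := hC s h1 h2
  calc _ ≤ (C * (1 + |s.im|) ^ N) * (K * (2 ^ (1 - M - 2 * c) * Real.sqrt Real.pi)) := by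
        refine mul_le_mul hC' (mul_le_mul hK' ?_ (by positivity) ((norm_nonneg _).trans hK'))
          (by positivity) ((norm_nonneg _).trans hC')
        gcongr
    _ = _ := by ring

/-! ### Residues at the poles of `(π / sin πz)²` -/

theorem sin_pi_mul_ne_zero {z : ℂ} (h : ∀ k : ℤ, z ≠ k) : Complex.sin (Real.pi * z) ≠ 0 := by
  intro h0
  obtain ⟨k, hk⟩ := Complex.sin_eq_zero_iff.1 h0
  refine h k ?_
  have hpi : (Real.pi : ℂ) ≠ 0 := by exact_mod_cast Real.pi_ne_zero
  exact mul_left_cancel₀ hpi (by rw [hk]; ring)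

theorem sin_pi_mul_int_add (m : ℤ) (z : ℂ) :
    Complex.sin (Real.pi * (m + z)) = (-1) ^ m * Complex.sin (Real.pi * z) := by
  rw [show (Real.pi : ℂ) * (m + z) = Real.pi * z + m * Real.pi by ring,
    Complex.sin_antiperiodic.add_int_mul_eq m, Int.coe_negOnePow]
  rcases Int.even_or_odd m with h | h
  · rw [h.neg_one_zpow, (Int.natAbs_even.2 h).neg_one_pow]
  · rw [h.neg_one_zpow, (Int.natAbs_odd.2 h).neg_one_pow]

/-- The difference of the integrals of `φ(z) (π / sin πz)²` along two lines at distance `1` is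
the residue at the integer between them. There is no contribution from the second factor, since
`(z - m) π / sin πz` is even about `m`. -/
theorem vline_sub_vline_sin {φ : ℂ → ℂ} {c r : ℝ} (m : ℤ) (hc : c < m) (hm : m < c + 1)
    (hr : r < 0) (hφ : ∀ z : ℂ, c ≤ z.re → z.re ≤ c + 1 → DifferentiableAt ℂ φ z)
    (hf : StripGrowth (fun z => φ z * (Real.pi / Complex.sin (Real.pi * z)) ^ 2) c (c + 1) r) :
    vline (c + 1) (fun z => φ z * (Real.pi / Complex.sin (Real.pi * z)) ^ 2) -
      vline c (fun z => φ z * (Real.pi / Complex.sin (Real.pi * z)) ^ 2) = deriv φ m := by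
  have hpi : (Real.pi : ℂ) ≠ 0 := by exact_mod_cast Real.pi_ne_zero
  set S : ℂ → ℂ := fun z => Complex.sin (Real.pi * z) with hS
  have hSd : Differentiable ℂ S := by rw [hS]; fun_prop
  have hS0 : S m = 0 := by
    have := sin_pi_mul_int_add m 0
    simpa [hS] using this
  have hS' : deriv S m = Real.pi * Complex.cos (Real.pi * m) := by
    have h1 : HasDerivAt (fun z : ℂ => (Real.pi : ℂ) * z) Real.pi (m : ℂ) := by
      simpa using (hasDerivAt_id (m : ℂ)).const_mul (Real.pi : ℂ)
    rw [hS, h1.csin.deriv, mul_comm]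
  set σ := dslope S (m : ℂ) with hσ
  have hσd : Differentiable ℂ σ := by
    have := (Complex.differentiableOn_dslope (s := univ) (c := (m : ℂ)) univ_mem).2
      hSd.differentiableOn
    exact differentiableOn_univ.1 this
  have hσm : σ m ^ 2 = Real.pi ^ 2 := by
    have h1 := Complex.sin_sq_add_cos_sq (Real.pi * m)
    have h2 : Complex.sin (Real.pi * m) = 0 := hS0
    rw [hσ, dslope_same, hS']
    rw [h2] at h1
    linear_combination (Real.pi : ℂ) ^ 2 * h1
  have hσz : ∀ z : ℂ, z ≠ m → σ z = S z / (z - m) := by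
    intro z hz
    rw [hσ, dslope_of_ne _ hz, slope_def_field, hS0, sub_zero]
  have heven : ∀ z : ℂ, σ (2 * m - z) = σ z := by
    intro z
    by_cases hz : z = m
    · rw [hz]; congr 1; ring
    · have h1 : 2 * (m : ℂ) - z ≠ m := fun h => hz (by linear_combination -h)
      rw [hσz _ h1, hσz _ hz]
      have h2 : S (2 * m - z) = - S z := by
        have h3 := sin_pi_mul_int_add (2 * m) (-z)
        rw [zpow_mul] at h3
        simp only [hS]
        push_cast at h3
        rw [sub_eq_add_neg, h3]
        simp
      rw [h2, show 2 * (m : ℂ) - z - m = -(z - m) by ring, neg_div_neg_eq]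
  have hσ' : deriv σ m = 0 := by
    have h1 : HasDerivAt (fun z : ℂ => σ (2 * m - z)) (-deriv σ m) (m : ℂ) := by
      have h2 : HasDerivAt σ (deriv σ m) (2 * (m : ℂ) - m) := by
        rw [show 2 * (m : ℂ) - m = m by ring]
        exact (hσd _).hasDerivAt
      have h3 : HasDerivAt (fun z : ℂ => 2 * (m : ℂ) - z) (-1) (m : ℂ) := by
        simpa using (hasDerivAt_id (m : ℂ)).const_sub (2 * (m : ℂ))
      exact (h2.comp (m : ℂ) h3).congr_deriv (by ring)
    simp_rw [heven] at h1
    have h4 := h1.deriv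
    exact self_eq_neg.1 h4
  have hint : ∀ z : ℂ, c ≤ z.re → z.re ≤ c + 1 → z ≠ m → S z ≠ 0 := by
    intro z h1 h2 h3
    refine sin_pi_mul_ne_zero fun k hk => h3 ?_
    rw [hk] at h1 h2 ⊢
    simp only [Complex.intCast_re] at h1 h2
    have e1 : (k : ℝ) < m + 1 := by linarith
    have e2 : (m : ℝ) < k + 1 := by linarith
    have e3 : k < m + 1 := by exact_mod_cast e1
    have e4 : m < k + 1 := by exact_mod_cast e2
    have : k = m := by omega
    rw [this]
  have hσ0 : ∀ z : ℂ, c ≤ z.re → z.re ≤ c + 1 → σ z ≠ 0 := by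
    intro z h1 h2
    by_cases hz : z = m
    · rw [hz]
      intro h0
      rw [h0] at hσm
      exact hpi (pow_eq_zero_iff two_ne_zero |>.1 (by rw [← hσm]; ring))
    · rw [hσz z hz]
      exact div_ne_zero (hint z h1 h2 hz) (sub_ne_zero.2 hz)
  have key := vline_sub_vline (f := fun z => φ z * (Real.pi / Complex.sin (Real.pi * z)) ^ 2)
    (g := fun z => φ z * (Real.pi ^ 2 / σ z ^ 2)) (c := c) (d := c + 1) (m := (m : ℝ)) hc hm hr
    (fun z h1 h2 => (hφ z h1 h2).mul
      ((differentiableAt_const _).div ((hσd z).pow 2) (pow_ne_zero 2 (hσ0 z h1 h2))))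
    (fun z h1 h2 h3 => by
      have h3' : z ≠ m := by simpa using h3
      have h4 : z - m ≠ 0 := sub_ne_zero.2 h3'
      have h5 : Complex.sin (Real.pi * z) ≠ 0 := hint z h1 h2 h3'
      simp only [hσz z h3', hS, Complex.ofReal_intCast]
      field_simp) hf
  rw [key, Complex.ofReal_intCast]
  have hm1 : c ≤ (m : ℂ).re := by simpa using hc.le
  have hm2 : (m : ℂ).re ≤ c + 1 := by simpa using hm.le
  have hd1 := (hφ m hm1 hm2).hasDerivAt
  have hd2 : HasDerivAt (fun z => (Real.pi : ℂ) ^ 2 / σ z ^ 2) 0 (m : ℂ) := by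
    have := (hasDerivAt_const (m : ℂ) ((Real.pi : ℂ) ^ 2)).div ((hσd m).hasDerivAt.pow 2)
      (pow_ne_zero 2 (hσ0 m hm1 hm2))
    refine this.congr_deriv ?_
    rw [hσ']
    simp
  have hd3 : HasDerivAt (fun z => φ z * ((Real.pi : ℂ) ^ 2 / σ z ^ 2)) _ (m : ℂ) := hd1.mul hd2
  rw [hd3.deriv, hσm, div_self (pow_ne_zero 2 hpi)]
  ring

/-! ### An integral of Saalschütz type -/

theorem differentiableAt_Gamma_add {a s : ℂ} (h : 0 < (a + s).re) :
    DifferentiableAt ℂ (fun s => Complex.Gamma (a + s)) s := by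
  have h1 : DifferentiableAt ℂ Complex.Gamma (a + s) := by
    refine Complex.differentiableAt_Gamma _ fun m hm => ?_
    rw [hm] at h
    simp at h
    linarith [(Nat.cast_nonneg m : (0 : ℝ) ≤ m)]
  exact h1.comp s (by fun_prop)

theorem differentiableAt_Gamma_sub {a s : ℂ} (h : 0 < (a - s).re) :
    DifferentiableAt ℂ (fun s => Complex.Gamma (a - s)) s := by
  have h1 : DifferentiableAt ℂ Complex.Gamma (a - s) := by
    refine Complex.differentiableAt_Gamma _ fun m hm => ?_
    rw [hm] at h
    simp at h
    linarith [(Nat.cast_nonneg m : (0 : ℝ) ≤ m)]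
  exact h1.comp s (by fun_prop)

theorem differentiable_Gamma_inv_add (a : ℂ) :
    Differentiable ℂ (fun s => (Complex.Gamma (a + s))⁻¹) :=
  Complex.differentiable_one_div_Gamma.comp (by fun_prop)

theorem Gamma_add_one_of_re_pos {z : ℂ} (h : 0 < z.re) :
    Complex.Gamma (z + 1) = z * Complex.Gamma z :=
  Complex.Gamma_add_one z fun h0 => by simp [h0] at h

theorem Gamma_inv_eq (z : ℂ) : (Complex.Gamma z)⁻¹ = z * (Complex.Gamma (z + 1))⁻¹ :=
  Complex.one_div_Gamma_eq_self_mul_one_div_Gamma_add_one z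

theorem fact_add_one {n : ℤ} (h : 0 ≤ n) : fact (n + 1) = (n + 1) * fact n := by
  obtain ⟨k, rfl⟩ := Int.eq_ofNat_of_zero_le h
  rw [fact, fact, show ((k : ℤ) + 1).toNat = k + 1 by omega, Int.toNat_natCast,
    Nat.factorial_succ]
  push_cast
  ring

theorem fact_zero : fact 0 = 1 := by simp [fact]

theorem fact_ne_zero (n : ℤ) : fact n ≠ 0 := by
  rw [fact]; exact_mod_cast Nat.factorial_ne_zero _

theorem Gamma_int_add_one {n : ℤ} (h : 0 ≤ n) : Complex.Gamma ((n : ℂ) + 1) = fact n := by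
  obtain ⟨k, rfl⟩ := Int.eq_ofNat_of_zero_le h
  rw [fact, Int.toNat_natCast, ← Complex.Gamma_nat_eq_factorial]
  simp

theorem Gamma_inv_int_eq_zero {n : ℤ} (h : n ≤ 0) : (Complex.Gamma (n : ℂ))⁻¹ = 0 := by
  obtain ⟨k, hk⟩ := Int.eq_ofNat_of_zero_le (neg_nonneg.2 h)
  rw [inv_eq_zero, Complex.Gamma_eq_zero_iff]
  refine ⟨k, ?_⟩
  rw [show n = -(k : ℤ) by omega]
  push_cast
  ring

theorem sin_pi_mul_ne_zero_of_re {z : ℂ} {c : ℝ} {m : ℤ} (hz : z.re = c) (h1 : (m : ℝ) < c)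
    (h2 : c < m + 1) : Complex.sin (Real.pi * z) ≠ 0 := by
  refine sin_pi_mul_ne_zero fun k hk => ?_
  have h3 : (k : ℝ) = c := by rw [← hz, hk]; simp
  have h4 : m < k := by exact_mod_cast h3 ▸ h1
  have h5 : k < m + 1 := by exact_mod_cast h3 ▸ h2
  omega

noncomputable section

/-- The function `Γ(x + s) Γ(y + s) Γ(w + s) / Γ(x + y + w - n + s)`. -/
def saalFun (n x y w : ℤ) (s : ℂ) : ℂ :=
  Complex.Gamma (x + s) * Complex.Gamma (y + s) * Complex.Gamma (w + s) *
    (Complex.Gamma ((x + y + w - n : ℤ) + s))⁻¹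

/-- The kernel `Γ(τ - s) / Γ(1 + n + τ + s)`. -/
def kern (n : ℤ) (s τ : ℂ) : ℂ :=
  Complex.Gamma (τ - s) * (Complex.Gamma (1 + n + τ + s))⁻¹

/-- The quotient `Γ(x + τ) / Γ(1 + n - x + τ)`. -/
def wpQuot (n x : ℤ) (τ : ℂ) : ℂ :=
  Complex.Gamma (x + τ) * (Complex.Gamma (1 + n - x + τ))⁻¹

/-- The function whose antiperiodic difference produces the contiguous relation. -/
def saalAux (n x y w : ℤ) (τ s : ℂ) : ℂ :=
  saalFun n x y w s * (Complex.Gamma (τ + 1 - s) * (Complex.Gamma (n + τ + s))⁻¹)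

end

theorem saalFun_growth (n x y w : ℤ) {c d e M : ℝ} (hx : 0 < c + x) (hy : 0 < c + y)
    (hw : 0 < c + w) (hM : 0 < M + 2 * c) (hde : d < e) :
    ∃ (C : ℝ) (N : ℕ), ∀ s τ : ℂ, c ≤ s.re → s.re ≤ d → e ≤ τ.re →
      ‖saalFun n x y w s * (Complex.Gamma (τ - s) * (Complex.Gamma (M + τ + s))⁻¹)‖ ≤
        C * (1 + |s.im|) ^ N := by
  obtain ⟨C, N, h⟩ := norm_kernel_le x y M hde hM hx hy
  obtain ⟨D, K, k⟩ := stripPoly_Gamma_mul_inv (w : ℂ) ((x + y + w - n : ℤ) : ℂ) (c := c) (d := d)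
    (by simpa)
  refine ⟨C * D, N + K, fun s τ h1 h2 h3 => ?_⟩
  have e1 := h s τ h1 h2 h3
  have e2 := k s h1 h2
  have e : saalFun n x y w s * (Complex.Gamma (τ - s) * (Complex.Gamma (M + τ + s))⁻¹) =
      (Complex.Gamma (s + (x : ℝ)) * Complex.Gamma (s + (y : ℝ)) *
        (Complex.Gamma (τ - s) * (Complex.Gamma (M + τ + s))⁻¹)) *
      (Complex.Gamma (s + w) * (Complex.Gamma (s + (x + y + w - n : ℤ)))⁻¹) := by
    simp only [saalFun, Complex.ofReal_intCast, add_comm s]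
    ring
  rw [e, norm_mul]
  calc _ ≤ (C * (1 + |s.im|) ^ N) * (D * (1 + |s.im|) ^ K) :=
        mul_le_mul e1 e2 (norm_nonneg _) ((norm_nonneg _).trans e1)
    _ = _ := by rw [pow_add]; ring

theorem saalFun_differentiableAt (n x y w : ℤ) {s : ℂ} (hx : 0 < s.re + x) (hy : 0 < s.re + y)
    (hw : 0 < s.re + w) : DifferentiableAt ℂ (saalFun n x y w) s := by
  unfold saalFun
  refine (((differentiableAt_Gamma_add ?_).mul (differentiableAt_Gamma_add ?_)).mul
    (differentiableAt_Gamma_add ?_)).mul (differentiable_Gamma_inv_add _ s) <;>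
  · simp; linarith

theorem kern_differentiableAt_left (n : ℤ) {s τ : ℂ} (h : s.re < τ.re) :
    DifferentiableAt ℂ (fun s => kern n s τ) s :=
  (differentiableAt_Gamma_sub (by simpa using h)).mul (differentiable_Gamma_inv_add _ s)

section
variable {n x y w : ℤ} {c : ℝ} {τ : ℂ}

/-- Integrability of `saalFun · kern · π / sin πs` on vertical lines. -/
theorem saal_lineIntegrable (hwx : w ≤ x) (hwy : w ≤ y) (hn : 2 * w ≤ n) (hc1 : -(w : ℝ) < c)
    (hc2 : c < 1 - w) (hτ : c < τ.re) :
    LineIntegrable (fun s => saalFun n x y w s * kern n s τ *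
      (Real.pi / Complex.sin (Real.pi * s))) c := by
  have hwx' : (w : ℝ) ≤ x := by exact_mod_cast hwx
  have hwy' : (w : ℝ) ≤ y := by exact_mod_cast hwy
  have hn' : 2 * (w : ℝ) ≤ n := by exact_mod_cast hn
  have hg : StripGrowth (fun s => saalFun n x y w s * kern n s τ *
      (Real.pi / Complex.sin (Real.pi * s))) c c (-Real.pi) := by
    obtain ⟨C, N, h⟩ := saalFun_growth n x y w (c := c) (d := c) (e := τ.re) (M := 1 + n)
      (by linarith) (by linarith) (by linarith) (by linarith) hτ
    have h1 : StripGrowth (fun s => saalFun n x y w s * kern n s τ) c c 0 := by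
      refine ⟨C, N, fun s h1 h2 _ => ?_⟩
      have := h s τ h1 h2 le_rfl
      simpa [kern] using this
    exact (h1.mul (stripGrowth_pi_div_sin c c)).rate (by ring)
  refine hg.lineIntegrable (by linarith [Real.pi_pos]) le_rfl le_rfl fun s hs => ?_
  have d1 : DifferentiableAt ℂ (saalFun n x y w) s := by
    refine saalFun_differentiableAt n x y w ?_ ?_ ?_ <;> rw [hs] <;> linarith
  have d2 : DifferentiableAt ℂ (fun s => kern n s τ) s :=
    kern_differentiableAt_left n (by rw [hs]; exact hτ)
  have d3 : DifferentiableAt ℂ (fun s => Real.pi / Complex.sin (Real.pi * s)) s :=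
    (differentiableAt_const _).div (by fun_prop)
      (sin_pi_mul_ne_zero_of_re (m := -w) hs (by push_cast; linarith) (by push_cast; linarith))
  exact ((d1.mul d2).mul d3).continuousAt

/-- The contiguous relation between the parameters `x` and `x + 1`. The boundary term is the
residue at the only integer in the strip `c < Re s < c + 1`. -/
theorem saal_recurrence (hwx : w ≤ x) (hwy : w ≤ y) (hn : 2 * w ≤ n) (hc1 : -(w : ℝ) < c)
    (hc2 : c < 1 - w) (hτ : c < τ.re) :
    (τ + x) * (τ + n - x) * vline c (fun s => saalFun n x y w s * kern n s τ *
        (Real.pi / Complex.sin (Real.pi * s))) +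
      (n - x - y) * (n - x - w) * vline c (fun s => saalFun n (x + 1) y w s * kern n s τ *
        (Real.pi / Complex.sin (Real.pi * s))) =
      (-1) ^ w * saalAux n x y w τ (1 - w) := by
  have hwx' : (w : ℝ) ≤ x := by exact_mod_cast hwx
  have hwy' : (w : ℝ) ≤ y := by exact_mod_cast hwy
  have hn' : 2 * (w : ℝ) ≤ n := by exact_mod_cast hn
  have hpi : (Real.pi : ℂ) ≠ 0 := by exact_mod_cast Real.pi_ne_zero
  set U := saalAux n x y w τ with hU
  have hUd : ∀ z : ℂ, c ≤ z.re → z.re ≤ c + 1 → DifferentiableAt ℂ U z := by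
    intro z h1 h2
    refine (saalFun_differentiableAt n x y w ?_ ?_ ?_).mul
      ((differentiableAt_Gamma_sub ?_).mul (differentiable_Gamma_inv_add _ z))
    · linarith
    · linarith
    · linarith
    · simp; linarith
  have hUg : StripGrowth U c (c + 1) 0 := by
    obtain ⟨C, N, h⟩ := saalFun_growth n x y w (c := c) (d := c + 1) (e := τ.re + 1) (M := 1 + n)
      (by linarith) (by linarith) (by linarith) (by linarith) (by linarith)
    have h1 : StripGrowth (fun s => saalFun n x y w s * (Complex.Gamma (τ + 1 - s) *
        (Complex.Gamma ((1 + n : ℝ) + (τ + 1) + s))⁻¹)) c (c + 1) 0 :=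
      ⟨C, N, fun s h1 h2 _ => by simpa using h s (τ + 1) h1 h2 (by simp)⟩
    have h2 := (h1.mul (stripGrowth_add_const (n + τ) c (c + 1))).mul
      (stripGrowth_add_const (n + τ + 1) c (c + 1))
    refine (h2.rate (by ring)).congr fun s _ _ _ => ?_
    rw [hU, saalAux, Gamma_inv_eq (n + τ + s), Gamma_inv_eq (n + τ + s + 1)]
    have : ((1 + n : ℝ) : ℂ) + (τ + 1) + s = n + τ + s + 1 + 1 := by push_cast; ring
    rw [this]
    ring
  -- the simple poles of `U π / sin πs` are read as poles of `φ (π / sin πs)²`, with the numerator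
  -- `φ` vanishing at the integers
  set φ : ℂ → ℂ := fun s => U s * (Complex.sin (Real.pi * s) / Real.pi) with hφ
  have hφs : ∀ s, φ s * (Real.pi / Complex.sin (Real.pi * s)) ^ 2 =
      U s * (Real.pi / Complex.sin (Real.pi * s)) := by
    intro s
    by_cases h : Complex.sin (Real.pi * s) = 0
    · simp [hφ, h]
    · simp only [hφ]; field_simp
  have hres := vline_sub_vline_sin (φ := φ) (c := c) (r := -Real.pi) (1 - w)
    (by push_cast; linarith) (by push_cast; linarith) (by linarith [Real.pi_pos])
    (fun z h1 h2 => (hUd z h1 h2).mul (by fun_prop))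
    (by simp_rw [hφs]; exact (hUg.mul (stripGrowth_pi_div_sin c (c + 1))).rate (by ring))
  simp_rw [hφs] at hres
  have hd : deriv φ ((1 - w : ℤ) : ℂ) = -((-1) ^ w * U (1 - w)) := by
    have h0 : DifferentiableAt ℂ U ((1 - w : ℤ) : ℂ) :=
      hUd _ (by simp; linarith) (by simp; linarith)
    have h1 : HasDerivAt (fun z : ℂ => (Real.pi : ℂ) * z) Real.pi (((1 - w : ℤ) : ℂ)) := by
      simpa using (hasDerivAt_id (((1 - w : ℤ) : ℂ))).const_mul (Real.pi : ℂ)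
    have h2 : HasDerivAt φ _ ((1 - w : ℤ) : ℂ) := h0.hasDerivAt.mul (h1.csin.div_const _)
    have h3 : Complex.sin (Real.pi * ((1 - w : ℤ) : ℂ)) = 0 := by
      have := sin_pi_mul_int_add (1 - w) 0
      simpa using this
    have h4 : Complex.cos (Real.pi * ((1 - w : ℤ) : ℂ)) = -(-1) ^ w := by
      have h5 := sin_pi_mul_int_add (1 - w) (1 / 2)
      rw [mul_add, Complex.sin_add, h3, zero_mul, zero_add,
        show (Real.pi : ℂ) * (1 / 2) = Real.pi / 2 by ring, Complex.sin_pi_div_two, mul_one,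
        mul_one] at h5
      rw [h5, zpow_sub₀ (by norm_num), zpow_one]
      rcases Int.even_or_odd w with h | h <;> rw [h.neg_one_zpow] <;> norm_num
    rw [h2.deriv, h3, h4]
    push_cast
    field_simp
    ring
  rw [hd] at hres
  have hshift : vline (c + 1) (fun s => U s * (Real.pi / Complex.sin (Real.pi * s))) =
      vline c (fun s => -(U (s + 1) * (Real.pi / Complex.sin (Real.pi * s)))) := by
    rw [← vline_comp_add _ c 1]
    refine vline_congr fun s _ => ?_
    rw [Complex.ofReal_one, mul_add, mul_one, Complex.sin_add_pi, div_neg, mul_neg]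
  have i1 := saal_lineIntegrable (n := n) hwx hwy hn hc1 hc2 hτ
  have i2 := saal_lineIntegrable (n := n) (x := x + 1) (by omega) hwy hn hc1 hc2 hτ
  have i3 : LineIntegrable (fun s => U s * (Real.pi / Complex.sin (Real.pi * s))) c := by
    refine ((hUg.mul (stripGrowth_pi_div_sin c (c + 1))).rate (by ring)).lineIntegrable
      (r := -Real.pi) (by linarith [Real.pi_pos]) le_rfl (by linarith) fun s hs => ?_
    refine ((hUd s ?_ ?_).mul ((differentiableAt_const _).div (by fun_prop)
      (sin_pi_mul_ne_zero_of_re (m := -w) hs ?_ ?_))).continuousAt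
    · rw [hs]
    · rw [hs]; linarith
    · push_cast; linarith
    · push_cast; linarith
  have hpt : ∀ s : ℂ, s.re = c → U (s + 1) * (Real.pi / Complex.sin (Real.pi * s)) =
      (τ + x) * (τ + n - x) * (saalFun n x y w s * kern n s τ *
        (Real.pi / Complex.sin (Real.pi * s))) +
      (n - x - y) * (n - x - w) * (saalFun n (x + 1) y w s * kern n s τ *
        (Real.pi / Complex.sin (Real.pi * s))) -
      U s * (Real.pi / Complex.sin (Real.pi * s)) := by
    intro s hs
    have g1 := Gamma_add_one_of_re_pos (z := x + s) (by simp; linarith)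
    have g2 := Gamma_add_one_of_re_pos (z := y + s) (by simp; linarith)
    have g3 := Gamma_add_one_of_re_pos (z := w + s) (by simp; linarith)
    have g4 := Gamma_add_one_of_re_pos (z := τ - s) (by simp; linarith)
    have g5 := Gamma_inv_eq ((x + y + w - n : ℤ) + s)
    have g6 := Gamma_inv_eq (n + τ + s)
    simp only [hU, saalAux, saalFun, kern]
    rw [show (x : ℂ) + (s + 1) = x + s + 1 by ring, show (y : ℂ) + (s + 1) = y + s + 1 by ring,
      show (w : ℂ) + (s + 1) = w + s + 1 by ring, show τ + 1 - (s + 1) = τ - s by ring,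
      show ((x + y + w - n : ℤ) : ℂ) + (s + 1) = (x + y + w - n : ℤ) + s + 1 by ring,
      show (n : ℂ) + τ + (s + 1) = n + τ + s + 1 by ring,
      show τ + 1 - s = τ - s + 1 by ring, show ((x + 1 : ℤ) : ℂ) + s = x + s + 1 by push_cast; ring,
      show ((x + 1 + y + w - n : ℤ) : ℂ) + s = (x + y + w - n : ℤ) + s + 1 by push_cast; ring,
      show (1 : ℂ) + n + τ + s = n + τ + s + 1 by ring, g1, g2, g3, g4, g5, g6]
    push_cast
    ring
  have hsum : vline (c + 1) (fun s => U s * (Real.pi / Complex.sin (Real.pi * s))) =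
      -((τ + x) * (τ + n - x) * vline c (fun s => saalFun n x y w s * kern n s τ *
        (Real.pi / Complex.sin (Real.pi * s))) +
      (n - x - y) * (n - x - w) * vline c (fun s => saalFun n (x + 1) y w s * kern n s τ *
        (Real.pi / Complex.sin (Real.pi * s)))) +
      vline c (fun s => U s * (Real.pi / Complex.sin (Real.pi * s))) := by
    rw [hshift, vline_neg, vline_congr hpt,
      vline_sub ((i1.const_mul _).add (i2.const_mul _)) i3,
      vline_add (i1.const_mul _) (i2.const_mul _), vline_const_mul, vline_const_mul]
    ring
  rw [hsum] at hres
  linear_combination -hres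

/-- The factor `1 / Γ` of `saalAux` vanishes at a nonpositive integer. -/
theorem saalAux_eq_zero (h : x + y < n) : saalAux n x y w τ (1 - w) = 0 := by
  rw [saalAux, saalFun, show ((x + y + w - n : ℤ) : ℂ) + (1 - w) = ((x + y + 1 - n : ℤ) : ℂ) by
    push_cast; ring, Gamma_inv_int_eq_zero (by omega)]
  ring

/-- The transform when `w` is the smallest of the three parameters, by induction on
`k = n - x - y`. -/
theorem saal_transform_of_min (k : ℕ) : ∀ {x : ℤ}, n - x - y = k → w ≤ x → w ≤ y →
    0 ≤ n - x - w → 0 ≤ n - y - w → -(w : ℝ) < c → c < 1 - w → c < τ.re →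
    vline c (fun s => saalFun n x y w s * kern n s τ * (Real.pi / Complex.sin (Real.pi * s))) =
      (-1) ^ (n + x + y + w) * (fact (n - x - y) * fact (n - x - w) * fact (n - y - w)) *
        (wpQuot n x τ * wpQuot n y τ * wpQuot n w τ) := by
  have hpos : ∀ {z : ℤ}, w ≤ z → -(w : ℝ) < c → c < τ.re → 0 < ((z : ℂ) + τ).re := by
    intro z h1 h2 h3
    have : (w : ℝ) ≤ z := by exact_mod_cast h1
    simp
    linarith
  have hne : ∀ {z : ℂ}, 0 < z.re → z ≠ 0 := by
    rintro z h rfl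
    simp at h
  induction k with
  | zero =>
    intro x hk hwx hwy h1 h2 hc1 hc2 hτ
    -- the second integral drops out, and the boundary term is explicit
    have hn : n = x + y := by omega
    have hrec := saal_recurrence (n := n) hwx hwy (by omega) hc1 hc2 hτ
    have e0 : (n : ℂ) - x - y = 0 := by rw [hn]; push_cast; ring
    have e1 : Complex.Gamma (x + (1 - w)) = fact (n - y - w) := by
      rw [← Gamma_int_add_one h2, hn]; congr 1; push_cast; ring
    have e2 : Complex.Gamma (y + (1 - w)) = fact (n - x - w) := by
      rw [← Gamma_int_add_one h1, hn]; congr 1; push_cast; ring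
    have e3 : saalAux n x y w τ (1 - w) =
        fact (n - y - w) * fact (n - x - w) * wpQuot n w τ := by
      rw [saalAux, saalFun, e1, e2, show (w : ℂ) + (1 - w) = 1 by ring,
        show ((x + y + w - n : ℤ) : ℂ) + (1 - w) = 1 by rw [hn]; push_cast; ring,
        Complex.Gamma_one, wpQuot, show τ + 1 - (1 - (w : ℂ)) = w + τ by ring,
        show (n : ℂ) + τ + (1 - w) = 1 + n - w + τ by ring]
      ring
    have px := hpos hwx hc1 hτ
    have py := hpos hwy hc1 hτ
    have gx := Complex.Gamma_ne_zero_of_re_pos px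
    have gy := Complex.Gamma_ne_zero_of_re_pos py
    have e4 : wpQuot n x τ * wpQuot n y τ * ((x + τ) * (y + τ)) = 1 := by
      rw [wpQuot, wpQuot, show (1 : ℂ) + n - x + τ = y + τ + 1 by rw [hn]; push_cast; ring,
        show (1 : ℂ) + n - y + τ = x + τ + 1 by rw [hn]; push_cast; ring,
        Gamma_add_one_of_re_pos px, Gamma_add_one_of_re_pos py]
      have := hne px
      have := hne py
      field_simp
    have e5 : ((-1 : ℂ)) ^ (n + x + y + w) = (-1) ^ w := by
      rw [show n + x + y + w = 2 * (x + y) + w by omega, zpow_add₀ (by norm_num), zpow_mul]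
      norm_num
    rw [e0, zero_mul, zero_mul, add_zero, e3] at hrec
    have e6 : fact (n - x - y) = 1 := by
      rw [show n - x - y = 0 by omega, fact_zero]
    rw [e5, e6]
    have e7 : (n : ℂ) - x = y := by linear_combination e0
    have e8 : τ + n - x = y + τ := by linear_combination e7
    rw [e8] at hrec
    linear_combination (wpQuot n x τ * wpQuot n y τ) * hrec - (vline c fun s => saalFun n x y w s *
      kern n s τ * (Real.pi / Complex.sin (Real.pi * s))) * e4
  | succ k ih =>
    intro x hk hwx hwy h1 h2 hc1 hc2 hτ
    -- the boundary term vanishes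
    have hrec := saal_recurrence (n := n) hwx hwy (by omega) hc1 hc2 hτ
    have hih := ih (x := x + 1) (by push_cast at hk ⊢; omega) (by omega)
      hwy (by push_cast at hk; omega) h2 hc1 hc2 hτ
    rw [saalAux_eq_zero (by push_cast at hk; omega), hih] at hrec
    have px := hpos hwx hc1 hτ
    have pnx := hpos (z := n - x) (by omega) hc1 hτ
    have e1 : wpQuot n (x + 1) τ = (x + τ) * (n - x + τ) * wpQuot n x τ := by
      rw [wpQuot, wpQuot, show ((x + 1 : ℤ) : ℂ) + τ = x + τ + 1 by push_cast; ring,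
        Gamma_add_one_of_re_pos px, Gamma_inv_eq, show (1 : ℂ) + n - (x + 1 : ℤ) + τ = n - x + τ by
        push_cast; ring, show (1 : ℂ) + n - x + τ = n - x + τ + 1 by ring]
      ring
    have e2 : fact (n - x - y) = (n - x - y) * fact (n - (x + 1) - y) := by
      have := fact_add_one (n := n - (x + 1) - y) (by push_cast at hk; omega)
      rw [show n - (x + 1) - y + 1 = n - x - y by ring] at this
      rw [this]; push_cast; ring
    have e3 : fact (n - x - w) = (n - x - w) * fact (n - (x + 1) - w) := by
      have := fact_add_one (n := n - (x + 1) - w) (by push_cast at hk; omega)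
      rw [show n - (x + 1) - w + 1 = n - x - w by ring] at this
      rw [this]; push_cast; ring
    have e4 : (-1 : ℂ) ^ (n + (x + 1) + y + w) = -(-1) ^ (n + x + y + w) := by
      rw [show n + (x + 1) + y + w = n + x + y + w + 1 by ring, zpow_add₀ (by norm_num)]
      norm_num
    have hx0 := hne px
    have hn0 : (n : ℂ) - x + τ ≠ 0 := by
      have := hne pnx
      push_cast at this
      exact this
    rw [e1, e4] at hrec
    rw [e2, e3]
    refine mul_left_cancel₀ (mul_ne_zero hx0 hn0) ?_
    linear_combination hrec

/-- The transform of `saalFun` by the kernel. It is a version of Barnes' second lemma for integer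
parameters, for which the general formula degenerates. -/
theorem saal_transform (hxy : 0 ≤ n - x - y) (hxw : 0 ≤ n - x - w) (hyw : 0 ≤ n - y - w)
    (hc1 : -((min x (min y w) : ℤ) : ℝ) < c) (hc2 : c < 1 - ((min x (min y w) : ℤ) : ℝ))
    (hτ : c < τ.re) :
    vline c (fun s => saalFun n x y w s * kern n s τ * (Real.pi / Complex.sin (Real.pi * s))) =
      (-1) ^ (n + x + y + w) * (fact (n - x - y) * fact (n - x - w) * fact (n - y - w)) *
        (wpQuot n x τ * wpQuot n y τ * wpQuot n w τ) := by
  have key : ∀ x y w : ℤ, 0 ≤ n - x - y → 0 ≤ n - x - w → 0 ≤ n - y - w → w ≤ x → w ≤ y →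
      -(w : ℝ) < c → c < 1 - w →
      vline c (fun s => saalFun n x y w s * kern n s τ * (Real.pi / Complex.sin (Real.pi * s))) =
      (-1) ^ (n + x + y + w) * (fact (n - x - y) * fact (n - x - w) * fact (n - y - w)) *
        (wpQuot n x τ * wpQuot n y τ * wpQuot n w τ) := fun x y w h1 h2 h3 h4 h5 h6 h7 =>
    saal_transform_of_min (n - x - y).toNat (by omega) h4 h5 h2 h3 h6 h7 hτ
  have hs : ∀ x y w : ℤ, ∀ s, saalFun n x y w s = saalFun n y x w s ∧
      saalFun n x y w s = saalFun n x w y s := by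
    intro x y w s
    simp only [saalFun]
    rw [show y + x + w - n = x + y + w - n by ring, show x + w + y - n = x + y + w - n by ring]
    constructor <;> ring
  rcases le_total x y with h1 | h1
  · rcases le_total x w with h2 | h2
    · rw [min_eq_left (le_min h1 h2)] at hc1 hc2
      have := key y w x hyw (by omega) (by omega) h1 h2 hc1 hc2
      simp_rw [(hs y w x _).2, (hs y x w _).1] at this
      rw [this, show n + y + w + x = n + x + y + w by ring, show n - y - x = n - x - y by ring,
        show n - w - x = n - x - w by ring]
      ring
    · rw [min_eq_right (h2.trans h1), min_eq_right h2] at hc1 hc2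
      exact key x y w hxy hxw hyw h2 (h2.trans h1) hc1 hc2
  · rcases le_total y w with h2 | h2
    · rw [min_eq_left h2, min_eq_right h1] at hc1 hc2
      have := key x w y hxw hxy (by omega) h1 h2 hc1 hc2
      simp_rw [(hs x w y _).2] at this
      rw [this, show n + x + w + y = n + x + y + w by ring, show n - w - y = n - y - w by ring]
      ring
    · rw [min_eq_right h2, min_eq_right (h2.trans h1)] at hc1 hc2
      exact key x y w hxy hxw hyw (h2.trans h1) h2 hc1 hc2

end

/-! ### A very-well-poised integral with four parameters -/

noncomputable section

/-- The integrand `Γ(A ± z) Γ(B ± z) Γ(C + z) Γ(D + z) / (Γ(1 - C + z) Γ(1 - D + z))`. -/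
def wilsonFun (A B : ℝ) (C D z : ℂ) : ℂ :=
  Complex.Gamma (A + z) * Complex.Gamma (A - z) * (Complex.Gamma (B + z) * Complex.Gamma (B - z)) *
    (Complex.Gamma (C + z) * (Complex.Gamma (1 - C + z))⁻¹ *
      (Complex.Gamma (D + z) * (Complex.Gamma (1 - D + z))⁻¹))

/-- The integral of `2 z · wilsonFun` along `Re z = c`. -/
def wilsonInt (A B : ℝ) (C D : ℂ) (c : ℝ) : ℂ := vline c fun z => 2 * z * wilsonFun A B C D z

/-- The value of the integral. -/
def wilsonVal (A B : ℝ) (C D : ℂ) : ℂ :=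
  Complex.Gamma (A + B) * Complex.Gamma (A + C) * Complex.Gamma (A + D) * Complex.Gamma (B + C) *
    Complex.Gamma (B + D) * (Complex.Gamma (1 - C - D))⁻¹ * (Complex.Gamma (A + B + C + D))⁻¹

/-- The function whose difference is the integrand times a quadratic polynomial. -/
def wilsonAux (A B : ℝ) (C D z : ℂ) : ℂ :=
  Complex.Gamma (A + z) * Complex.Gamma (A + 1 - z) *
    (Complex.Gamma (B + z) * Complex.Gamma (B + 1 - z)) *
    (Complex.Gamma (C + z) * (Complex.Gamma (-C + z))⁻¹ *
      (Complex.Gamma (D + z) * (Complex.Gamma (-D + z))⁻¹))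

/-- The line `Re z = c` separates the poles of `Γ(A + z)`, `Γ(B + z)`, `Γ(C + z)`, `Γ(D + z)` from
those of `Γ(A - z)`, `Γ(B - z)`. -/
structure WilsonSep (A B : ℝ) (C D : ℂ) (c : ℝ) : Prop where
  hA : |c| < A
  hB : |c| < B
  hC : 0 < C.re + c
  hD : 0 < D.re + c

end

theorem stripGrowth_Gamma_quot (α β : ℂ) {c d : ℝ} (h : 0 < α.re + c) :
    StripGrowth (fun z => Complex.Gamma (α + z) * (Complex.Gamma (β + z))⁻¹) c d 0 := by
  have := (stripPoly_Gamma_mul_inv α β (c := c) (d := d) (by linarith)).growth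
  simpa only [add_comm] using this

theorem stripGrowth_Gamma_refl (a b : ℝ) {c d : ℝ} (h : 0 < a + c) :
    StripGrowth (fun z => Complex.Gamma (a + z) * Complex.Gamma (b - z)) c d (-Real.pi) := by
  have := stripGrowth_Gamma_mul_Gamma_sub a b (c := c) (d := d) (by linarith)
  simpa only [add_comm] using this

section
variable {A B c : ℝ} {C D : ℂ}

theorem WilsonSep.swap (h : WilsonSep A B C D c) : WilsonSep B A C D c := ⟨h.hB, h.hA, h.hC, h.hD⟩

theorem WilsonSep.swap' (h : WilsonSep A B C D c) : WilsonSep A B D C c := ⟨h.hA, h.hB, h.hD, h.hC⟩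

theorem wilsonFun_growth {d : ℝ} (h : WilsonSep A B C D c) :
    StripGrowth (wilsonFun A B C D) c d (-(2 * Real.pi)) := by
  have hA := (abs_lt.1 h.hA).1
  have hB := (abs_lt.1 h.hB).1
  exact (((stripGrowth_Gamma_refl A A (by linarith)).mul (stripGrowth_Gamma_refl B B
    (by linarith))).mul ((stripGrowth_Gamma_quot C (1 - C) h.hC).mul
    (stripGrowth_Gamma_quot D (1 - D) h.hD))).rate (by ring)

theorem wilsonFun_differentiableAt {z : ℂ} (h : WilsonSep A B C D z.re) :
    DifferentiableAt ℂ (wilsonFun A B C D) z := by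
  have hA := abs_lt.1 h.hA
  have hB := abs_lt.1 h.hB
  have a1 : DifferentiableAt ℂ (fun z => Complex.Gamma (A + z)) z :=
    differentiableAt_Gamma_add (by simp; linarith)
  have a2 : DifferentiableAt ℂ (fun z => Complex.Gamma (A - z)) z :=
    differentiableAt_Gamma_sub (by simp; linarith)
  have b1 : DifferentiableAt ℂ (fun z => Complex.Gamma (B + z)) z :=
    differentiableAt_Gamma_add (by simp; linarith)
  have b2 : DifferentiableAt ℂ (fun z => Complex.Gamma (B - z)) z :=
    differentiableAt_Gamma_sub (by simp; linarith)
  have c1 : DifferentiableAt ℂ (fun z => Complex.Gamma (C + z)) z :=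
    differentiableAt_Gamma_add (by simpa using h.hC)
  have d1 : DifferentiableAt ℂ (fun z => Complex.Gamma (D + z)) z :=
    differentiableAt_Gamma_add (by simpa using h.hD)
  exact ((a1.mul a2).mul (b1.mul b2)).mul ((c1.mul (differentiable_Gamma_inv_add _ z)).mul
    (d1.mul (differentiable_Gamma_inv_add _ z)))

theorem wilsonFun_lineIntegrable (h : WilsonSep A B C D c) {p : ℂ → ℂ} (hp : Continuous p)
    (hpg : StripGrowth p c c 0) : LineIntegrable (fun z => p z * wilsonFun A B C D z) c :=
  ((hpg.mul (wilsonFun_growth h)).rate (zero_add _)).lineIntegrable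
    (by linarith [Real.pi_pos]) le_rfl le_rfl fun z hz =>
      hp.continuousAt.mul (wilsonFun_differentiableAt (by rw [hz]; exact h)).continuousAt

theorem wilsonAux_sub (h : WilsonSep A B C D c) {z : ℂ} (hz : z.re = c) :
    wilsonAux A B C D (z + 1) - wilsonAux A B C D z = 2 * z * ((A + B + C + D) * z ^ 2 +
      (A * B * C + A * B * D + A * C * D + B * C * D)) * wilsonFun A B C D z := by
  have hA := abs_lt.1 h.hA
  have hB := abs_lt.1 h.hB
  have hC := h.hC
  have hD := h.hD
  have a1 := Gamma_add_one_of_re_pos (z := A + z) (by simp; linarith)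
  have a2 := Gamma_add_one_of_re_pos (z := A - z) (by simp; linarith)
  have b1 := Gamma_add_one_of_re_pos (z := B + z) (by simp; linarith)
  have b2 := Gamma_add_one_of_re_pos (z := B - z) (by simp; linarith)
  have c1 := Gamma_add_one_of_re_pos (z := C + z) (by simp; linarith)
  have d1 := Gamma_add_one_of_re_pos (z := D + z) (by simp; linarith)
  have c2 := Gamma_inv_eq (-C + z)
  have d2 := Gamma_inv_eq (-D + z)
  simp only [wilsonAux, wilsonFun]
  rw [show (A : ℂ) + (z + 1) = A + z + 1 by ring, show (A : ℂ) + 1 - (z + 1) = A - z by ring,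
    show (B : ℂ) + (z + 1) = B + z + 1 by ring, show (B : ℂ) + 1 - (z + 1) = B - z by ring,
    show C + (z + 1) = C + z + 1 by ring, show D + (z + 1) = D + z + 1 by ring,
    show -C + (z + 1) = 1 - C + z by ring, show -D + (z + 1) = 1 - D + z by ring,
    show (A : ℂ) + 1 - z = A - z + 1 by ring, show (B : ℂ) + 1 - z = B - z + 1 by ring,
    a1, a2, b1, b2, c1, d1, c2, d2, show -C + z + 1 = 1 - C + z by ring,
    show -D + z + 1 = 1 - D + z by ring]
  ring

/-- Telescoping relation: the poles of `wilsonAux` lie outside the strip `c ≤ Re z ≤ c + 1`. -/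
theorem wilson_relation (h : WilsonSep A B C D c) :
    vline c (fun z => 2 * z * ((A + B + C + D) * z ^ 2 +
      (A * B * C + A * B * D + A * C * D + B * C * D)) * wilsonFun A B C D z) = 0 := by
  have hA := abs_lt.1 h.hA
  have hB := abs_lt.1 h.hB
  have hC := h.hC
  have hD := h.hD
  have hg : StripGrowth (wilsonAux A B C D) c (c + 1) (-(2 * Real.pi)) := by
    have a := stripGrowth_Gamma_refl A (A + 1) (c := c) (d := c + 1) (by linarith)
    have b := stripGrowth_Gamma_refl B (B + 1) (c := c) (d := c + 1) (by linarith)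
    push_cast at a b
    exact ((a.mul b).mul ((stripGrowth_Gamma_quot C (-C) h.hC).mul
      (stripGrowth_Gamma_quot D (-D) h.hD))).rate (by ring)
  have hd : ∀ z : ℂ, c ≤ z.re → z.re ≤ c + 1 → DifferentiableAt ℂ (wilsonAux A B C D) z := by
    intro z h1 h2
    have a1 : DifferentiableAt ℂ (fun z => Complex.Gamma (A + z)) z :=
      differentiableAt_Gamma_add (by simp; linarith)
    have a2 : DifferentiableAt ℂ (fun z => Complex.Gamma (A + 1 - z)) z :=
      differentiableAt_Gamma_sub (by simp; linarith)
    have b1 : DifferentiableAt ℂ (fun z => Complex.Gamma (B + z)) z :=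
      differentiableAt_Gamma_add (by simp; linarith)
    have b2 : DifferentiableAt ℂ (fun z => Complex.Gamma (B + 1 - z)) z :=
      differentiableAt_Gamma_sub (by simp; linarith)
    have c1 : DifferentiableAt ℂ (fun z => Complex.Gamma (C + z)) z :=
      differentiableAt_Gamma_add (by simp; linarith)
    have d1 : DifferentiableAt ℂ (fun z => Complex.Gamma (D + z)) z :=
      differentiableAt_Gamma_add (by simp; linarith)
    exact ((a1.mul a2).mul (b1.mul b2)).mul ((c1.mul (differentiable_Gamma_inv_add _ z)).mul
      (d1.mul (differentiable_Gamma_inv_add _ z)))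
  have hr : -(2 * Real.pi) < 0 := by linarith [Real.pi_pos]
  have h1 := vline_eq_vline (by linarith : c ≤ c + 1) hr hd hg
  rw [← vline_comp_add _ c 1] at h1
  have i1 : LineIntegrable (wilsonAux A B C D) c :=
    hg.lineIntegrable hr le_rfl (by linarith) fun z hz =>
      (hd z (by rw [hz]) (by rw [hz]; linarith)).continuousAt
  have i2 : LineIntegrable (fun z => wilsonAux A B C D (z + (1 : ℝ))) c := by
    have h2 : LineIntegrable (wilsonAux A B C D) (c + 1) :=
      hg.lineIntegrable hr (by linarith) le_rfl fun z hz =>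
        (hd z (by rw [hz]; linarith) (by rw [hz])).continuousAt
    refine Integrable.congr h2 (Eventually.of_forall fun y => ?_)
    simp only
    congr 1
    push_cast
    ring
  rw [← sub_eq_zero, ← vline_sub i2 i1] at h1
  rw [← h1]
  refine vline_congr fun z hz => ?_
  rw [Complex.ofReal_one, wilsonAux_sub h hz]

theorem wilsonInt_split (h : WilsonSep A B C D c) (k l : ℂ) :
    vline c (fun z => 2 * z * (k * z ^ 2 + l) * wilsonFun A B C D z) =
      k * vline c (fun z => 2 * z * z ^ 2 * wilsonFun A B C D z) + l * wilsonInt A B C D c := by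
  have hz := stripGrowth_id c c
  have i1 : LineIntegrable (fun z => 2 * z * wilsonFun A B C D z) c :=
    wilsonFun_lineIntegrable h (by fun_prop)
      (((stripGrowth_const 2 c c).mul hz).rate (by ring))
  have i2 : LineIntegrable (fun z => 2 * z * z ^ 2 * wilsonFun A B C D z) c :=
    wilsonFun_lineIntegrable h (by fun_prop)
      ((((stripGrowth_const 2 c c).mul hz).mul (hz.pow 2)).rate (by ring))
  rw [wilsonInt, ← vline_const_mul, ← vline_const_mul,
    ← vline_add (i2.const_mul k) (i1.const_mul l)]
  refine vline_congr fun z _ => ?_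
  ring

/-- Raising `A` multiplies the integrand by `A² - z²`, so `wilson_relation` compares the parameters
`A` and `A + 1`. -/
theorem wilsonInt_add_one_left (h : WilsonSep A B C D c) :
    (A + B + C + D) * wilsonInt (A + 1) B C D c =
      (A + B) * (A + C) * (A + D) * wilsonInt A B C D c := by
  have hA := abs_lt.1 h.hA
  have hrel := wilson_relation h
  rw [wilsonInt_split h] at hrel
  have e : wilsonInt (A + 1) B C D c = A ^ 2 * wilsonInt A B C D c -
      vline c (fun z => 2 * z * z ^ 2 * wilsonFun A B C D z) := by
    have := wilsonInt_split h (-1) ((A : ℂ) ^ 2)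
    rw [show (A : ℂ) ^ 2 * wilsonInt A B C D c - vline c (fun z => 2 * z * z ^ 2 *
      wilsonFun A B C D z) = -1 * vline c (fun z => 2 * z * z ^ 2 * wilsonFun A B C D z) +
      (A : ℂ) ^ 2 * wilsonInt A B C D c by ring, ← this]
    refine vline_congr fun z hz => ?_
    have a1 := Gamma_add_one_of_re_pos (z := A + z) (by simp; linarith)
    have a2 := Gamma_add_one_of_re_pos (z := A - z) (by simp; linarith)
    simp only [wilsonFun]
    rw [show ((A + 1 : ℝ) : ℂ) + z = A + z + 1 by push_cast; ring,
      show ((A + 1 : ℝ) : ℂ) - z = A - z + 1 by push_cast; ring, a1, a2]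
    ring
  rw [e]
  linear_combination -hrel

/-- Raising `C` multiplies the integrand by `z² - C²`, so `wilson_relation` compares the parameters
`C` and `C + 1`. -/
theorem wilsonInt_add_one_right (h : WilsonSep A B C D c) :
    (A + B + C + D) * wilsonInt A B (C + 1) D c =
      -((A + C) * (B + C) * (C + D) * wilsonInt A B C D c) := by
  have hC := h.hC
  have hrel := wilson_relation h
  rw [wilsonInt_split h] at hrel
  have e : wilsonInt A B (C + 1) D c = vline c (fun z => 2 * z * z ^ 2 * wilsonFun A B C D z) -
      C ^ 2 * wilsonInt A B C D c := by
    have := wilsonInt_split h 1 (-C ^ 2)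
    rw [show vline c (fun z => 2 * z * z ^ 2 * wilsonFun A B C D z) - C ^ 2 * wilsonInt A B C D c
      = 1 * vline c (fun z => 2 * z * z ^ 2 * wilsonFun A B C D z) +
      -C ^ 2 * wilsonInt A B C D c by ring, ← this]
    refine vline_congr fun z hz => ?_
    have c1 := Gamma_add_one_of_re_pos (z := C + z) (by simp; linarith)
    have c2 := Gamma_inv_eq (-C + z)
    simp only [wilsonFun]
    rw [show C + 1 + z = C + z + 1 by ring, show 1 - (C + 1) + z = -C + z by ring, c1, c2,
      show -C + z + 1 = 1 - C + z by ring]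
    ring
  rw [e]
  linear_combination hrel

theorem wilsonInt_swap : wilsonInt A B C D c = wilsonInt B A C D c := by
  refine vline_congr fun z _ => ?_
  simp only [wilsonFun]
  ring

theorem wilsonInt_swap' : wilsonInt A B C D c = wilsonInt A B D C c := by
  refine vline_congr fun z _ => ?_
  simp only [wilsonFun]
  ring

theorem wilsonVal_swap : wilsonVal A B C D = wilsonVal B A C D := by
  simp only [wilsonVal]
  rw [add_comm (A : ℂ) B]
  ring

theorem wilsonVal_swap' : wilsonVal A B C D = wilsonVal A B D C := by
  simp only [wilsonVal]
  rw [show 1 - C - D = 1 - D - C by ring, show (A : ℂ) + B + C + D = A + B + D + C by ring]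
  ring

theorem WilsonSep.re_pos (h : WilsonSep A B C D c) :
    0 < ((A : ℂ) + B).re ∧ 0 < ((A : ℂ) + C).re ∧ 0 < ((A : ℂ) + D).re ∧ 0 < ((B : ℂ) + C).re ∧
      0 < ((B : ℂ) + D).re ∧ 0 < ((A : ℂ) + B + C + D).re := by
  have hA := abs_lt.1 h.hA
  have hB := abs_lt.1 h.hB
  have hC := h.hC
  have hD := h.hD
  simp only [Complex.add_re, Complex.ofReal_re]
  refine ⟨?_, ?_, ?_, ?_, ?_, ?_⟩ <;> linarith

theorem ne_zero_of_re_pos {z : ℂ} (h : 0 < z.re) : z ≠ 0 := by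
  rintro rfl
  simp at h

theorem WilsonSep.eval_add_one_left (h : WilsonSep A B C D c)
    (hv : wilsonInt A B C D c = wilsonVal A B C D) :
    wilsonInt (A + 1) B C D c = wilsonVal (A + 1) B C D := by
  obtain ⟨p1, p2, p3, p4, p5, p6⟩ := h.re_pos
  have h0 := ne_zero_of_re_pos p6
  refine mul_left_cancel₀ h0 ?_
  rw [wilsonInt_add_one_left h, hv, wilsonVal, wilsonVal, Complex.ofReal_add, Complex.ofReal_one,
    show (A : ℂ) + 1 + B = A + B + 1 by ring, show (A : ℂ) + 1 + C = A + C + 1 by ring,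
    show (A : ℂ) + 1 + D = A + D + 1 by ring, show (A : ℂ) + B + 1 + C + D = A + B + C + D + 1 by
    ring, Gamma_add_one_of_re_pos p1, Gamma_add_one_of_re_pos p2, Gamma_add_one_of_re_pos p3,
    Gamma_inv_eq ((A : ℂ) + B + C + D)]
  ring

theorem WilsonSep.eval_add_one_left' (h : WilsonSep A B C D c)
    (hv : wilsonInt A B C D c = wilsonVal A B C D) :
    wilsonInt A (B + 1) C D c = wilsonVal A (B + 1) C D := by
  rw [wilsonInt_swap, wilsonVal_swap]
  rw [wilsonInt_swap, wilsonVal_swap] at hv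
  exact h.swap.eval_add_one_left hv

theorem WilsonSep.eval_of_add_one_right (h : WilsonSep A B C D c) (hCD : C + D ≠ 0)
    (hv : wilsonInt A B (C + 1) D c = wilsonVal A B (C + 1) D) :
    wilsonInt A B C D c = wilsonVal A B C D := by
  obtain ⟨p1, p2, p3, p4, p5, p6⟩ := h.re_pos
  have hr := wilsonInt_add_one_right h
  rw [hv, wilsonVal, show (A : ℂ) + (C + 1) = A + C + 1 by ring,
    show (B : ℂ) + (C + 1) = B + C + 1 by ring, show 1 - (C + 1) - D = -(C + D) by ring,
    show (A : ℂ) + B + (C + 1) + D = A + B + C + D + 1 by ring, Gamma_add_one_of_re_pos p2,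
    Gamma_add_one_of_re_pos p4, Gamma_inv_eq (-(C + D))] at hr
  have h1 : (A + C) * (B + C) * (C + D) ≠ 0 :=
    mul_ne_zero (mul_ne_zero (ne_zero_of_re_pos p2) (ne_zero_of_re_pos p4)) hCD
  refine mul_left_cancel₀ h1 ?_
  rw [wilsonVal, Gamma_inv_eq ((A : ℂ) + B + C + D), show 1 - C - D = -(C + D) + 1 by ring]
  linear_combination hr

theorem WilsonSep.eval_of_add_one_right' (h : WilsonSep A B C D c) (hCD : C + D ≠ 0)
    (hv : wilsonInt A B C (D + 1) c = wilsonVal A B C (D + 1)) :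
    wilsonInt A B C D c = wilsonVal A B C D := by
  rw [wilsonInt_swap', wilsonVal_swap']
  rw [wilsonInt_swap', wilsonVal_swap'] at hv
  exact h.swap'.eval_of_add_one_right (by rwa [add_comm]) hv

theorem wilsonInt_eq_of_le {d : ℝ} (hcd : c ≤ d) (h : WilsonSep A B C D c)
    (h' : WilsonSep A B C D d) : wilsonInt A B C D d = wilsonInt A B C D c := by
  have hA := abs_lt.1 h.hA
  have hB := abs_lt.1 h.hB
  have hA' := abs_lt.1 h'.hA
  have hB' := abs_lt.1 h'.hB
  have hC := h.hC
  have hD := h.hD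
  refine vline_eq_vline (r := -(2 * Real.pi)) hcd (by linarith [Real.pi_pos]) (fun z h1 h2 => ?_) ?_
  · refine (by fun_prop : DifferentiableAt ℂ (fun z : ℂ => 2 * z) z).mul
      (wilsonFun_differentiableAt ⟨?_, ?_, ?_, ?_⟩)
    · rw [abs_lt]; constructor <;> linarith
    · rw [abs_lt]; constructor <;> linarith
    · linarith
    · linarith
  · exact (((stripGrowth_const 2 c d).mul (stripGrowth_id c d)).mul (wilsonFun_growth h)).rate
      (by ring)

/-- A product `Γ(a + x) Γ(a - x)` is stationary at `x = 0`. -/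
theorem hasDerivAt_Gamma_mul_Gamma {a : ℂ} (h : 0 < a.re) :
    HasDerivAt (fun x => Complex.Gamma (a + x) * Complex.Gamma (a - x)) 0 (0 : ℂ) := by
  have h0 : DifferentiableAt ℂ Complex.Gamma a := by
    refine Complex.differentiableAt_Gamma _ fun m hm => ?_
    rw [hm] at h
    simp at h
    linarith [(Nat.cast_nonneg m : (0 : ℝ) ≤ m)]
  have h1 : HasDerivAt (fun x : ℂ => Complex.Gamma (a + x)) (deriv Complex.Gamma a) 0 := by
    have h2 : HasDerivAt Complex.Gamma (deriv Complex.Gamma a) (a + 0) := by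
      rw [add_zero]; exact h0.hasDerivAt
    exact (h2.comp (0 : ℂ) ((hasDerivAt_id (0 : ℂ)).const_add a)).congr_deriv (by ring)
  have h3 : HasDerivAt (fun x : ℂ => Complex.Gamma (a - x)) (-deriv Complex.Gamma a) 0 := by
    have h2 : HasDerivAt Complex.Gamma (deriv Complex.Gamma a) (a - 0) := by
      rw [sub_zero]; exact h0.hasDerivAt
    exact (h2.comp (0 : ℂ) ((hasDerivAt_id (0 : ℂ)).const_sub a)).congr_deriv (by ring)
  refine (h1.mul h3).congr_deriv ?_
  rw [add_zero, sub_zero]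
  ring

theorem hasDerivAt_sin_pi_add (a : ℂ) :
    HasDerivAt (fun x => Complex.sin (Real.pi * (a + x))) (Real.pi * Complex.cos (Real.pi * a))
      (0 : ℂ) := by
  have h1 : HasDerivAt (fun x : ℂ => (Real.pi : ℂ) * (a + x)) Real.pi 0 := by
    simpa using ((hasDerivAt_id (0 : ℂ)).const_add a).const_mul (Real.pi : ℂ)
  refine h1.csin.congr_deriv ?_
  rw [add_zero, mul_comm]

/-- `Γ(C + z) Γ(D + z) / (Γ(z - C) Γ(z - D))`, whose difference is `2 (C + D) z` times the part of
the integrand that depends on `C` and `D`. -/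
noncomputable def wilsonTail (C D z : ℂ) : ℂ :=
  Complex.Gamma (C + z) * (Complex.Gamma (-C + z))⁻¹ *
    (Complex.Gamma (D + z) * (Complex.Gamma (-D + z))⁻¹)

theorem Gamma_inv_eq_sin {z : ℂ} (h : 0 < (1 - z).re) :
    (Complex.Gamma z)⁻¹ = Complex.Gamma (1 - z) * (Complex.sin (Real.pi * z) / Real.pi) := by
  have h1 := Complex.Gamma_mul_Gamma_one_sub z
  have h2 := Complex.Gamma_ne_zero_of_re_pos h
  have hpi : (Real.pi : ℂ) ≠ 0 := by exact_mod_cast Real.pi_ne_zero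
  by_cases h3 : Complex.sin (Real.pi * z) = 0
  · rw [h3, div_zero] at h1
    rw [h3, (mul_eq_zero.1 h1).resolve_right h2]
    simp
  · have h4 : Complex.Gamma z ≠ 0 := by
      intro h0
      rw [h0, zero_mul] at h1
      exact div_ne_zero hpi h3 h1.symm
    rw [eq_div_iff h3] at h1
    rw [inv_eq_one_div, div_eq_iff h4, mul_div_assoc', div_mul_eq_mul_div, eq_div_iff hpi]
    linear_combination -h1

theorem wilsonTail_differentiableAt {z : ℂ} (hC : 0 < C.re + z.re) (hD : 0 < D.re + z.re) :
    DifferentiableAt ℂ (wilsonTail C D) z :=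
  ((differentiableAt_Gamma_add (by simpa using hC)).mul (differentiable_Gamma_inv_add _ z)).mul
    ((differentiableAt_Gamma_add (by simpa using hD)).mul (differentiable_Gamma_inv_add _ z))

theorem wilsonTail_growth {d : ℝ} (hC : 0 < C.re + c) (hD : 0 < D.re + c) :
    StripGrowth (wilsonTail C D) c d 0 :=
  ((stripGrowth_Gamma_quot C (-C) hC).mul (stripGrowth_Gamma_quot D (-D) hD)).rate (by ring)

theorem wilsonFun_eq_tail {z : ℂ} :
    wilsonTail C D z = Complex.Gamma (C + z) * (Complex.Gamma (1 - C + z))⁻¹ *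
      (Complex.Gamma (D + z) * (Complex.Gamma (1 - D + z))⁻¹) * ((z - C) * (z - D)) := by
  rw [wilsonTail, Gamma_inv_eq (-C + z), Gamma_inv_eq (-D + z),
    show -C + z + 1 = 1 - C + z by ring, show -D + z + 1 = 1 - D + z by ring]
  ring

theorem wilsonFun_eq_tail_add_one {z : ℂ} (hC : 0 < C.re + z.re) (hD : 0 < D.re + z.re) :
    wilsonTail C D (z + 1) = Complex.Gamma (C + z) * (Complex.Gamma (1 - C + z))⁻¹ *
      (Complex.Gamma (D + z) * (Complex.Gamma (1 - D + z))⁻¹) * ((z + C) * (z + D)) := by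
  rw [wilsonTail, show C + (z + 1) = C + z + 1 by ring, show D + (z + 1) = D + z + 1 by ring,
    show -C + (z + 1) = 1 - C + z by ring, show -D + (z + 1) = 1 - D + z by ring,
    Gamma_add_one_of_re_pos (z := C + z) (by simpa using hC),
    Gamma_add_one_of_re_pos (z := D + z) (by simpa using hD)]
  ring

/-- The function `φ(z) (π / sin πz)²` is integrable along vertical lines avoiding the integers. -/
theorem lineIntegrable_mul_sin {φ : ℂ → ℂ} {d a : ℝ} {m : ℤ} (h1 : c ≤ a) (h2 : a ≤ d)
    (hm1 : (m : ℝ) < a) (hm2 : a < m + 1) (hφ : ∀ z : ℂ, z.re = a → DifferentiableAt ℂ φ z)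
    (hg : StripGrowth φ c d 0) :
    LineIntegrable (fun z => φ z * (Real.pi / Complex.sin (Real.pi * z)) ^ 2) a := by
  have hs := stripGrowth_pi_div_sin c d
  have hg2 : StripGrowth (fun z => φ z * (Real.pi / Complex.sin (Real.pi * z)) ^ 2) c d
      (-(2 * Real.pi)) := by
    simp only [pow_two]
    exact (hg.mul (hs.mul hs)).rate (by ring)
  refine hg2.lineIntegrable (by linarith [Real.pi_pos]) h1 h2 fun z hz => ?_
  have d1 : DifferentiableAt ℂ (fun s => Real.pi / Complex.sin (Real.pi * s)) z :=
    (differentiableAt_const _).div (by fun_prop) (sin_pi_mul_ne_zero_of_re hz hm1 hm2)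
  exact ((hφ z hz).mul (d1.pow 2)).continuousAt

/-- The telescoping form of `vline_sub_vline_sin`. -/
theorem vline_difference_sin {φ : ℂ → ℂ} (m : ℤ) (hc : c < m) (hm : m < c + 1)
    (hφ : ∀ z : ℂ, c ≤ z.re → z.re ≤ c + 1 → DifferentiableAt ℂ φ z)
    (hg : StripGrowth φ c (c + 1) 0) :
    vline c (fun z => (φ (z + 1) - φ z) * (Real.pi / Complex.sin (Real.pi * z)) ^ 2) =
      deriv φ m := by
  have hs := stripGrowth_pi_div_sin c (c + 1)
  have hg2 : StripGrowth (fun z => φ z * (Real.pi / Complex.sin (Real.pi * z)) ^ 2) c (c + 1)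
      (-(2 * Real.pi)) := by
    simp only [pow_two]
    exact (hg.mul (hs.mul hs)).rate (by ring)
  rw [← vline_sub_vline_sin m hc hm (by linarith [Real.pi_pos]) hφ hg2, ← vline_comp_add _ c 1]
  have i1 : LineIntegrable (fun z => φ z * (Real.pi / Complex.sin (Real.pi * z)) ^ 2) c :=
    lineIntegrable_mul_sin (m := m - 1) le_rfl (by linarith) (by push_cast; linarith)
      (by push_cast; linarith) (fun z hz => hφ z (by rw [hz]) (by rw [hz]; linarith)) hg
  have i2 : LineIntegrable (fun z => φ (z + (1 : ℝ)) *
      (Real.pi / Complex.sin (Real.pi * (z + (1 : ℝ)))) ^ 2) c := by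
    have h2 : LineIntegrable (fun z => φ z * (Real.pi / Complex.sin (Real.pi * z)) ^ 2) (c + 1) :=
      lineIntegrable_mul_sin (m := m) (by linarith) le_rfl hm (by linarith)
        (fun z hz => hφ z (by rw [hz]; linarith) (by rw [hz])) hg
    refine Integrable.congr h2 (Eventually.of_forall fun y => ?_)
    have : ((c + 1 : ℝ) : ℂ) + (y : ℂ) * Complex.I =
        (c : ℂ) + (y : ℂ) * Complex.I + ((1 : ℝ) : ℂ) := by push_cast; ring
    simp only [this]
  rw [← vline_sub i2 i1]
  refine vline_congr fun z _ => ?_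
  rw [Complex.ofReal_one, mul_add, mul_one, Complex.sin_add_pi, div_neg, neg_sq]
  ring

/-- If `E` is stationary at `0`, only the second factor contributes to the derivative. -/
theorem hasDerivAt_mul_even {E f : ℂ → ℂ} {f' : ℂ} (hE : HasDerivAt E 0 0)
    (hf : HasDerivAt f f' 0) : HasDerivAt (fun x => E x * f x) (E 0 * f') 0 :=
  (hE.mul hf).congr_deriv (by ring)

/-- The initial case `A = B = 1/2`, where `Γ(1/2 + z)² Γ(1/2 - z)² = (π / cos πz)²`. The
remaining factor is a difference of `wilsonTail`, whose derivative at `1/2` gives the residue. -/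
theorem wilson_base_half (hC : 1 / 2 < C.re) (hD : 1 / 2 < D.re) :
    wilsonInt (1 / 2) (1 / 2) C D (-1 / 4) = wilsonVal (1 / 2) (1 / 2) C D := by
  have hpi : (Real.pi : ℂ) ≠ 0 := by exact_mod_cast Real.pi_ne_zero
  have hCD : C + D ≠ 0 := ne_zero_of_re_pos (by simp; linarith)
  set φ : ℂ → ℂ := fun v => wilsonTail C D (v + (-(1 / 2))) with hφ
  have hφd : ∀ z : ℂ, 1 / 4 ≤ z.re → DifferentiableAt ℂ φ z := fun z h1 =>
    DifferentiableAt.comp z (g := wilsonTail C D) (f := fun v : ℂ => v + (-(1 / 2)))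
      (wilsonTail_differentiableAt (by simp; norm_num; linarith) (by simp; norm_num; linarith))
      (by fun_prop)
  have hφg : StripGrowth φ (1 / 4) (1 / 4 + 1) 0 := by
    obtain ⟨K, N, h⟩ := wilsonTail_growth (C := C) (D := D) (c := -1 / 4) (d := 3 / 4)
      (by linarith) (by linarith)
    refine ⟨K, N, fun z h1 h2 h3 => ?_⟩
    have h4 : (z + (-(1 / 2)) : ℂ).im = z.im := by simp
    have := h (z + (-(1 / 2))) (by simp; norm_num; linarith) (by simp; norm_num; linarith)
      (by rw [h4]; exact h3)
    rwa [h4] at this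
  have hkey := vline_difference_sin (φ := φ) (c := 1 / 4) 1 (by norm_num) (by norm_num)
    (fun z h1 _ => hφd z h1) hφg
  have hJ : (C + D) * wilsonInt (1 / 2) (1 / 2) C D (-1 / 4) = deriv φ 1 := by
    rw [Int.cast_one] at hkey
    rw [← hkey, show (1 / 4 : ℝ) = -1 / 4 + 1 / 2 by norm_num, ← vline_comp_add,
      wilsonInt, ← vline_const_mul]
    refine vline_congr fun z hz => ?_
    have e1 := wilsonFun_eq_tail_add_one (C := C) (D := D) (z := z) (by linarith) (by linarith)
    have e2 := wilsonFun_eq_tail (C := C) (D := D) (z := z)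
    have e3 := Complex.Gamma_mul_Gamma_one_sub (1 / 2 + z)
    simp only [hφ, wilsonFun]
    push_cast
    rw [show z + 1 / 2 + 1 + -(1 / 2) = z + 1 by ring, show z + 1 / 2 + -(1 / 2) = z by ring,
      e1, e2, show z + 1 / 2 = 1 / 2 + z by ring, ← e3, show (1 : ℂ) - (1 / 2 + z) = 1 / 2 - z by
      ring]
    ring
  have hev : HasDerivAt φ ((Complex.Gamma (C + 1 / 2) * Complex.Gamma (C + 1 / 2)) *
      (Complex.Gamma (D + 1 / 2) * Complex.Gamma (D + 1 / 2)) *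
        (Complex.sin (Real.pi * (C + D)) / Real.pi)) 1 := by
    -- by reflection `φ` is, near `1`, an even function of `v - 1` times two sines
    have hE := hasDerivAt_mul_even (hasDerivAt_Gamma_mul_Gamma (a := C + 1 / 2)
      (by simp; linarith)) (hasDerivAt_Gamma_mul_Gamma (a := D + 1 / 2) (by simp; linarith))
    rw [mul_zero] at hE
    have hsC := (hasDerivAt_sin_pi_add (1 / 2 - C)).div_const (Real.pi : ℂ)
    have hsD := (hasDerivAt_sin_pi_add (1 / 2 - D)).div_const (Real.pi : ℂ)
    have h1 := hasDerivAt_mul_even hE (hsC.mul hsD)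
    have h2 := HasDerivAt.comp (1 : ℂ) (h := fun v : ℂ => v - 1) (by rw [sub_self]; exact h1)
      ((hasDerivAt_id (1 : ℂ)).sub_const 1)
    refine (h2.congr_of_eventuallyEq ?_).congr_deriv ?_
    · have hn : {v : ℂ | v.re < 2} ∈ 𝓝 (1 : ℂ) :=
        (isOpen_lt Complex.continuous_re continuous_const).mem_nhds (by simp)
      filter_upwards [hn] with v hv
      have hv' : v.re < 2 := hv
      simp only [hφ, Function.comp_apply, Pi.mul_apply, wilsonTail]
      rw [Gamma_inv_eq_sin (z := -C + (v + -(1 / 2))) (by simp; norm_num; linarith),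
        Gamma_inv_eq_sin (z := -D + (v + -(1 / 2))) (by simp; norm_num; linarith),
        show C + (v + -(1 / 2)) = C + 1 / 2 + (v - 1) by ring,
        show D + (v + -(1 / 2)) = D + 1 / 2 + (v - 1) by ring,
        show 1 - (-C + (v + -(1 / 2))) = C + 1 / 2 - (v - 1) by ring,
        show 1 - (-D + (v + -(1 / 2))) = D + 1 / 2 - (v - 1) by ring,
        show -C + (v + -(1 / 2)) = 1 / 2 - C + (v - 1) by ring,
        show -D + (v + -(1 / 2)) = 1 / 2 - D + (v - 1) by ring]
      ring
    · rw [add_zero, sub_zero, add_zero, sub_zero, add_zero, add_zero,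
        show (Real.pi : ℂ) * (C + D) = Real.pi * C + Real.pi * D by ring, Complex.sin_add,
        show (Real.pi : ℂ) * (1 / 2 - C) = Real.pi / 2 - Real.pi * C by ring,
        show (Real.pi : ℂ) * (1 / 2 - D) = Real.pi / 2 - Real.pi * D by ring,
        Complex.cos_pi_div_two_sub, Complex.cos_pi_div_two_sub, Complex.sin_pi_div_two_sub,
        Complex.sin_pi_div_two_sub]
      field_simp
  rw [hev.deriv] at hJ
  refine mul_left_cancel₀ hCD ?_
  have h1 := Gamma_inv_eq_sin (z := 1 - C - D) (by simp; linarith)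
  have h2 := Gamma_add_one_of_re_pos (z := C + D) (by simp; linarith)
  have h3 := Complex.Gamma_ne_zero_of_re_pos (s := C + D) (by simp; linarith)
  rw [show 1 - (1 - C - D) = C + D by ring, show (Real.pi : ℂ) * (1 - C - D) =
    Real.pi - Real.pi * (C + D) by ring, Complex.sin_pi_sub] at h1
  rw [hJ, wilsonVal, h1]
  push_cast
  rw [show (1 / 2 + 1 / 2 : ℂ) = 1 by norm_num, Complex.Gamma_one,
    show 1 + C + D = C + D + 1 by ring, h2, show (1 / 2 : ℂ) + C = C + 1 / 2 by ring,
    show (1 / 2 : ℂ) + D = D + 1 / 2 by ring]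
  field_simp

/-- The initial case `A = B = 1`, where `z⁻² Γ(1 + z)² Γ(1 - z)² = (π / sin πz)²`. The remaining
factor is a difference of a quadratic polynomial times `wilsonTail`; the constant term of the
polynomial `q` is determined by this requirement. -/
theorem wilson_base_one (hC : 1 / 2 < C.re) (hD : 1 / 2 < D.re) :
    wilsonInt 1 1 C D (-1 / 4) = wilsonVal 1 1 C D := by
  have hpi : (Real.pi : ℂ) ≠ 0 := by exact_mod_cast Real.pi_ne_zero
  have hCD : C + D ≠ 0 := ne_zero_of_re_pos (by simp; linarith)
  have hCD1 : C + D + 1 ≠ 0 := ne_zero_of_re_pos (by simp; linarith)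
  set q : ℂ → ℂ := fun z => z * (z + -1) + -(C * D / (C + D)) with hq
  set φ : ℂ → ℂ := fun z => q z * wilsonTail C D z with hφ
  have hqd : Differentiable ℂ q := by rw [hq]; fun_prop
  have hφd : ∀ z : ℂ, -1 / 4 ≤ z.re → DifferentiableAt ℂ φ z := fun z h1 =>
    (hqd z).mul (wilsonTail_differentiableAt (by linarith) (by linarith))
  have hqg : StripGrowth q (-1 / 4) (-1 / 4 + 1) 0 :=
    (((stripGrowth_id _ _).mul (stripGrowth_add_const _ _ _)).rate (by ring)).add
      (stripGrowth_const _ _ _)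
  have hφg : StripGrowth φ (-1 / 4) (-1 / 4 + 1) 0 :=
    (hqg.mul (wilsonTail_growth (C := C) (D := D) (c := -1 / 4) (d := -1 / 4 + 1)
      (by linarith) (by linarith))).rate (by ring)
  have hkey := vline_difference_sin (φ := φ) (c := -1 / 4) 0 (by norm_num) (by norm_num)
    (fun z h1 _ => hφd z h1) hφg
  have hJ : (C + D + 1) * wilsonInt 1 1 C D (-1 / 4) = deriv φ 0 := by
    rw [Int.cast_zero] at hkey
    rw [← hkey, wilsonInt, ← vline_const_mul]
    refine vline_congr fun z hz => ?_
    have e1 := wilsonFun_eq_tail_add_one (C := C) (D := D) (z := z) (by linarith) (by linarith)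
    have e2 := wilsonFun_eq_tail (C := C) (D := D) (z := z)
    have hz0 : z ≠ 0 := by
      rintro rfl
      norm_num at hz
    have e3 := Complex.Gamma_mul_Gamma_one_sub z
    have e4 := Complex.Gamma_add_one z hz0
    simp only [hφ, hq, wilsonFun]
    push_cast
    rw [e1, e2, ← e3, add_comm (1 : ℂ) z, e4]
    field_simp
    ring
  have hev : HasDerivAt φ ((C * D) ^ 2 * ((Complex.Gamma C * Complex.Gamma C) *
      (Complex.Gamma D * Complex.Gamma D)) *
        (Complex.sin (Real.pi * (C + D)) / (Real.pi * (C + D)))) 0 := by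
    -- by reflection `φ` is, near `0`, a function stationary at `0` times two sines
    have hE := hasDerivAt_mul_even (hasDerivAt_Gamma_mul_Gamma (a := C)
      (by linarith)) (hasDerivAt_Gamma_mul_Gamma (a := D) (by linarith))
    rw [mul_zero] at hE
    have hsC := (hasDerivAt_sin_pi_add (-C)).div_const (Real.pi : ℂ)
    have hsD := (hasDerivAt_sin_pi_add (-D)).div_const (Real.pi : ℂ)
    have hlin : ∀ a : ℂ, HasDerivAt (fun z : ℂ => a - z) (-1) 0 := fun a => by
      simpa using (hasDerivAt_id (0 : ℂ)).const_sub a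
    have hqq : HasDerivAt (fun z => q z * ((C - z) * (D - z))) 0 (0 : ℂ) := by
      have h1 : HasDerivAt (fun z : ℂ => z * (z + -1) + -(C * D / (C + D))) (-1) 0 := by
        refine (((hasDerivAt_id (0 : ℂ)).mul ((hasDerivAt_id (0 : ℂ)).add_const (-1))).add_const
          (-(C * D / (C + D)))).congr_deriv ?_
        simp
      refine (h1.mul ((hlin C).mul (hlin D))).congr_deriv ?_
      simp only [Pi.mul_apply]
      field_simp
      ring
    have h1 := hasDerivAt_mul_even (hasDerivAt_mul_even hqq hE |>.congr_deriv (mul_zero _))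
      (hsC.mul hsD)
    refine (h1.congr_of_eventuallyEq ?_).congr_deriv ?_
    · have hn : {v : ℂ | v.re < 1 / 2} ∈ 𝓝 (0 : ℂ) :=
        (isOpen_lt Complex.continuous_re continuous_const).mem_nhds (by simp)
      filter_upwards [hn] with v hv
      have hv' : v.re < 1 / 2 := hv
      simp only [hφ, Pi.mul_apply, wilsonTail]
      rw [Gamma_inv_eq_sin (z := -C + v) (by simp; linarith),
        Gamma_inv_eq_sin (z := -D + v) (by simp; linarith),
        show 1 - (-C + v) = C - v + 1 by ring, show 1 - (-D + v) = D - v + 1 by ring,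
        Gamma_add_one_of_re_pos (z := C - v) (by simp; linarith),
        Gamma_add_one_of_re_pos (z := D - v) (by simp; linarith)]
      ring
    · simp only [hq, add_zero, sub_zero, mul_neg, Complex.cos_neg, Complex.sin_neg, mul_add,
        Complex.sin_add]
      field_simp
      ring
  rw [hev.deriv] at hJ
  refine mul_left_cancel₀ hCD1 ?_
  have h1 := Gamma_inv_eq_sin (z := 1 - C - D) (by simp; linarith)
  have h2 := Gamma_add_one_of_re_pos (z := C + D) (by simp; linarith)
  have h2' := Gamma_add_one_of_re_pos (z := C + D + 1) (by simp; linarith)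
  have h3 := Complex.Gamma_ne_zero_of_re_pos (s := C + D) (by simp; linarith)
  have hC1 := Gamma_add_one_of_re_pos (z := C) (by linarith)
  have hD1 := Gamma_add_one_of_re_pos (z := D) (by linarith)
  rw [show 1 - (1 - C - D) = C + D by ring, show (Real.pi : ℂ) * (1 - C - D) =
    Real.pi - Real.pi * (C + D) by ring, Complex.sin_pi_sub] at h1
  rw [hJ, wilsonVal, h1]
  push_cast
  have hG2 : Complex.Gamma 2 = 1 := by
    have := Complex.Gamma_add_one 1 one_ne_zero
    rwa [Complex.Gamma_one, mul_one, one_add_one_eq_two] at this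
  rw [show (1 + 1 : ℂ) = 2 by norm_num, hG2, show 2 + C + D = C + D + 1 + 1 by ring, h2', h2,
    add_comm 1 C, add_comm 1 D, hC1, hD1]
  field_simp

/-- If `C` and `D` have real part greater than `1/2`, the line `Re z = -1/4` separates the poles for
all `A, B ≥ 1/2`, so `A` and `B` can be raised from the initial cases. -/
theorem wilson_eval_of_large {A₀ : ℝ} (hA₀ : A₀ = 1 / 2 ∨ A₀ = 1) (i j : ℕ) (hC : 1 / 2 < C.re)
    (hD : 1 / 2 < D.re) :
    wilsonInt (A₀ + i) (A₀ + j) C D (-1 / 4) = wilsonVal (A₀ + i) (A₀ + j) C D := by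
  have hpos : 1 / 2 ≤ A₀ := by rcases hA₀ with h | h <;> rw [h]; norm_num
  have hsep : ∀ i j : ℕ, WilsonSep (A₀ + i) (A₀ + j) C D (-1 / 4) := fun i j => by
    have hi : (0 : ℝ) ≤ i := Nat.cast_nonneg i
    have hj : (0 : ℝ) ≤ j := Nat.cast_nonneg j
    have h4 : |(-1 / 4 : ℝ)| = 1 / 4 := by norm_num [abs_div]
    exact ⟨by rw [h4]; linarith, by rw [h4]; linarith, by linarith, by linarith⟩
  induction i with
  | succ i ih =>
    have := (hsep i j).eval_add_one_left ih
    push_cast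
    rwa [← add_assoc]
  | zero =>
    induction j with
    | succ j ih =>
      have := (hsep 0 j).eval_add_one_left' ih
      push_cast at this ⊢
      rwa [← add_assoc]
    | zero =>
      rw [Nat.cast_zero, add_zero]
      rcases hA₀ with h | h <;> rw [h]
      · exact wilson_base_half hC hD
      · exact wilson_base_one hC hD

/-- Evaluation of the four-parameter integral when `A` and `B` are half-integers of the same
parity. -/
theorem wilson_eval {A₀ : ℝ} (hA₀ : A₀ = 1 / 2 ∨ A₀ = 1) (i j : ℕ)
    (h : WilsonSep (A₀ + i) (A₀ + j) C D c) (hCD : ∀ k : ℤ, C + D ≠ k) :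
    wilsonInt (A₀ + i) (A₀ + j) C D c = wilsonVal (A₀ + i) (A₀ + j) C D := by
  have hpos : 1 / 2 ≤ A₀ := by rcases hA₀ with h | h <;> rw [h]; norm_num
  have hsep : ∀ k l : ℕ, WilsonSep (A₀ + i) (A₀ + j) (C + k) (D + l) c := fun k l => by
    have hk : (0 : ℝ) ≤ k := Nat.cast_nonneg k
    have hl : (0 : ℝ) ≤ l := Nat.cast_nonneg l
    have h1 := h.hC
    have h2 := h.hD
    exact ⟨h.hA, h.hB, by simp; linarith, by simp; linarith⟩
  have hne : ∀ k l : ℕ, C + k + (D + l) ≠ 0 := fun k l h0 =>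
    hCD (-(k + l)) (by push_cast; linear_combination h0)
  -- descent in `C` and `D`; the values `C + D` to be avoided are integers
  have hdesc : ∀ k l : ℕ, wilsonInt (A₀ + i) (A₀ + j) (C + k) (D + l) c =
      wilsonVal (A₀ + i) (A₀ + j) (C + k) (D + l) →
      wilsonInt (A₀ + i) (A₀ + j) C D c = wilsonVal (A₀ + i) (A₀ + j) C D := by
    intro k l
    induction k with
    | succ k ih =>
      intro hk
      refine ih ((hsep k l).eval_of_add_one_right (hne k l) ?_)
      push_cast at hk
      rwa [← add_assoc] at hk
    | zero =>
      induction l with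
      | succ l ih =>
        intro hl
        refine ih ((hsep 0 l).eval_of_add_one_right' (hne 0 l) ?_)
        push_cast at hl
        push_cast
        rwa [← add_assoc D] at hl
      | zero => intro h0; simpa using h0
  obtain ⟨k, hk⟩ := exists_nat_gt (1 / 2 - C.re)
  obtain ⟨l, hl⟩ := exists_nat_gt (1 / 2 - D.re)
  have hCk : 1 / 2 < (C + k).re := by simp; linarith
  have hDl : 1 / 2 < (D + l).re := by simp; linarith
  refine hdesc k l ?_
  rw [← wilson_eval_of_large hA₀ i j hCk hDl]
  have hi : (0 : ℝ) ≤ i := Nat.cast_nonneg i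
  have hj : (0 : ℝ) ≤ j := Nat.cast_nonneg j
  have h4 : |(-1 / 4 : ℝ)| = 1 / 4 := by norm_num [abs_div]
  have hs : WilsonSep (A₀ + i) (A₀ + j) (C + k) (D + l) (-1 / 4) :=
    ⟨by rw [h4]; linarith, by rw [h4]; linarith, by linarith, by linarith⟩
  rcases le_total c (-1 / 4) with h5 | h5
  · exact (wilsonInt_eq_of_le h5 (hsep k l) hs).symm
  · exact wilsonInt_eq_of_le h5 hs (hsep k l)

end

/-! ### Interchange of integrations -/

/-- Joint integrability on a product of two lines from a bound by a product. -/
theorem integrable_prod_of_bound {f : ℂ → ℂ → ℂ} {c d : ℝ} {φ ψ : ℝ → ℝ}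
    (hf : ∀ s τ : ℂ, s.re = c → τ.re = d → ContinuousAt (fun q : ℂ × ℂ => f q.1 q.2) (s, τ))
    (hφ : Integrable φ) (hψ : Integrable ψ)
    (h : ∀ s τ : ℂ, s.re = c → τ.re = d → ‖f s τ‖ ≤ φ s.im * ψ τ.im) :
    Integrable (fun q : ℝ × ℝ => f ((c : ℂ) + (q.1 : ℂ) * Complex.I)
      ((d : ℂ) + (q.2 : ℂ) * Complex.I)) := by
  refine Integrable.mono' (Integrable.mul_prod hφ hψ) ?_ (Eventually.of_forall fun q => ?_)
  · refine Continuous.aestronglyMeasurable ?_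
    rw [continuous_iff_continuousAt]
    intro q
    refine ContinuousAt.comp (f := fun q : ℝ × ℝ => (((c : ℂ) + (q.1 : ℂ) * Complex.I),
      ((d : ℂ) + (q.2 : ℂ) * Complex.I))) (g := fun q : ℂ × ℂ => f q.1 q.2) (hf _ _ (line_re c _)
        (line_re d _)) ?_
    fun_prop
  · have := h _ _ (line_re c q.1) (line_re d q.2)
    rwa [line_im, line_im] at this

theorem vline_vline_comm {f : ℂ → ℂ → ℂ} {c d : ℝ}
    (h : Integrable (fun q : ℝ × ℝ => f ((c : ℂ) + (q.1 : ℂ) * Complex.I)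
      ((d : ℂ) + (q.2 : ℂ) * Complex.I))) :
    vline c (fun s => vline d fun τ => f s τ) = vline d fun τ => vline c fun s => f s τ := by
  simp only [vline]
  rw [integral_const_mul, integral_const_mul]
  congr 2
  exact integral_integral_swap h

theorem kern_continuousAt (n : ℤ) {s τ : ℂ} (h : s.re < τ.re) :
    ContinuousAt (fun q : ℂ × ℂ => kern n q.1 q.2) (s, τ) := by
  have h1 : ContinuousAt Complex.Gamma (τ - s) := by
    have := (differentiableAt_Gamma_add (a := 0) (s := τ - s) (by simpa using h)).continuousAt
    simpa using this
  have h2 : Continuous fun z : ℂ => (Complex.Gamma z)⁻¹ :=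
    Complex.differentiable_one_div_Gamma.continuous
  refine ContinuousAt.mul ?_ ?_
  · exact ContinuousAt.comp (f := fun q : ℂ × ℂ => q.2 - q.1) (g := Complex.Gamma) h1 (by fun_prop)
  · exact (h2.comp (by fun_prop : Continuous fun q : ℂ × ℂ => 1 + (n : ℂ) + q.2 + q.1)).continuousAt

/-- Interchange of the integration in `saal_transform` with a second integration over `τ`. -/
theorem saal_fubini {n x y w m : ℤ} {c d : ℝ} {g : ℂ → ℂ} (hg : LineIntegrable g d)
    (hgc : ∀ z : ℂ, z.re = d → ContinuousAt g z) (hx : 0 < c + x) (hy : 0 < c + y) (hw : 0 < c + w)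
    (hn : 0 < 1 + n + 2 * c) (hcd : c < d) (hm1 : (m : ℝ) < c) (hm2 : c < m + 1) :
    vline d (fun τ => g τ * vline c (fun s => saalFun n x y w s * kern n s τ *
      (Real.pi / Complex.sin (Real.pi * s)))) =
    vline c (fun s => saalFun n x y w s * (Real.pi / Complex.sin (Real.pi * s)) *
      vline d (fun τ => g τ * kern n s τ)) := by
  have hsin : ∀ s : ℂ, s.re = c →
      ContinuousAt (fun s : ℂ => Real.pi / Complex.sin (Real.pi * s)) s := fun s hs => by
    have h : DifferentiableAt ℂ (fun s : ℂ => Real.pi / Complex.sin (Real.pi * s)) s :=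
      (differentiableAt_const _).div (by fun_prop) (sin_pi_mul_ne_zero_of_re hs hm1 hm2)
    exact h.continuousAt
  obtain ⟨C, N, hC⟩ := saalFun_growth n x y w hx hy hw (M := 1 + n) (d := c) hn hcd
  have hφ : LineIntegrable (fun s => ((C * (1 + |s.im|) ^ N : ℝ) : ℂ) *
      (Real.pi / Complex.sin (Real.pi * s))) c := by
    have h1 : StripGrowth (fun s : ℂ => ((C * (1 + |s.im|) ^ N : ℝ) : ℂ)) c c 0 := by
      refine ⟨|C|, N, fun z _ _ _ => ?_⟩
      rw [Complex.norm_real, Real.norm_eq_abs, abs_mul, zero_mul, Real.exp_zero, mul_one,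
        abs_of_nonneg (by positivity : 0 ≤ (1 + |z.im|) ^ N)]
    refine (h1.mul (stripGrowth_pi_div_sin c c)).lineIntegrable (by linarith [Real.pi_pos]) le_rfl
      le_rfl fun s hs => ContinuousAt.mul ?_ (hsin s hs)
    refine Continuous.continuousAt (Complex.continuous_ofReal.comp ?_)
    have := Complex.continuous_im
    fun_prop
  have hI := integrable_prod_of_bound (c := d) (d := c)
    (f := fun τ s => g τ * (saalFun n x y w s * kern n s τ *
      (Real.pi / Complex.sin (Real.pi * s)))) (fun τ s hτ hs => ?_) hg.norm hφ.norm
    (fun τ s hτ hs => ?_)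
  · simp_rw [← vline_const_mul]
    rw [vline_vline_comm hI]
    refine vline_congr fun s _ => vline_congr fun τ _ => ?_
    ring
  · refine ((hgc τ hτ).comp continuousAt_fst).mul (ContinuousAt.mul (ContinuousAt.mul ?_ ?_)
      (ContinuousAt.comp (f := fun q : ℂ × ℂ => q.2) (x := (τ, s))
        (g := fun s : ℂ => Real.pi / Complex.sin (Real.pi * s)) (hsin s hs) continuousAt_snd))
    · exact ContinuousAt.comp (f := fun q : ℂ × ℂ => q.2) (saalFun_differentiableAt n x y w
        (by rw [hs]; exact hx) (by rw [hs]; exact hy) (by rw [hs]; exact hw)).continuousAt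
        continuousAt_snd
    · exact ContinuousAt.comp (f := fun q : ℂ × ℂ => (q.2, q.1)) (x := (τ, s))
        (kern_continuousAt n (by rw [hs, hτ]; exact hcd)) (by fun_prop)
  · have e1 : ((d : ℂ) + (τ.im : ℂ) * Complex.I) = τ := by
      rw [← hτ]; exact Complex.re_add_im τ
    have e2 : ((c : ℂ) + (s.im : ℂ) * Complex.I) = s := by
      rw [← hs]; exact Complex.re_add_im s
    simp only [e1, e2]
    rw [norm_mul, norm_mul, norm_mul (((_ : ℝ) : ℂ)), Complex.norm_real, Real.norm_eq_abs]
    have := hC s τ hs.ge hs.le hτ.ge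
    refine mul_le_mul_of_nonneg_left (mul_le_mul_of_nonneg_right ?_ (norm_nonneg _)) (norm_nonneg _)
    refine le_trans ?_ (this.trans (le_abs_self _))
    rw [kern]
    push_cast
    rfl

/-! ### The very-well-poised integral as a double integral -/

noncomputable section

/-- The factor `(n + 2τ) Γ(n + τ) Γ(-τ) Γ(b + τ) Γ(b - n - τ)` of the very-well-poised integrand. -/
def wpWeight (n b : ℤ) (τ : ℂ) : ℂ :=
  (n + 2 * τ) * (Complex.Gamma (n + τ) * Complex.Gamma (-τ) *
    (Complex.Gamma (b + τ) * Complex.Gamma (b - n - τ)))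

/-- The line `Re τ = c` separates the two sequences of poles of each factor of `wpWeight`. -/
structure WeightLine (n b : ℤ) (c : ℝ) : Prop where
  left : -(n : ℝ) < c
  neg : c < 0
  left' : -(b : ℝ) < c
  right : c < b - n

end

theorem wpWeight_growth {n b : ℤ} {c d : ℝ} (h1 : -(n : ℝ) < c) (h2 : -(b : ℝ) < c) :
    StripGrowth (wpWeight n b) c d (-(2 * Real.pi)) := by
  have a1 := stripGrowth_Gamma_refl n 0 (c := c) (d := d) (by linarith)
  have a2 := stripGrowth_Gamma_refl b (b - n) (c := c) (d := d) (by linarith)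
  have a3 : StripGrowth (fun τ : ℂ => n + 2 * τ) c d 0 :=
    (stripGrowth_const (n : ℂ) c d).add
      (((stripGrowth_const 2 c d).mul (stripGrowth_id c d)).rate (by ring))
  push_cast at a1 a2
  simp only [zero_sub] at a1
  exact (a3.mul (a1.mul a2)).rate (by ring)

theorem wpWeight_differentiableAt {n b : ℤ} {τ : ℂ} (h : WeightLine n b τ.re) :
    DifferentiableAt ℂ (wpWeight n b) τ := by
  have h1 := h.left
  have h2 := h.neg
  have h3 := h.left'
  have h4 := h.right
  have a1 : DifferentiableAt ℂ (fun z => Complex.Gamma (n + z)) τ :=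
    differentiableAt_Gamma_add (by simp; linarith)
  have a2 : DifferentiableAt ℂ (fun z => Complex.Gamma (0 - z)) τ :=
    differentiableAt_Gamma_sub (by simp; linarith)
  have a3 : DifferentiableAt ℂ (fun z => Complex.Gamma (b + z)) τ :=
    differentiableAt_Gamma_add (by simp; linarith)
  have a4 : DifferentiableAt ℂ (fun z => Complex.Gamma (b - n - z)) τ :=
    differentiableAt_Gamma_sub (by simp; linarith)
  simp only [zero_sub] at a2
  exact (by fun_prop : DifferentiableAt ℂ (fun z : ℂ => (n : ℂ) + 2 * z) τ).mul
    ((a1.mul a2).mul (a3.mul a4))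

theorem wpQuot_growth (n x : ℤ) {c d : ℝ} (h : 0 < c + x) : StripGrowth (wpQuot n x) c d 0 :=
  stripGrowth_Gamma_quot _ _ (by simpa [add_comm] using h)

theorem wpQuot_differentiableAt (n x : ℤ) {τ : ℂ} (h : 0 < τ.re + x) :
    DifferentiableAt ℂ (wpQuot n x) τ :=
  (differentiableAt_Gamma_add (by simp; linarith)).mul (differentiable_Gamma_inv_add _ τ)

theorem kern_differentiableAt_right (n : ℤ) {s τ : ℂ} (h : s.re < τ.re) :
    DifferentiableAt ℂ (fun τ => kern n s τ) τ := by
  have h1 : DifferentiableAt ℂ (fun τ => Complex.Gamma (-s + τ)) τ :=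
    differentiableAt_Gamma_add (by simpa using h)
  have h2 := differentiable_Gamma_inv_add (1 + n + s) τ
  refine (h1.mul h2).congr_of_eventuallyEq (Eventually.of_forall fun z => ?_)
  simp only [kern, Pi.mul_apply]
  rw [show -s + z = z - s by ring, show 1 + (n : ℂ) + s + z = 1 + n + z + s by ring]

theorem kern_growth_right (n : ℤ) {s : ℂ} {c d : ℝ} (h : s.re < c) :
    StripGrowth (fun τ => kern n s τ) c d 0 := by
  refine (stripGrowth_Gamma_quot (-s) (1 + n + s) (by simpa using h)).congr fun z _ _ _ => ?_
  rw [kern, show -s + z = z - s by ring, show 1 + (n : ℂ) + s + z = 1 + n + z + s by ring]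

/-- `wilson_eval` in the variable `τ = z - n/2`. -/
theorem wp_integral {n b : ℤ} {c : ℝ} {s t : ℂ} (hn : 1 ≤ n) (hb : 1 ≤ 2 * b - n)
    (hc : WeightLine n b c) (hs : s.re < c) (ht : t.re < c) (hst : ∀ k : ℤ, s + t ≠ k) :
    vline c (fun τ => wpWeight n b τ * (kern n s τ * kern n t τ)) =
      Complex.Gamma b * Complex.Gamma (-s) * Complex.Gamma (-t) * Complex.Gamma (b - n - s) *
        Complex.Gamma (b - n - t) * (Complex.Gamma (1 + n + s + t))⁻¹ *
        (Complex.Gamma (b - n - s - t))⁻¹ := by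
  have h1 := hc.left
  have h2 := hc.neg
  have h3 := hc.left'
  have h4 := hc.right
  -- `n / 2` and `b - n / 2` differ by an integer, and the parity of `n` decides the initial case
  obtain ⟨A₀, i, j, hA₀, hA, hB⟩ : ∃ (A₀ : ℝ) (i j : ℕ), (A₀ = 1 / 2 ∨ A₀ = 1) ∧
      A₀ + i = (n : ℝ) / 2 ∧ A₀ + j = b - (n : ℝ) / 2 := by
    rcases Int.even_or_odd' n with ⟨k, hk | hk⟩
    · refine ⟨1, (k - 1).toNat, (b - k - 1).toNat, Or.inr rfl, ?_, ?_⟩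
      · have : (((k - 1).toNat : ℤ) : ℝ) = ((k - 1 : ℤ) : ℝ) := by
          rw [Int.toNat_of_nonneg (by omega)]
        rw [Int.cast_natCast] at this
        rw [this, hk]; push_cast; ring
      · have : (((b - k - 1).toNat : ℤ) : ℝ) = ((b - k - 1 : ℤ) : ℝ) := by
          rw [Int.toNat_of_nonneg (by omega)]
        rw [Int.cast_natCast] at this
        rw [this, hk]; push_cast; ring
    · refine ⟨1 / 2, k.toNat, (b - k - 1).toNat, Or.inl rfl, ?_, ?_⟩
      · have : ((k.toNat : ℤ) : ℝ) = ((k : ℤ) : ℝ) := by rw [Int.toNat_of_nonneg (by omega)]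
        rw [Int.cast_natCast] at this
        rw [this, hk]; push_cast; ring
      · have : (((b - k - 1).toNat : ℤ) : ℝ) = ((b - k - 1 : ℤ) : ℝ) := by
          rw [Int.toNat_of_nonneg (by omega)]
        rw [Int.cast_natCast] at this
        rw [this, hk]; push_cast; ring
  have hre : ((n : ℂ) / 2).re = (n : ℝ) / 2 := by
    rw [show (n : ℂ) / 2 = (((n : ℝ) / 2 : ℝ) : ℂ) by push_cast; rfl, Complex.ofReal_re]
  have hsep : WilsonSep (A₀ + i) (A₀ + j) (-s - n / 2) (-t - n / 2) (c + n / 2) := by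
    rw [hA, hB]
    refine ⟨abs_lt.2 ⟨by linarith, by linarith⟩, abs_lt.2 ⟨by linarith, by linarith⟩, ?_, ?_⟩ <;>
    · rw [Complex.sub_re, Complex.neg_re, hre]; linarith
  have hev := wilson_eval hA₀ i j hsep fun k hk =>
    hst (-k - n) (by push_cast; linear_combination -hk)
  rw [hA, hB, wilsonInt, ← vline_comp_add, wilsonVal] at hev
  push_cast at hev
  rw [show (n : ℂ) / 2 + (b - n / 2) = b by ring, show (n : ℂ) / 2 + (-s - n / 2) = -s by ring,
    show (n : ℂ) / 2 + (-t - n / 2) = -t by ring,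
    show (b : ℂ) - n / 2 + (-s - n / 2) = b - n - s by ring,
    show (b : ℂ) - n / 2 + (-t - n / 2) = b - n - t by ring,
    show 1 - (-s - (n : ℂ) / 2) - (-t - n / 2) = 1 + n + s + t by ring,
    show (b : ℂ) + (-s - n / 2) + (-t - n / 2) = b - n - s - t by ring] at hev
  rw [← hev]
  refine vline_congr fun τ _ => ?_
  simp only [wilsonFun, wpWeight, kern]
  push_cast
  rw [show (n : ℂ) / 2 + (τ + n / 2) = n + τ by ring, show (n : ℂ) / 2 - (τ + n / 2) = -τ by ring,
    show (b : ℂ) - n / 2 + (τ + n / 2) = b + τ by ring,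
    show (b : ℂ) - n / 2 - (τ + n / 2) = b - n - τ by ring,
    show -s - (n : ℂ) / 2 + (τ + n / 2) = τ - s by ring,
    show -t - (n : ℂ) / 2 + (τ + n / 2) = τ - t by ring,
    show 1 - (-s - (n : ℂ) / 2) + (τ + n / 2) = 1 + n + τ + s by ring,
    show 1 - (-t - (n : ℂ) / 2) + (τ + n / 2) = 1 + n + τ + t by ring]
  ring

section
variable {n b x y w x' y' w' : ℤ} {c c₁ c₂ : ℝ}

/-- The very-well-poised integral with six free parameters as a double integral. The two triples
of parameters are expanded by `saal_transform`, and the inner integral over `τ` is evaluated by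
`wp_integral`. -/
theorem wp_double_integral (hn : 1 ≤ n) (hb : 1 ≤ 2 * b - n) (hc : WeightLine n b c)
    (hxy : 0 ≤ n - x - y) (hxw : 0 ≤ n - x - w) (hyw : 0 ≤ n - y - w)
    (hxy' : 0 ≤ n - x' - y') (hxw' : 0 ≤ n - x' - w') (hyw' : 0 ≤ n - y' - w')
    (hc₁ : c₁ = 1 / 3 - ((min x (min y w) : ℤ) : ℝ))
    (hc₂ : c₂ = 1 / 3 - ((min x' (min y' w') : ℤ) : ℝ)) (h₁ : c₁ < c) (h₂ : c₂ < c) :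
    (-1) ^ (x + y + w + x' + y' + w') *
      (fact (n - x - y) * fact (n - x - w) * fact (n - y - w)) *
      (fact (n - x' - y') * fact (n - x' - w') * fact (n - y' - w')) *
      vline c (fun τ => wpWeight n b τ * (wpQuot n x τ * wpQuot n y τ * wpQuot n w τ) *
        (wpQuot n x' τ * wpQuot n y' τ * wpQuot n w' τ)) =
    vline c₂ fun t => saalFun n x' y' w' t * (Real.pi / Complex.sin (Real.pi * t)) *
      vline c₁ fun s => saalFun n x y w s * (Real.pi / Complex.sin (Real.pi * s)) *
        (Complex.Gamma b * Complex.Gamma (-s) * Complex.Gamma (-t) * Complex.Gamma (b - n - s) *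
        Complex.Gamma (b - n - t) * (Complex.Gamma (1 + n + s + t))⁻¹ *
        (Complex.Gamma (b - n - s - t))⁻¹) := by
  have hm : ∀ {x y w : ℤ} {e : ℝ}, 0 ≤ n - x - y → 0 ≤ n - x - w → 0 ≤ n - y - w →
      e = 1 / 3 - ((min x (min y w) : ℤ) : ℝ) →
      0 < e + x ∧ 0 < e + y ∧ 0 < e + w ∧ 0 < 1 + n + 2 * e := by
    intro x y w e h1 h2 h3 he
    have k1 : ((min x (min y w) : ℤ) : ℝ) ≤ x := by exact_mod_cast min_le_left _ _
    have k2 : ((min x (min y w) : ℤ) : ℝ) ≤ y := by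
      exact_mod_cast (min_le_right _ _).trans (min_le_left _ _)
    have k3 : ((min x (min y w) : ℤ) : ℝ) ≤ w := by
      exact_mod_cast (min_le_right _ _).trans (min_le_right _ _)
    have h1' : (0 : ℝ) ≤ n - x - y := by exact_mod_cast h1
    exact ⟨by linarith, by linarith, by linarith, by linarith⟩
  obtain ⟨p1, p2, p3, p4⟩ := hm hxy hxw hyw hc₁
  obtain ⟨q1, q2, q3, q4⟩ := hm hxy' hxw' hyw' hc₂
  have hpi : -(2 * Real.pi) < 0 := by linarith [Real.pi_pos]
  have hQg := wpWeight_growth (d := c) hc.left hc.left'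
  have hQc : ∀ z : ℂ, z.re = c → ContinuousAt (wpWeight n b) z := fun z hz =>
    (wpWeight_differentiableAt (by rw [hz]; exact hc)).continuousAt
  have hqc : ∀ {x y w : ℤ} {e : ℝ}, e < c → 0 < e + x → 0 < e + y → 0 < e + w →
      StripGrowth (fun τ => wpQuot n x τ * wpQuot n y τ * wpQuot n w τ) c c 0 ∧
      ∀ z : ℂ, z.re = c → ContinuousAt (fun τ => wpQuot n x τ * wpQuot n y τ * wpQuot n w τ) z := by
    intro x y w e he h1 h2 h3
    refine ⟨(((wpQuot_growth n x (by linarith)).mul (wpQuot_growth n y (by linarith))).mul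
      (wpQuot_growth n w (by linarith))).rate (by ring), fun z hz => ?_⟩
    exact (((wpQuot_differentiableAt n x (by linarith)).mul
      (wpQuot_differentiableAt n y (by linarith))).mul
      (wpQuot_differentiableAt n w (by linarith))).continuousAt
  obtain ⟨g1, k1⟩ := hqc h₁ p1 p2 p3
  -- the interchanges of the integrations over `s` and `τ`, and over `t` and `τ`
  have step2 := fun t : ℂ => fun ht : t.re = c₂ => saal_fubini (n := n) (x := x) (y := y) (w := w)
    (m := -min x (min y w)) (c := c₁) (d := c) (g := fun τ => wpWeight n b τ * kern n t τ)
    (((hQg.mul (kern_growth_right n (by rw [ht]; exact h₂))).rate (add_zero _)).lineIntegrable hpi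
      le_rfl le_rfl fun z hz => (hQc z hz).mul
        (kern_differentiableAt_right n (by rw [ht, hz]; exact h₂)).continuousAt)
    (fun z hz => (hQc z hz).mul
        (kern_differentiableAt_right n (by rw [ht, hz]; exact h₂)).continuousAt)
    p1 p2 p3 p4 h₁ (by rw [hc₁]; push_cast; linarith) (by rw [hc₁]; push_cast; linarith)
  have step1 := saal_fubini (n := n) (x := x') (y := y') (w := w')
    (m := -min x' (min y' w')) (c := c₂) (d := c)
    (g := fun τ => wpWeight n b τ * (wpQuot n x τ * wpQuot n y τ * wpQuot n w τ))
    (((hQg.mul g1).rate (add_zero _)).lineIntegrable hpi le_rfl le_rfl fun z hz =>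
      (hQc z hz).mul (k1 z hz)) (fun z hz => (hQc z hz).mul (k1 z hz))
    q1 q2 q3 q4 h₂ (by rw [hc₂]; push_cast; linarith) (by rw [hc₂]; push_cast; linarith)
  -- the expansions of the two triples
  have tr1 := fun τ : ℂ => fun hτ : τ.re = c => saal_transform (n := n) (x := x) (y := y) (w := w)
    (c := c₁) (τ := τ) hxy hxw hyw (by rw [hc₁]; linarith) (by rw [hc₁]; linarith)
    (by rw [hτ]; exact h₁)
  have tr2 := fun τ : ℂ => fun hτ : τ.re = c => saal_transform (n := n) (x := x') (y := y')
    (w := w') (c := c₂) (τ := τ) hxy' hxw' hyw' (by rw [hc₂]; linarith) (by rw [hc₂]; linarith)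
    (by rw [hτ]; exact h₂)
  set E := fact (n - x - y) * fact (n - x - w) * fact (n - y - w) with hE
  set E' := fact (n - x' - y') * fact (n - x' - w') * fact (n - y' - w') with hE'
  have hsgn : (-1 : ℂ) ^ (x + y + w + x' + y' + w') =
      (-1) ^ (n + x + y + w) * (-1) ^ (n + x' + y' + w') := by
    rw [← zpow_add₀ (by norm_num), show n + x + y + w + (n + x' + y' + w') =
      2 * n + (x + y + w + x' + y' + w') by ring, zpow_add₀ (by norm_num) (2 * n), zpow_mul]
    norm_num
  rw [hsgn]
  calc _ = (-1) ^ (n + x + y + w) * E * ((-1) ^ (n + x' + y' + w') * E' *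
        vline c (fun τ => wpWeight n b τ * (wpQuot n x τ * wpQuot n y τ * wpQuot n w τ) *
        (wpQuot n x' τ * wpQuot n y' τ * wpQuot n w' τ))) := by ring
    _ = (-1) ^ (n + x + y + w) * E * vline c₂ (fun t => saalFun n x' y' w' t *
        (Real.pi / Complex.sin (Real.pi * t)) * vline c fun τ =>
          wpWeight n b τ * (wpQuot n x τ * wpQuot n y τ * wpQuot n w τ) * kern n t τ) := by
      rw [← step1, ← vline_const_mul]
      congr 1
      refine vline_congr fun τ hτ => ?_
      rw [tr2 τ hτ]
      ring
    _ = _ := by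
      rw [← vline_const_mul]
      refine vline_congr fun t ht => ?_
      rw [show ∀ a b c : ℂ, a * (b * c) = b * (a * c) by intros; ring]
      congr 1
      rw [← vline_const_mul]
      calc _ = vline c (fun τ => wpWeight n b τ * kern n t τ *
            vline c₁ fun s => saalFun n x y w s * kern n s τ *
              (Real.pi / Complex.sin (Real.pi * s))) := by
            refine vline_congr fun τ hτ => ?_
            rw [tr1 τ hτ]
            ring
        _ = _ := by
          rw [step2 t ht]
          refine vline_congr fun s hs => ?_
          congr 1
          rw [← wp_integral hn hb hc (by rw [hs]; exact h₁) (by rw [ht]; exact h₂) ?_]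
          · refine vline_congr fun τ _ => ?_
            ring
          · intro k hk
            have e1 := congrArg Complex.re hk
            rw [Complex.add_re, hs, ht, hc₁, hc₂, Complex.intCast_re] at e1
            -- `Re (s + t)` differs from an integer by `2/3`
            have e2 : (2 : ℝ) = 3 * (k + min x (min y w) + min x' (min y' w') : ℤ) := by
              push_cast at e1 ⊢
              linarith
            have e3 : (2 : ℤ) = 3 * (k + min x (min y w) + min x' (min y' w')) := by
              exact_mod_cast e2
            omega

end

/-! ### The double integral `G` -/

theorem poch_eq_Gamma {z : ℂ} (hz : ∀ k : ℤ, z ≠ k) {m : ℤ} (hm : 0 ≤ m) :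
    poch z m = Complex.Gamma (z + m) * (Complex.Gamma z)⁻¹ := by
  obtain ⟨k, rfl⟩ := Int.eq_ofNat_of_zero_le hm
  have h0 : Complex.Gamma z ≠ 0 := Complex.Gamma_ne_zero fun m h => hz (-m) (by rw [h]; simp)
  rw [poch, Int.toNat_natCast]
  induction k with
  | zero => simp [h0]
  | succ k ih =>
    have h1 : z + k ≠ 0 := fun h => hz (-k) (by push_cast; linear_combination h)
    rw [ascPochhammer_succ_eval, ih (by positivity)]
    push_cast
    rw [← add_assoc, Complex.Gamma_add_one _ h1]
    ring

theorem Gamma_eq_pi_div_sin {z : ℂ} (hz : ∀ k : ℤ, z ≠ k) :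
    Complex.Gamma z = Real.pi / Complex.sin (Real.pi * z) * (Complex.Gamma (1 - z))⁻¹ := by
  have h0 : Complex.Gamma (1 - z) ≠ 0 :=
    Complex.Gamma_ne_zero fun m h => hz (1 + m) (by push_cast; linear_combination -h)
  rw [← Complex.Gamma_mul_Gamma_one_sub, mul_inv_cancel_right₀ h0]

theorem sin_int_sub (m : ℤ) (z : ℂ) :
    Complex.sin (Real.pi * (m - z)) = -((-1) ^ m * Complex.sin (Real.pi * z)) := by
  rw [sub_eq_add_neg, sin_pi_mul_int_add, mul_neg, Complex.sin_neg, mul_neg]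

theorem neg_one_zpow_mul_self (m : ℤ) : (-1 : ℂ) ^ m * (-1) ^ m = 1 := by
  rw [← mul_zpow]; norm_num

theorem neg_one_zpow_inv (m : ℤ) : ((-1 : ℂ) ^ m)⁻¹ = (-1) ^ m :=
  inv_eq_of_mul_eq_one_left (neg_one_zpow_mul_self m)

/-- One of the two triples of Pochhammer symbols in `G`, by the reflection formula. -/
theorem poch_triple {n b x y w : ℤ} {s : ℂ} (hs : ∀ k : ℤ, s ≠ k) (hx : 1 ≤ x)
    (hxw : 0 ≤ n - x - w) (hw : 0 ≤ w + b - n - 1) :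
    poch (s + 1) (x - 1) * poch (s + (x + y + w - n : ℤ)) (y - (x + y + w - n)) *
        poch (s + (1 + n - b : ℤ)) (w - (1 + n - b)) *
        (Real.pi / Complex.sin (Real.pi * s)) ^ 3 =
      (-1) ^ (b - n) * (saalFun n x y w s * (Real.pi / Complex.sin (Real.pi * s)) *
        (Complex.Gamma (-s) * Complex.Gamma (b - n - s))) := by
  have e1 : ∀ m : ℤ, ∀ k : ℤ, s + m ≠ k := fun m k h =>
    hs (k - m) (by push_cast; linear_combination h)
  have e2 : ∀ k : ℤ, -s ≠ k := fun k h => hs (-k) (by push_cast; linear_combination -h)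
  have e3 : ∀ k : ℤ, (b : ℂ) - n - s ≠ k := fun k h =>
    hs (b - n - k) (by push_cast; linear_combination -h)
  have e4 := e1 1
  rw [Int.cast_one] at e4
  rw [poch_eq_Gamma e4 (by omega), poch_eq_Gamma (e1 _) (by omega),
    poch_eq_Gamma (e1 _) (by omega), Gamma_eq_pi_div_sin e2, Gamma_eq_pi_div_sin e3,
    show (b : ℂ) - n - s = (b - n : ℤ) - s by push_cast; ring, sin_int_sub, mul_neg,
    Complex.sin_neg, div_neg, div_neg, div_mul_eq_div_div_swap, div_eq_mul_inv _ ((-1 :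
      ℂ) ^ (b - n)),
    neg_one_zpow_inv, saalFun]
  push_cast
  rw [show s + 1 + ((x : ℂ) - 1) = x + s by ring, show 1 - -s = s + 1 by ring,
    show s + ((x : ℂ) + y + w - n) + (y - (x + y + w - n)) = y + s by ring,
    show s + (1 + (n : ℂ) - b) + (w - (1 + n - b)) = w + s by ring,
    show 1 - ((b : ℂ) - n - s) = s + (1 + n - b) by ring,
    show s + ((x : ℂ) + y + w - n) = x + y + w - n + s by ring]
  linear_combination -(Complex.Gamma (x + s) * Complex.Gamma (y + s) * Complex.Gamma (w + s) *
    (Complex.Gamma (x + y + w - n + s))⁻¹ * (Complex.Gamma (s + 1))⁻¹ *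
    (Complex.Gamma (s + (1 + n - b)))⁻¹ * (Real.pi / Complex.sin (Real.pi * s)) ^ 3) *
    neg_one_zpow_mul_self (b - n)

/-- The factor of `G` that depends on both variables, by the reflection formula. -/
theorem poch_coupling {n b : ℤ} {s t : ℂ} (hst : ∀ k : ℤ, s + t ≠ k) (hb : 1 ≤ b) :
    fact (b - 1) / poch (t + s + (1 + n - b : ℤ)) b * (Complex.sin (Real.pi * (s + t)) / Real.pi) =
      -(-1) ^ (b - n) * (Complex.Gamma b * (Complex.Gamma (1 + n + s + t))⁻¹ *
        (Complex.Gamma (b - n - s - t))⁻¹) := by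
  have e1 : ∀ m : ℤ, ∀ k : ℤ, t + s + m ≠ k := fun m k h =>
    hst (k - m) (by push_cast; linear_combination h)
  have e3 : ∀ k : ℤ, (b : ℂ) - n - s - t ≠ k := fun k h =>
    hst (b - n - k) (by push_cast; linear_combination -h)
  have hG : Complex.Gamma (b : ℂ) = fact (b - 1) := by
    rw [← Gamma_int_add_one (by omega)]; congr 1; push_cast; ring
  rw [poch_eq_Gamma (e1 _) (by omega), Gamma_eq_pi_div_sin e3,
    show (b : ℂ) - n - s - t = (b - n : ℤ) - (s + t) by push_cast; ring, sin_int_sub, hG]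
  push_cast
  rw [show t + s + (1 + (n : ℂ) - b) + b = 1 + n + s + t by ring,
    show 1 - ((b : ℂ) - n - (s + t)) = t + s + (1 + n - b) by ring]
  simp only [div_eq_mul_inv, mul_inv, inv_inv, inv_neg, neg_one_zpow_inv]
  linear_combination -(fact (b - 1) * (Complex.Gamma (1 + n + s + t))⁻¹ *
    Complex.Gamma (t + s + (1 + n - b)) * (Complex.sin (Real.pi * (s + t)) * (Real.pi : ℂ)⁻¹)) *
    neg_one_zpow_mul_self (b - n)

theorem HParams.Admissible.bounds {p : HParams} (hp : p.Admissible) :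
    (∀ j : Fin 6, 1 ≤ p.h j.succ ∧ 1 ≤ p.h j.succ + p.hm - p.h 0) ∧
      ∀ j k : Fin 6, j ≠ k → 0 ≤ p.h 0 - p.h j.succ - p.h k.succ := by
  constructor
  · intro j
    have h1 := hp (.e 0 j.succ (Fin.succ_pos j))
    have h2 := hp (.ebar j.succ (Fin.succ_ne_zero j))
    simp only [eVal, if_true] at h1 h2
    omega
  · intro j k hjk
    rcases lt_or_gt_of_ne hjk with h | h
    · have h1 := hp (.e j.succ k.succ (Fin.succ_lt_succ_iff.2 h))
      simp only [eVal, if_neg (Fin.succ_ne_zero j)] at h1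
      exact h1
    · have h1 := hp (.e k.succ j.succ (Fin.succ_lt_succ_iff.2 h))
      simp only [eVal, if_neg (Fin.succ_ne_zero k)] at h1
      omega

/-- The inequalities between `h₀`, `h₋₁`, and `h₁, …, h₆`, in explicit form. -/
theorem HParams.Admissible.explicit {p : HParams} (hp : p.Admissible) :
    (1 ≤ p.h 1 ∧ 1 ≤ p.h 2 ∧ 1 ≤ p.h 3 ∧ 1 ≤ p.h 4 ∧ 1 ≤ p.h 5 ∧ 1 ≤ p.h 6) ∧
    (1 ≤ p.h 1 + p.hm - p.h 0 ∧ 1 ≤ p.h 2 + p.hm - p.h 0 ∧ 1 ≤ p.h 3 + p.hm - p.h 0 ∧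
      1 ≤ p.h 4 + p.hm - p.h 0 ∧ 1 ≤ p.h 5 + p.hm - p.h 0 ∧ 1 ≤ p.h 6 + p.hm - p.h 0) ∧
    (0 ≤ p.h 0 - p.h 1 - p.h 3 ∧ 0 ≤ p.h 0 - p.h 1 - p.h 5 ∧ 0 ≤ p.h 0 - p.h 3 - p.h 5) ∧
    (0 ≤ p.h 0 - p.h 2 - p.h 4 ∧ 0 ≤ p.h 0 - p.h 2 - p.h 6 ∧ 0 ≤ p.h 0 - p.h 4 - p.h 6) := by
  obtain ⟨h1, h2⟩ := hp.bounds
  exact ⟨⟨(h1 0).1, (h1 1).1, (h1 2).1, (h1 3).1, (h1 4).1, (h1 5).1⟩,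
    ⟨(h1 0).2, (h1 1).2, (h1 2).2, (h1 3).2, (h1 4).2, (h1 5).2⟩,
    ⟨h2 0 2 (by decide), h2 0 4 (by decide), h2 2 4 (by decide)⟩,
    ⟨h2 1 3 (by decide), h2 1 5 (by decide), h2 3 5 (by decide)⟩⟩

theorem toAB_admissible {p : HParams} (hp : p.Admissible) : (toAB p).Admissible := by
  have h := hp.explicit
  simp only [ABParams.Admissible, toAB, max_le_iff, le_min_iff]
  simp
  omega

theorem hMin_le (p : HParams) (j : Fin 6) : hMin p ≤ p.h j.succ :=
  Finset.inf'_le _ (Finset.mem_univ j)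

theorem hMin_eq (p : HParams) : hMin p =
    min (min (p.h 1) (min (p.h 3) (p.h 5))) (min (p.h 2) (min (p.h 4) (p.h 6))) := by
  refine le_antisymm ?_ ?_
  · simp only [le_min_iff]
    exact ⟨⟨hMin_le p 0, hMin_le p 2, hMin_le p 4⟩, ⟨hMin_le p 1, hMin_le p 3, hMin_le p 5⟩⟩
  · refine Finset.le_inf' _ _ fun j _ => ?_
    fin_cases j <;> simp

theorem prod_wpQuot (p : HParams) (τ : ℂ) :
    ((p.h 0 : ℂ) + 2 * τ) *
      (Complex.Gamma ((p.hm : ℂ) + τ) * ∏ j : Fin 7, Complex.Gamma ((p.h j : ℂ) + τ)) *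
      Complex.Gamma ((p.hm : ℂ) - (p.h 0 : ℂ) - τ) * Complex.Gamma (-τ) /
      ∏ j : Fin 6, Complex.Gamma (1 + (p.h 0 : ℂ) - (p.h j.succ : ℂ) + τ) =
    wpWeight (p.h 0) p.hm τ * ∏ j : Fin 6, wpQuot (p.h 0) (p.h j.succ) τ := by
  simp only [wpWeight, wpQuot]
  rw [Fin.prod_univ_succ, Finset.prod_mul_distrib, Finset.prod_inv_distrib, div_eq_mul_inv]
  ring

theorem prod_wpQuot_growth (n : ℤ) {h : Fin 6 → ℤ} {c d : ℝ} (hc : ∀ j, 0 < c + h j)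
    (s : Finset (Fin 6)) : StripGrowth (fun τ => ∏ j ∈ s, wpQuot n (h j) τ) c d 0 := by
  classical
  induction s using Finset.induction_on with
  | empty => simpa using stripGrowth_const 1 c d
  | insert a s ha ih =>
    simp_rw [Finset.prod_insert ha]
    exact ((wpQuot_growth n (h a) (hc a)).mul ih).rate (by ring)

/-- No pole of the integrand lies between the two lines. -/
theorem F6'_eq {p : HParams} {c : ℝ} (h1 : WeightLine (p.h 0) p.hm (1 / 3 - (hMin p : ℝ)))
    (h2 : WeightLine (p.h 0) p.hm c) (hc : 1 / 3 - (hMin p : ℝ) ≤ c) :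
    F6' p = vline c fun τ =>
      wpWeight (p.h 0) p.hm τ * ∏ j : Fin 6, wpQuot (p.h 0) (p.h j.succ) τ := by
  rw [F6']
  simp_rw [prod_wpQuot]
  have hj : ∀ j : Fin 6, (hMin p : ℝ) ≤ p.h j.succ := fun j => by exact_mod_cast hMin_le p j
  symm
  refine vline_eq_vline (r := -(2 * Real.pi)) hc (by linarith [Real.pi_pos]) (fun z k1 k2 => ?_) ?_
  · refine (wpWeight_differentiableAt ⟨?_, ?_, ?_, ?_⟩).mul
      (DifferentiableAt.fun_finsetProd fun j _ => wpQuot_differentiableAt _ _ ?_)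
    · linarith [h1.left]
    · linarith [h2.neg]
    · linarith [h1.left']
    · linarith [h2.right]
    · linarith [hj j]
  · exact ((wpWeight_growth h1.left h1.left').mul (prod_wpQuot_growth _ (fun j => by
      linarith [hj j]) _)).rate (by ring)

/-- Cancellation of the factorials in the normalised integrand. -/
theorem cancel_six {f₁ f₂ f₃ f₄ f₅ f₆ : ℂ} (h₁ : f₁ ≠ 0) (h₂ : f₂ ≠ 0) (h₃ : f₃ ≠ 0) (h₄ : f₄ ≠ 0)
    (h₅ : f₅ ≠ 0) (h₆ : f₆ ≠ 0) (a₁ a₂ a₃ a₄ a₅ a₆ u v w : ℂ) :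
    f₁ * f₃ * f₅ * (f₂ * f₄ * f₆) * (a₂ / f₂ * (a₄ / f₄) * (a₆ / f₆)) * u *
      (a₁ / f₁ * (a₃ / f₃) * (a₅ / f₅) * v * w) =
      a₁ * a₃ * a₅ * v * (a₂ * a₄ * a₆ * u) * w := by
  field_simp

/-- The representation of `F(𝐡)` by the double integral. -/
theorem F_eq_G {p : HParams} (hp : p.Admissible) :
    F p = (-1 : ℂ) ^ (1 + p.hm + ∑ j : Fin 7, p.h j) * G (toAB p) := by
  obtain ⟨⟨a1, a2, a3, a4, a5, a6⟩, ⟨b1, b2, b3, b4, b5, b6⟩, ⟨o1, o2, o3⟩, ⟨e1, e2, e3⟩⟩ :=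
    hp.explicit
  set n := p.h 0 with hn
  set b := p.hm with hb
  set m₁ := min (p.h 1) (min (p.h 3) (p.h 5)) with hm₁
  set m₂ := min (p.h 2) (min (p.h 4) (p.h 6)) with hm₂
  have i1 : 1 ≤ m₁ ∧ 1 ≤ m₁ + b - n ∧ 2 * m₁ ≤ n := by omega
  have i2 : 1 ≤ m₂ ∧ 1 ≤ m₂ + b - n ∧ 2 * m₂ ≤ n := by omega
  -- `D` is the leftmost pole of `Γ(b - n - τ) Γ(-τ)`; the line `Re τ = D - 1/2` lies to the right
  -- of the lines of `s` and `t`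
  set D := min 0 (b - n) with hD
  have iD : D ≤ 0 ∧ D ≤ b - n ∧ 1 - n ≤ D ∧ 1 - b ≤ D ∧ 1 - m₁ ≤ D ∧ 1 - m₂ ≤ D := by omega
  have hmin : hMin p = min m₁ m₂ := hMin_eq p
  have iM : min m₁ m₂ ≤ n - 1 ∧ min m₁ m₂ ≤ b - 1 ∧ 1 - D ≤ min m₁ m₂ := by omega
  have hline : ∀ e : ℝ, 1 / 3 - ((min m₁ m₂ : ℤ) : ℝ) ≤ e → e ≤ (D : ℝ) - 1 / 2 →
      WeightLine n b e := by
    intro e k1 k2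
    have r1 : ((min m₁ m₂ : ℤ) : ℝ) ≤ ((n - 1 : ℤ) : ℝ) := by exact_mod_cast iM.1
    have r2 : ((min m₁ m₂ : ℤ) : ℝ) ≤ ((b - 1 : ℤ) : ℝ) := by exact_mod_cast iM.2.1
    have r3 : (D : ℝ) ≤ 0 := by exact_mod_cast iD.1
    have r4 : (D : ℝ) ≤ ((b - n : ℤ) : ℝ) := by exact_mod_cast iD.2.1
    rw [Int.cast_sub, Int.cast_one] at r1 r2
    rw [Int.cast_sub] at r4
    exact ⟨by linarith, by linarith, by linarith, by linarith⟩
  have r5 : 1 - (m₁ : ℝ) ≤ D := by exact_mod_cast iD.2.2.2.2.1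
  have r6 : 1 - (m₂ : ℝ) ≤ D := by exact_mod_cast iD.2.2.2.2.2
  have r7 : 1 - (D : ℝ) ≤ ((min m₁ m₂ : ℤ) : ℝ) := by exact_mod_cast iM.2.2
  have hprod : ∀ τ, wpWeight n b τ * ∏ j : Fin 6, wpQuot n (p.h j.succ) τ =
      wpWeight n b τ * (wpQuot n (p.h 1) τ * wpQuot n (p.h 3) τ * wpQuot n (p.h 5) τ) *
        (wpQuot n (p.h 2) τ * wpQuot n (p.h 4) τ * wpQuot n (p.h 6) τ) := by
    intro τ
    have : ∏ j : Fin 6, wpQuot n (p.h j.succ) τ = wpQuot n (p.h 1) τ * wpQuot n (p.h 2) τ *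
        wpQuot n (p.h 3) τ * wpQuot n (p.h 4) τ * wpQuot n (p.h 5) τ * wpQuot n (p.h 6) τ :=
      Fin.prod_univ_six _
    rw [this]
    ring
  have hF : F6' p = vline ((D : ℝ) - 1 / 2) fun τ =>
      wpWeight n b τ * (wpQuot n (p.h 1) τ * wpQuot n (p.h 3) τ * wpQuot n (p.h 5) τ) *
        (wpQuot n (p.h 2) τ * wpQuot n (p.h 4) τ * wpQuot n (p.h 6) τ) :=
    (F6'_eq (by rw [hmin]; exact hline _ le_rfl (by linarith)) (hline _ (by linarith) le_rfl)
      (by rw [hmin]; linarith)).trans (vline_congr fun τ _ => hprod τ)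
  have hdouble := wp_double_integral (n := n) (b := b) (x := p.h 1) (y := p.h 3) (w := p.h 5)
    (x' := p.h 2) (y' := p.h 4) (w' := p.h 6) (c := (D : ℝ) - 1 / 2) (by omega) (by omega)
    (hline _ (by linarith) le_rfl) o1 o2 o3 e1 e2 e3 rfl rfl (by rw [← hm₁]; linarith)
    (by rw [← hm₂]; linarith)
  rw [← hm₁, ← hm₂] at hdouble
  rw [← hF] at hdouble
  have hnonint : ∀ {m : ℤ} {s : ℂ}, s.re = 1 / 3 - (m : ℝ) → ∀ k : ℤ, s ≠ k := by
    rintro m s hs k rfl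
    rw [Complex.intCast_re] at hs
    have : (3 : ℝ) * (k + m : ℤ) = 1 := by push_cast; linarith
    have : (3 : ℤ) * (k + m) = 1 := by exact_mod_cast this
    omega
  have hG : (fact (p.h 1 - 1) * fact (n - p.h 1 - p.h 5) * fact (p.h 5 + b - n - 1)) *
      (fact (p.h 2 - 1) * fact (n - p.h 2 - p.h 6) * fact (p.h 6 + b - n - 1)) * G (toAB p) =
      -(-1) ^ (b - n) * ((-1) ^ (p.h 1 + p.h 3 + p.h 5 + p.h 2 + p.h 4 + p.h 6) *
      (fact (n - p.h 1 - p.h 3) * fact (n - p.h 1 - p.h 5) * fact (n - p.h 3 - p.h 5)) *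
      (fact (n - p.h 2 - p.h 4) * fact (n - p.h 2 - p.h 6) * fact (n - p.h 4 - p.h 6)) *
      F6' p) := by
    rw [hdouble, ← vline_const_mul, G, ← vline_const_mul]
    have a0 : (toAB p).a 0 = 1 + n - b := rfl
    have a1' : (toAB p).a 1 = p.h 1 := rfl
    have a2' : (toAB p).a 2 = p.h 2 := rfl
    have a3' : (toAB p).a 3 = p.h 3 := rfl
    have a4' : (toAB p).a 4 = p.h 4 := rfl
    have a5' : (toAB p).a 5 = p.h 5 := rfl
    have a6' : (toAB p).a 6 = p.h 6 := rfl
    have b0 : (toAB p).b 0 = 1 + n := rfl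
    have b1' : (toAB p).b 1 = 1 := rfl
    have b2' : (toAB p).b 2 = 1 := rfl
    have b3' : (toAB p).b 3 = p.h 1 + p.h 3 + p.h 5 - n := rfl
    have b4' : (toAB p).b 4 = p.h 2 + p.h 4 + p.h 6 - n := rfl
    have b5' : (toAB p).b 5 = 1 + n - b := rfl
    have b6' : (toAB p).b 6 = 1 + n - b := rfl
    simp only [pochFactor, a0, a1', a2', a3', a4', a5', a6', b0, b1', b2', b3', b4', b5', b6']
    refine vline_congr fun t ht => ?_
    rw [← mul_assoc, ← vline_const_mul, ← mul_assoc, ← vline_const_mul, ← vline_const_mul]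
    refine vline_congr fun s hs => ?_
    have hs' := hnonint hs
    have ht' := hnonint ht
    have hst : ∀ k : ℤ, s + t ≠ k := by
      intro k hk
      have e1 := congrArg Complex.re hk
      rw [Complex.add_re, hs, ht, ← hm₁, ← hm₂, Complex.intCast_re] at e1
      have e2 : (2 : ℝ) = 3 * (k + m₁ + m₂ : ℤ) := by push_cast at e1 ⊢; linarith
      have e3 : (2 : ℤ) = 3 * (k + m₁ + m₂) := by exact_mod_cast e2
      omega
    have P1 := poch_triple (n := n) (b := b) (x := p.h 1) (y := p.h 3) (w := p.h 5) hs' a1 o2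
      (by omega)
    have P2 := poch_triple (n := n) (b := b) (x := p.h 2) (y := p.h 4) (w := p.h 6) ht' a2 e2
      (by omega)
    have P3 := poch_coupling (n := n) (b := b) (s := s) (t := t) hst (by omega)
    rw [show (1 + n - (1 + n - b)) = b by ring,
      show p.h 3 - (p.h 1 + p.h 3 + p.h 5 - n) = n - p.h 1 - p.h 5 by ring,
      show p.h 4 - (p.h 2 + p.h 4 + p.h 6 - n) = n - p.h 2 - p.h 6 by ring,
      show p.h 5 - (1 + n - b) = p.h 5 + b - n - 1 by ring,
      show p.h 6 - (1 + n - b) = p.h 6 + b - n - 1 by ring, Int.cast_one]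
    rw [show p.h 3 - (p.h 1 + p.h 3 + p.h 5 - n) = n - p.h 1 - p.h 5 by ring,
      show p.h 5 - (1 + n - b) = p.h 5 + b - n - 1 by ring] at P1
    rw [show p.h 4 - (p.h 2 + p.h 4 + p.h 6 - n) = n - p.h 2 - p.h 6 by ring,
      show p.h 6 - (1 + n - b) = p.h 6 + b - n - 1 by ring] at P2
    have hb1 : fact (1 + n - (1 + n - b) - 1) = fact (b - 1) := by
      rw [show 1 + n - (1 + n - b) - 1 = b - 1 by ring]
    have f1 := fact_ne_zero (p.h 1 - 1)
    have f2 := fact_ne_zero (p.h 2 - 1)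
    have f3 := fact_ne_zero (n - p.h 1 - p.h 5)
    have f4 := fact_ne_zero (n - p.h 2 - p.h 6)
    have f5 := fact_ne_zero (p.h 5 + b - n - 1)
    have f6 := fact_ne_zero (p.h 6 + b - n - 1)
    rw [mul_assoc _ (fact (b - 1) / _), cancel_six f1 f2 f3 f4 f5 f6, P1, P2, P3]
    linear_combination -((-1) ^ (b - n) * (saalFun n (p.h 1) (p.h 3) (p.h 5) s *
      (Real.pi / Complex.sin (Real.pi * s)) * (Complex.Gamma (-s) * Complex.Gamma (b - n - s))) *
      (saalFun n (p.h 2) (p.h 4) (p.h 6) t * (Real.pi / Complex.sin (Real.pi * t)) *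
      (Complex.Gamma (-t) * Complex.Gamma (b - n - t))) *
      (Complex.Gamma b * (Complex.Gamma (1 + n + s + t))⁻¹ *
        (Complex.Gamma (b - n - s - t))⁻¹)) * neg_one_zpow_mul_self (b - n)
  have hsign : (-1 : ℂ) ^ (1 + b + ∑ j : Fin 7, p.h j) =
      -(-1) ^ (b - n) * (-1) ^ (p.h 1 + p.h 3 + p.h 5 + p.h 2 + p.h 4 + p.h 6) := by
    have h7 : ∑ j : Fin 7, p.h j =
        n + p.h 1 + p.h 2 + p.h 3 + p.h 4 + p.h 5 + p.h 6 := Fin.sum_univ_seven _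
    rw [h7, show 1 + b + (n + p.h 1 + p.h 2 + p.h 3 + p.h 4 + p.h 5 + p.h 6) = 2 * n + 1 + (b - n) +
      (p.h 1 + p.h 3 + p.h 5 + p.h 2 + p.h 4 + p.h 6) by ring, zpow_add₀ (by norm_num),
      zpow_add₀ (by norm_num), zpow_add₀ (by norm_num), zpow_mul]
    norm_num
  have s1 := neg_one_zpow_mul_self (b - n)
  have s2 := neg_one_zpow_mul_self (p.h 1 + p.h 3 + p.h 5 + p.h 2 + p.h 4 + p.h 6)
  have f1 := fact_ne_zero (p.h 1 - 1)
  have f2 := fact_ne_zero (p.h 2 - 1)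
  have f3 := fact_ne_zero (n - p.h 1 - p.h 5)
  have f4 := fact_ne_zero (n - p.h 2 - p.h 6)
  have f5 := fact_ne_zero (p.h 5 + b - n - 1)
  have f6 := fact_ne_zero (p.h 6 + b - n - 1)
  rw [hsign, F, gammaFactor, ← hn, ← hb, div_mul_eq_mul_div, div_eq_iff
    (mul_ne_zero (mul_ne_zero (mul_ne_zero f1 f2) f5) f6)]
  refine mul_right_cancel₀ (mul_ne_zero f3 f4) ?_
  set u := (-1 : ℂ) ^ (b - n)
  set v := (-1 : ℂ) ^ (p.h 1 + p.h 3 + p.h 5 + p.h 2 + p.h 4 + p.h 6)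
  set E := fact (n - p.h 1 - p.h 3) * fact (n - p.h 1 - p.h 5) * fact (n - p.h 3 - p.h 5) *
      (fact (n - p.h 2 - p.h 4) * fact (n - p.h 2 - p.h 6) * fact (n - p.h 4 - p.h 6)) *
      F6' p with hE
  linear_combination u * v * hG - E * u * u * s2 - E * s1

/-- Under the balancing condition the exponent of the sign is odd. -/
theorem F_eq_neg_G {p : HParams} (hp : p.Admissible) (hb : p.Balanced) : F p = -G (toAB p) := by
  rw [F_eq_G hp]
  rw [HParams.Balanced, Finset.sum_erase_eq_sub (Finset.mem_univ _)] at hb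
  rw [show 1 + p.hm + ∑ j : Fin 7, p.h j = 2 * (1 + 2 * p.h 0) + 1 by rw [hb]; ring,
    zpow_add₀ (by norm_num), zpow_mul]
  norm_num

/-! ### Invariance of the normalised double integral -/

/-- The indices `1, 3, 5`. -/
def oddIdx : Finset (Fin 7) := {1, 3, 5}

/-- The indices `2, 4, 6`. -/
def evenIdx : Finset (Fin 7) := {2, 4, 6}

theorem ABParams.admissible_iff (q : ABParams) : q.Admissible ↔
    (∑ j ∈ oddIdx, q.a j - ∑ j ∈ oddIdx, q.b j ≤ q.b 0 - q.a 0 - 2 ∧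
      ∑ j ∈ evenIdx, q.a j - ∑ j ∈ evenIdx, q.b j ≤ q.b 0 - q.a 0 - 2) ∧
    (∀ j ∈ oddIdx, ∀ k ∈ oddIdx, q.b j ≤ q.a k) ∧ ∀ j ∈ evenIdx, ∀ k ∈ evenIdx, q.b j ≤ q.a k := by
  simp only [ABParams.Admissible, oddIdx, evenIdx, max_le_iff, le_min_iff, Finset.mem_insert,
    Finset.mem_singleton, forall_eq_or_imp, forall_eq]
  rw [Finset.sum_insert (by decide), Finset.sum_pair (by decide), Finset.sum_insert (by decide),
    Finset.sum_pair (by decide), Finset.sum_insert (by decide), Finset.sum_pair (by decide),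
    Finset.sum_insert (by decide), Finset.sum_pair (by decide)]
  constructor <;> intro h <;> omega

noncomputable section

/-- The factor of the double integral that depends on one of the two variables, written with
`Γ(z + a_j) / Γ(z + b_j)` instead of `(z + b_j)_{a_j - b_j}`, which makes its symmetry evident. -/
def gammaTriple (s : Finset (Fin 7)) (q : ABParams) (z : ℂ) : ℂ :=
  (∏ j ∈ s, Complex.Gamma (z + q.a j)) * (∏ j ∈ s, Complex.Gamma (z + q.b j))⁻¹ *
    (Real.pi / Complex.sin (Real.pi * z)) ^ 3

/-- The factor of the double integral that depends on the sum `w` of the two variables. -/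
def coupling (q : ABParams) (w : ℂ) : ℂ :=
  fact (q.b 0 - q.a 0 - 1) / poch (w + q.a 0) (q.b 0 - q.a 0) * (Complex.sin (Real.pi *
    w) / Real.pi)

/-- The double integral with the index sets of the two variables and the lines as arguments. -/
def doubleInt (s₁ s₂ : Finset (Fin 7)) (q : ABParams) (m₁ m₂ : ℤ) : ℂ :=
  vline (1 / 3 - m₂) fun t => gammaTriple s₂ q t *
    vline (1 / 3 - m₁) fun s => gammaTriple s₁ q s * coupling q (s + t)

end

theorem ne_int_of_re {m : ℤ} {s : ℂ} (hs : s.re = 1 / 3 - (m : ℝ)) (k : ℤ) : s ≠ k := by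
  rintro rfl
  rw [Complex.intCast_re] at hs
  have : (3 : ℝ) * (k + m : ℤ) = 1 := by push_cast; linarith
  have : (3 : ℤ) * (k + m) = 1 := by exact_mod_cast this
  omega

theorem gammaTriple_odd {q : ABParams} (hq : q.Admissible) {z : ℂ} (hz : ∀ k : ℤ, z ≠ k) :
    gammaTriple oddIdx q z = poch (z + q.b 1) (q.a 1 - q.b 1) * poch (z + q.b 3) (q.a 3 - q.b 3) *
      poch (z + q.b 5) (q.a 5 - q.b 5) * (Real.pi / Complex.sin (Real.pi * z)) ^ 3 := by
  have e1 : ∀ m : ℤ, ∀ k : ℤ, z + m ≠ k := fun m k h =>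
    hz (k - m) (by push_cast; linear_combination h)
  have h := ((ABParams.admissible_iff q).1 hq).2.1
  rw [poch_eq_Gamma (e1 _) (sub_nonneg.2 (h 1 (by decide) 1 (by decide))),
    poch_eq_Gamma (e1 _) (sub_nonneg.2 (h 3 (by decide) 3 (by decide))),
    poch_eq_Gamma (e1 _) (sub_nonneg.2 (h 5 (by decide) 5 (by decide))), gammaTriple, oddIdx,
    Finset.prod_insert (by decide), Finset.prod_pair (by decide), Finset.prod_insert (by decide),
    Finset.prod_pair (by decide)]
  push_cast
  simp only [add_assoc, add_sub_cancel, mul_inv]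
  ring

theorem gammaTriple_even {q : ABParams} (hq : q.Admissible) {z : ℂ} (hz : ∀ k : ℤ, z ≠ k) :
    gammaTriple evenIdx q z = poch (z + q.b 2) (q.a 2 - q.b 2) * poch (z + q.b 4) (q.a 4 - q.b 4) *
      poch (z + q.b 6) (q.a 6 - q.b 6) * (Real.pi / Complex.sin (Real.pi * z)) ^ 3 := by
  have e1 : ∀ m : ℤ, ∀ k : ℤ, z + m ≠ k := fun m k h =>
    hz (k - m) (by push_cast; linear_combination h)
  have h := ((ABParams.admissible_iff q).1 hq).2.2
  rw [poch_eq_Gamma (e1 _) (sub_nonneg.2 (h 2 (by decide) 2 (by decide))),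
    poch_eq_Gamma (e1 _) (sub_nonneg.2 (h 4 (by decide) 4 (by decide))),
    poch_eq_Gamma (e1 _) (sub_nonneg.2 (h 6 (by decide) 6 (by decide))), gammaTriple, evenIdx,
    Finset.prod_insert (by decide), Finset.prod_pair (by decide), Finset.prod_insert (by decide),
    Finset.prod_pair (by decide)]
  push_cast
  simp only [add_assoc, add_sub_cancel, mul_inv]
  ring

theorem isLeast_min_three {f : Fin 7 → ℤ} (i j k : Fin 7) :
    IsLeast (f '' (({i, j, k} : Finset (Fin 7)) : Set (Fin 7))) (min (f i) (min (f j) (f k))) := by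
  constructor
  · rcases min_choice (f i) (min (f j) (f k)) with h | h
    · exact ⟨i, by simp, h.symm⟩
    · rcases min_choice (f j) (f k) with h' | h'
      · exact ⟨j, by simp, by rw [h, h']⟩
      · exact ⟨k, by simp, by rw [h, h']⟩
  · rintro _ ⟨l, hl, rfl⟩
    simp only [Finset.coe_insert, Finset.coe_singleton, mem_insert_iff, mem_singleton_iff] at hl
    rcases hl with rfl | rfl | rfl <;> simp

theorem normG_eq_doubleInt {q : ABParams} (hq : q.Admissible) {m₁ m₂ : ℤ}
    (h₁ : IsLeast (q.a '' oddIdx) m₁) (h₂ : IsLeast (q.a '' evenIdx) m₂) :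
    normG q = doubleInt oddIdx evenIdx q m₁ m₂ := by
  rw [h₁.unique (isLeast_min_three 1 3 5), h₂.unique (isLeast_min_three 2 4 6)]
  have hp : ∏ j : Fin 6, fact (q.a j.succ - q.b j.succ) =
      fact (q.a 1 - q.b 1) * fact (q.a 2 - q.b 2) * fact (q.a 3 - q.b 3) * fact (q.a 4 - q.b 4) *
        fact (q.a 5 - q.b 5) * fact (q.a 6 - q.b 6) := Fin.prod_univ_six _
  have hp' : ∏ j : Fin 6, fact (q.a j.succ - q.b j.succ) =
      fact (q.a 1 - q.b 1) * fact (q.a 3 - q.b 3) * fact (q.a 5 - q.b 5) *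
        (fact (q.a 2 - q.b 2) * fact (q.a 4 - q.b 4) * fact (q.a 6 - q.b 6)) := by rw [hp]; ring
  rw [normG, hp', G, doubleInt, ← vline_const_mul]
  refine vline_congr fun t ht => ?_
  rw [← mul_assoc, ← vline_const_mul, ← mul_assoc, ← vline_const_mul]
  refine vline_congr fun s hs => ?_
  rw [gammaTriple_odd hq (ne_int_of_re hs), gammaTriple_even hq (ne_int_of_re ht), coupling,
    mul_assoc _ (fact _ / _)]
  simp only [pochFactor]
  rw [cancel_six (fact_ne_zero _) (fact_ne_zero _) (fact_ne_zero _) (fact_ne_zero _)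
    (fact_ne_zero _) (fact_ne_zero _), add_comm t s]
  ring

theorem norm_sin_pi_le (w : ℂ) :
    ‖Complex.sin (Real.pi * w)‖ ≤ Real.exp (Real.pi * |w.im|) := by
  have h1 : ∀ v : ℂ, |v.re| ≤ Real.pi * |w.im| → ‖Complex.exp v‖ ≤ Real.exp (Real.pi * |w.im|) :=
    fun v hv => by rw [Complex.norm_exp]; exact Real.exp_le_exp.2 ((le_abs_self _).trans hv)
  have h2 : |(Real.pi * w * Complex.I).re| ≤ Real.pi * |w.im| := by
    simp [abs_mul, abs_of_pos Real.pi_pos]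
  have h3 : |(-(Real.pi * w) * Complex.I).re| ≤ Real.pi * |w.im| := by
    simp [abs_mul, abs_of_pos Real.pi_pos]
  have := norm_sub_le (Complex.exp (-(Real.pi * w) * Complex.I)) (Complex.exp (Real.pi * w *
    Complex.I))
  rw [Complex.sin, norm_div, norm_mul, Complex.norm_I, mul_one, Complex.norm_ofNat,
    div_le_iff₀ two_pos]
  linarith [h1 _ h2, h1 _ h3]

/-- A lower bound for a Pochhammer symbol at a point whose real part keeps the distance `1/3` from
the integers. -/
theorem le_norm_poch {z : ℂ} (hz : ∀ k : ℤ, (1 : ℝ) / 3 ≤ |z.re + k|) (m : ℤ) :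
    (1 / 3 : ℝ) ^ m.toNat ≤ ‖poch z m‖ := by
  rw [poch]
  induction m.toNat with
  | zero => simp
  | succ k ih =>
    rw [ascPochhammer_succ_eval, norm_mul, pow_succ]
    refine mul_le_mul ih ?_ (by positivity) (norm_nonneg _)
    refine (hz k).trans ?_
    have := Complex.abs_re_le_norm (z + k)
    simpa using this

theorem third_le_abs {m₁ m₂ : ℤ} {w : ℂ} (hw : w.re = 2 / 3 - (m₁ : ℝ) - m₂) (k : ℤ) :
    (1 : ℝ) / 3 ≤ |w.re + k| := by
  rw [hw, show (2 / 3 - (m₁ : ℝ) - m₂ + k) = 2 / 3 + ((k - m₁ - m₂ : ℤ) : ℝ) by push_cast; ring]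
  rcases le_or_gt 0 (k - m₁ - m₂) with h | h
  · have : (0 : ℝ) ≤ ((k - m₁ - m₂ : ℤ) : ℝ) := by exact_mod_cast h
    rw [abs_of_pos (by linarith)]
    linarith
  · have : ((k - m₁ - m₂ : ℤ) : ℝ) ≤ -1 := by exact_mod_cast (by omega : k - m₁ - m₂ ≤ -1)
    rw [abs_of_neg (by linarith)]
    linarith

theorem gammaTriple_growth {s : Finset (Fin 7)} {q : ABParams} {c : ℝ}
    (h : ∀ j ∈ s, 0 < c + q.a j) : StripGrowth (gammaTriple s q) c c (-(3 * Real.pi)) := by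
  have h1 : StripGrowth (fun z => ∏ j ∈ s, (Complex.Gamma (z + q.a j) *
      (Complex.Gamma (z + q.b j))⁻¹)) c c 0 := by
    classical
    induction s using Finset.induction_on with
    | empty => simpa using stripGrowth_const 1 c c
    | insert a s ha ih =>
      simp_rw [Finset.prod_insert ha]
      refine ((StripPoly.growth (stripPoly_Gamma_mul_inv _ _ ?_)).mul
        (ih fun j hj => h j (Finset.mem_insert_of_mem hj))).rate (by ring)
      simpa using h a (Finset.mem_insert_self a s)
  have h2 := stripGrowth_pi_div_sin c c
  refine ((h1.mul ((h2.mul h2).mul h2)).rate (by ring)).congr fun z _ _ _ => ?_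
  rw [gammaTriple, Finset.prod_mul_distrib, Finset.prod_inv_distrib]
  ring

theorem gammaTriple_continuousAt {s : Finset (Fin 7)} {q : ABParams} {z : ℂ}
    (h : ∀ j ∈ s, 0 < z.re + q.a j) (hz : ∀ k : ℤ, z ≠ k) : ContinuousAt (gammaTriple s q) z := by
  have h1 : DifferentiableAt ℂ (fun z => ∏ j ∈ s, Complex.Gamma (z + q.a j)) z := by
    refine DifferentiableAt.fun_finsetProd fun j hj => ?_
    simp_rw [add_comm _ ((q.a j : ℤ) : ℂ)]
    exact differentiableAt_Gamma_add (by have := h j hj; simp; linarith)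
  have h2 : DifferentiableAt ℂ (fun z => (∏ j ∈ s, Complex.Gamma (z + q.b j))⁻¹) z := by
    simp_rw [← Finset.prod_inv_distrib]
    refine DifferentiableAt.fun_finsetProd fun j hj => ?_
    simp_rw [add_comm _ ((q.b j : ℤ) : ℂ)]
    exact differentiable_Gamma_inv_add _ z
  have h3 : DifferentiableAt ℂ (fun z : ℂ => Real.pi / Complex.sin (Real.pi * z)) z :=
    (differentiableAt_const _).div (by fun_prop) (sin_pi_mul_ne_zero hz)
  exact (h1.continuousAt.mul h2.continuousAt).mul (h3.continuousAt.pow 3)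

theorem norm_coupling_le (q : ABParams) {m₁ m₂ : ℤ} {s t : ℂ} (hs : s.re = 1 / 3 - (m₁ : ℝ))
    (ht : t.re = 1 / 3 - (m₂ : ℝ)) : ‖coupling q (s + t)‖ ≤
      ‖fact (q.b 0 - q.a 0 - 1)‖ * 3 ^ (q.b 0 - q.a 0).toNat / Real.pi *
        (Real.exp (Real.pi * |s.im|) * Real.exp (Real.pi * |t.im|)) := by
  have h1 := norm_sin_pi_le (s + t)
  have h2 : Real.exp (Real.pi * |(s + t).im|) ≤
      Real.exp (Real.pi * |s.im|) * Real.exp (Real.pi * |t.im|) := by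
    rw [← Real.exp_add, ← mul_add, Complex.add_im]
    exact Real.exp_le_exp.2 (mul_le_mul_of_nonneg_left (abs_add_le _ _) Real.pi_pos.le)
  have hre : (s + t).re = 2 / 3 - (m₁ : ℝ) - m₂ := by rw [Complex.add_re, hs, ht]; ring
  have h3 := le_norm_poch (z := s + t + q.a 0) (fun k => by
    have := third_le_abs hre (q.a 0 + k)
    rw [Complex.add_re, Complex.intCast_re, add_assoc]
    push_cast at this
    exact this) (q.b 0 - q.a 0)
  rw [one_div, inv_pow] at h3
  have h4 : (0 : ℝ) < (3 ^ (q.b 0 - q.a 0).toNat)⁻¹ := by positivity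
  rw [coupling, norm_mul, norm_div, norm_div, Complex.norm_real, Real.norm_of_nonneg Real.pi_pos.le]
  calc _ ≤ ‖fact (q.b 0 - q.a 0 - 1)‖ / (3 ^ (q.b 0 - q.a 0).toNat)⁻¹ *
        (Real.exp (Real.pi * |s.im|) * Real.exp (Real.pi * |t.im|) / Real.pi) := by
        gcongr
        exact h1.trans h2
    _ = _ := by
        rw [div_inv_eq_mul]
        ring

theorem coupling_continuousAt (q : ABParams) {m₁ m₂ : ℤ} {w : ℂ}
    (hw : w.re = 2 / 3 - (m₁ : ℝ) - m₂) : ContinuousAt (coupling q) w := by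
  have h3 := le_norm_poch (z := w + q.a 0) (fun k => by
    have := third_le_abs hw (q.a 0 + k)
    rw [Complex.add_re, Complex.intCast_re, add_assoc]
    push_cast at this
    exact this) (q.b 0 - q.a 0)
  have h4 : poch (w + q.a 0) (q.b 0 - q.a 0) ≠ 0 := by
    intro h0
    rw [h0, norm_zero] at h3
    have : (0 : ℝ) < (1 / 3) ^ (q.b 0 - q.a 0).toNat := by positivity
    linarith
  have h5 : Continuous fun w : ℂ => poch (w + q.a 0) (q.b 0 - q.a 0) :=
    (Polynomial.continuous _).comp (by fun_prop)
  exact (continuousAt_const.div h5.continuousAt h4).mul (by fun_prop)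

/-- The order of integration may be reversed. -/
theorem doubleInt_comm (s₁ s₂ : Finset (Fin 7)) (q : ABParams) {m₁ m₂ : ℤ}
    (h₁ : ∀ j ∈ s₁, m₁ ≤ q.a j) (h₂ : ∀ j ∈ s₂, m₂ ≤ q.a j) :
    doubleInt s₁ s₂ q m₁ m₂ = doubleInt s₂ s₁ q m₂ m₁ := by
  have hpos : ∀ {s : Finset (Fin 7)} {m : ℤ}, (∀ j ∈ s, m ≤ q.a j) →
      ∀ j ∈ s, 0 < (1 / 3 - (m : ℝ)) + q.a j := by
    intro s m h j hj
    have : (m : ℝ) ≤ q.a j := by exact_mod_cast h j hj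
    linarith
  have hcont : ∀ {s : Finset (Fin 7)} {m : ℤ}, (∀ j ∈ s, m ≤ q.a j) → ∀ z : ℂ,
      z.re = 1 / 3 - m → ContinuousAt (gammaTriple s q) z := fun h z hz =>
    gammaTriple_continuousAt (by rw [hz]; exact hpos h) (ne_int_of_re hz)
  have hint : ∀ {s : Finset (Fin 7)} {m : ℤ}, (∀ j ∈ s, m ≤ q.a j) →
      LineIntegrable (fun z => gammaTriple s q z * ((Real.exp (Real.pi * |z.im|) : ℝ) : ℂ))
        (1 / 3 - m) := by
    intro s m h
    have h1 : StripGrowth (fun z : ℂ => ((Real.exp (Real.pi * |z.im|) : ℝ) : ℂ)) (1 / 3 - m)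
        (1 / 3 - m) Real.pi := by
      refine ⟨1, 0, fun z _ _ _ => ?_⟩
      rw [Complex.norm_real, Real.norm_of_nonneg (Real.exp_pos _).le]
      simp
    refine ((gammaTriple_growth (hpos h)).mul h1).lineIntegrable (by linarith [Real.pi_pos]) le_rfl
      le_rfl fun z hz => (hcont h z hz).mul ?_
    refine Continuous.continuousAt (Complex.continuous_ofReal.comp ?_)
    have := Complex.continuous_im
    fun_prop
  set K := ‖fact (q.b 0 - q.a 0 - 1)‖ * 3 ^ (q.b 0 - q.a 0).toNat / Real.pi with hK
  have hI := integrable_prod_of_bound (c := 1 / 3 - m₂) (d := 1 / 3 - m₁)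
    (f := fun t s => gammaTriple s₂ q t * (gammaTriple s₁ q s * coupling q (s + t)))
    (fun t s ht hs => ?_) (hint h₂).norm ((hint h₁).norm.const_mul K) (fun t s ht hs => ?_)
  · simp only [doubleInt]
    simp_rw [← vline_const_mul]
    rw [vline_vline_comm hI]
    refine vline_congr fun s _ => vline_congr fun t _ => ?_
    rw [add_comm t s]
    ring
  · refine ContinuousAt.mul ?_ (ContinuousAt.mul ?_ ?_)
    · exact ContinuousAt.comp (f := fun q : ℂ × ℂ => q.1) (x := (t, s)) (hcont h₂ t ht)
        continuousAt_fst
    · exact ContinuousAt.comp (f := fun q : ℂ × ℂ => q.2) (x := (t, s)) (hcont h₁ s hs)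
        continuousAt_snd
    · refine ContinuousAt.comp (f := fun q : ℂ × ℂ => q.2 + q.1) (x := (t, s))
        (coupling_continuousAt q (m₁ := m₁) (m₂ := m₂) ?_) (by fun_prop)
      simp only [Complex.add_re, hs, ht]
      ring
  · have e1 : (((1 / 3 - m₂ : ℝ) : ℂ) + (t.im : ℂ) * Complex.I) = t := by
      rw [← ht]; exact Complex.re_add_im t
    have e2 : (((1 / 3 - m₁ : ℝ) : ℂ) + (s.im : ℂ) * Complex.I) = s := by
      rw [← hs]; exact Complex.re_add_im s
    simp only [e1, e2, norm_mul, Complex.norm_real, Real.norm_of_nonneg (Real.exp_pos _).le]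
    have := norm_coupling_le q hs ht
    rw [← hK] at this
    calc _ ≤ ‖gammaTriple s₂ q t‖ * (‖gammaTriple s₁ q s‖ * (K *
          (Real.exp (Real.pi * |s.im|) * Real.exp (Real.pi * |t.im|)))) := by gcongr
      _ = _ := by ring

/-- The transformation preserves the standing conditions and the normalised double integral. -/
def PreservesNormG (τ : Perm ABParams) : Prop :=
  ∀ q, ((τ q).Admissible ↔ q.Admissible) ∧ (q.Admissible → normG (τ q) = normG q)

theorem gammaTriple_congr {s s' : Finset (Fin 7)} {q q' : ABParams} (σ τ : Perm (Fin 7))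
    (hσ : ∀ j, j ∈ s ↔ σ j ∈ s') (hτ : ∀ j, j ∈ s ↔ τ j ∈ s') (ha : ∀ j ∈ s, q.a j = q'.a (σ j))
    (hb : ∀ j ∈ s, q.b j = q'.b (τ j)) (z : ℂ) : gammaTriple s q z = gammaTriple s' q' z := by
  simp only [gammaTriple]
  congr 2
  · exact Finset.prod_equiv σ hσ fun j hj => by rw [ha j hj]
  · congr 1
    exact Finset.prod_equiv τ hτ fun j hj => by rw [hb j hj]

theorem coupling_congr {q q' : ABParams} (ha : q.a 0 = q'.a 0) (hb : q.b 0 = q'.b 0) (w : ℂ) :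
    coupling q w = coupling q' w := by
  simp only [coupling, ha, hb]

/-- A permutation of the indices that permutes `1, 3, 5` and `2, 4, 6` preserves both sets. -/
theorem KeepsParity.mem_iff {σ : Perm (Fin 7)} (h : KeepsParity σ) (j : Fin 7) :
    (j ∈ oddIdx ↔ σ j ∈ oddIdx) ∧ (j ∈ evenIdx ↔ σ j ∈ evenIdx) := by
  obtain ⟨h0, h1, h2⟩ := h
  have hd : ∀ k : Fin 7, k = 0 ∨ k ∈ oddIdx ∨ k ∈ evenIdx := by decide
  have hoe : ∀ k : Fin 7, k ∈ oddIdx → k ∉ evenIdx := by decide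
  have h0o : (0 : Fin 7) ∉ oddIdx := by decide
  have h0e : (0 : Fin 7) ∉ evenIdx := by decide
  refine ⟨⟨h1 j, fun h => ?_⟩, ⟨h2 j, fun h => ?_⟩⟩
  · rcases hd j with rfl | hj | hj
    · exact absurd (h0 ▸ h) h0o
    · exact hj
    · exact absurd (h2 j hj) (hoe _ h)
  · rcases hd j with rfl | hj | hj
    · exact absurd (h0 ▸ h) h0e
    · exact absurd h (hoe _ (h1 j hj))
    · exact hj

theorem KeepsParity.symm {σ : Perm (Fin 7)} (h : KeepsParity σ) : KeepsParity σ.symm := by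
  refine ⟨by rw [Equiv.symm_apply_eq]; exact h.1.symm, fun j hj => ?_, fun j hj => ?_⟩
  · exact (h.mem_iff _).1.2 (by rw [Equiv.apply_symm_apply]; exact hj)
  · exact (h.mem_iff _).2.2 (by rw [Equiv.apply_symm_apply]; exact hj)

theorem image_comp_perm {s s' : Finset (Fin 7)} (σ : Perm (Fin 7)) (hσ : ∀ j, j ∈ s ↔ σ j ∈ s')
    (f : Fin 7 → ℤ) : (f ∘ σ) '' s = f '' s' := by
  rw [image_comp]
  congr 1
  ext j
  simp only [mem_image, SetLike.mem_coe]
  constructor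
  · rintro ⟨k, hk, rfl⟩
    exact (hσ k).1 hk
  · intro hj
    exact ⟨σ.symm j, (hσ _).2 (by rwa [Equiv.apply_symm_apply]), Equiv.apply_symm_apply _ _⟩

theorem exists_isLeast_odd (q : ABParams) : ∃ m, IsLeast (q.a '' oddIdx) m :=
  ⟨_, isLeast_min_three 1 3 5⟩

theorem exists_isLeast_even (q : ABParams) : ∃ m, IsLeast (q.a '' evenIdx) m :=
  ⟨_, isLeast_min_three 2 4 6⟩

theorem preservesNormG_perm {σ τ : Perm (Fin 7)} (hσ : KeepsParity σ) (hτ : KeepsParity τ) :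
    PreservesNormG (aPerm σ * bPerm τ) := by
  intro q
  have hσ' := hσ.symm
  have hτ' := hτ.symm
  have ha : ((aPerm σ * bPerm τ) q).a = q.a ∘ σ.symm := rfl
  have hb : ((aPerm σ * bPerm τ) q).b = q.b ∘ τ.symm := rfl
  have h1 : ((aPerm σ * bPerm τ) q).Admissible ↔ q.Admissible := by
    have hsum : ∀ {s : Finset (Fin 7)} {ρ : Perm (Fin 7)} (f : Fin 7 → ℤ),
        (∀ j, j ∈ s ↔ ρ j ∈ s) → ∑ j ∈ s, f (ρ j) = ∑ j ∈ s, f j := fun f h =>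
      Finset.sum_equiv _ h fun _ _ => rfl
    have hall : ∀ {s : Finset (Fin 7)}, (∀ j, j ∈ s ↔ σ.symm j ∈ s) → (∀ j, j ∈ s ↔ τ.symm j ∈ s) →
        ((∀ j ∈ s, ∀ k ∈ s, q.b (τ.symm j) ≤ q.a (σ.symm k)) ↔
          ∀ j ∈ s, ∀ k ∈ s, q.b j ≤ q.a k) := by
      intro s e1 e2
      constructor
      · intro h j hj k hk
        have := h (τ j) ((e2 _).2 (by simpa)) (σ k) ((e1 _).2 (by simpa))
        simpa using this
      · intro h j hj k hk
        exact h _ ((e2 j).1 hj) _ ((e1 k).1 hk)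
    rw [ABParams.admissible_iff, ABParams.admissible_iff, ha, hb]
    simp only [Function.comp_apply]
    rw [hsum q.a fun j => (hσ'.mem_iff j).1, hsum q.a fun j => (hσ'.mem_iff j).2,
      hsum q.b fun j => (hτ'.mem_iff j).1, hsum q.b fun j => (hτ'.mem_iff j).2, hσ'.1, hτ'.1,
      hall (fun j => (hσ'.mem_iff j).1) (fun j => (hτ'.mem_iff j).1),
      hall (fun j => (hσ'.mem_iff j).2) (fun j => (hτ'.mem_iff j).2)]
  refine ⟨h1, fun hq => ?_⟩
  obtain ⟨m₁, hm₁⟩ := exists_isLeast_odd q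
  obtain ⟨m₂, hm₂⟩ := exists_isLeast_even q
  rw [normG_eq_doubleInt hq hm₁ hm₂, normG_eq_doubleInt (h1.2 hq) (m₁ := m₁) (m₂ := m₂)
    (by rw [ha, image_comp_perm _ fun j => (hσ'.mem_iff j).1]; exact hm₁)
    (by rw [ha, image_comp_perm _ fun j => (hσ'.mem_iff j).2]; exact hm₂)]
  refine vline_congr fun t _ => ?_
  rw [gammaTriple_congr σ.symm τ.symm (fun j => (hσ'.mem_iff j).2) (fun j => (hτ'.mem_iff j).2)
    (fun j _ => congrFun ha j) (fun j _ => congrFun hb j)]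
  congr 1
  refine vline_congr fun s _ => ?_
  rw [gammaTriple_congr σ.symm τ.symm (fun j => (hσ'.mem_iff j).1) (fun j => (hτ'.mem_iff j).1)
    (fun j _ => congrFun ha j) (fun j _ => congrFun hb j),
    coupling_congr (q := (aPerm σ * bPerm τ) q) (q' := q) (by rw [ha, Function.comp_apply,
      hσ'.1]) (by rw [hb, Function.comp_apply, hτ'.1])]

theorem preservesNormG_flip : PreservesNormG (aPerm flipIdx * bPerm flipIdx) := by
  intro q
  have hs : flipIdx.symm = flipIdx := by decide
  have ha : ((aPerm flipIdx * bPerm flipIdx) q).a = q.a ∘ flipIdx := by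
    change q.a ∘ flipIdx.symm = _
    rw [hs]
  have hb : ((aPerm flipIdx * bPerm flipIdx) q).b = q.b ∘ flipIdx := by
    change q.b ∘ flipIdx.symm = _
    rw [hs]
  have f1 : ∀ j, j ∈ oddIdx ↔ flipIdx j ∈ evenIdx := by decide
  have f2 : ∀ j, j ∈ evenIdx ↔ flipIdx j ∈ oddIdx := by decide
  have f0 : flipIdx 0 = 0 := by decide
  have h1 : ((aPerm flipIdx * bPerm flipIdx) q).Admissible ↔ q.Admissible := by
    have hsum : ∀ {s s' : Finset (Fin 7)} (f : Fin 7 → ℤ), (∀ j, j ∈ s ↔ flipIdx j ∈ s') →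
        ∑ j ∈ s, f (flipIdx j) = ∑ j ∈ s', f j := fun f h => Finset.sum_equiv _ h fun _ _ => rfl
    have hall : ∀ {s s' : Finset (Fin 7)}, (∀ j, j ∈ s ↔ flipIdx j ∈ s') →
        ((∀ j ∈ s, ∀ k ∈ s, q.b (flipIdx j) ≤ q.a (flipIdx k)) ↔
          ∀ j ∈ s', ∀ k ∈ s', q.b j ≤ q.a k) := by
      intro s s' e1
      constructor
      · intro h j hj k hk
        have := h (flipIdx.symm j) ((e1 _).2 (by simpa)) (flipIdx.symm k) ((e1 _).2 (by simpa))
        simpa using this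
      · intro h j hj k hk
        exact h _ ((e1 j).1 hj) _ ((e1 k).1 hk)
    rw [ABParams.admissible_iff, ABParams.admissible_iff, ha, hb]
    simp only [Function.comp_apply]
    rw [hsum q.a f1, hsum q.a f2, hsum q.b f1, hsum q.b f2, f0, hall f1, hall f2]
    tauto
  refine ⟨h1, fun hq => ?_⟩
  obtain ⟨m₁, hm₁⟩ := exists_isLeast_odd q
  obtain ⟨m₂, hm₂⟩ := exists_isLeast_even q
  rw [normG_eq_doubleInt hq hm₁ hm₂, normG_eq_doubleInt (h1.2 hq) (m₁ := m₂) (m₂ := m₁)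
    (by rw [ha, image_comp_perm _ f1]; exact hm₂) (by rw [ha, image_comp_perm _ f2]; exact hm₁),
    doubleInt_comm oddIdx evenIdx q (fun j hj => hm₁.2 ⟨j, hj, rfl⟩)
      (fun j hj => hm₂.2 ⟨j, hj, rfl⟩)]
  refine vline_congr fun t _ => ?_
  rw [gammaTriple_congr flipIdx flipIdx f2 f2 (fun j _ => congrFun ha j)
    (fun j _ => congrFun hb j)]
  congr 1
  refine vline_congr fun s _ => ?_
  rw [gammaTriple_congr flipIdx flipIdx f1 f1 (fun j _ => congrFun ha j)
    (fun j _ => congrFun hb j), coupling_congr (q := (aPerm flipIdx * bPerm flipIdx) q) (q' := q)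
    (by rw [ha, Function.comp_apply, f0])
    (by rw [hb, Function.comp_apply, f0])]

theorem pi_div_sin_add_int (z : ℂ) (m : ℤ) :
    Real.pi / Complex.sin (Real.pi * (z + m)) =
      (-1) ^ m * (Real.pi / Complex.sin (Real.pi * z)) := by
  rw [add_comm z, sin_pi_mul_int_add, div_mul_eq_div_div_swap, div_eq_mul_inv _ ((-1 : ℂ) ^ m),
    neg_one_zpow_inv, mul_comm]

theorem gammaTriple_shift {s : Finset (Fin 7)} {q q' : ABParams} {m : ℤ}
    (ha : ∀ j ∈ s, q'.a j = q.a j + m) (hb : ∀ j ∈ s, q'.b j = q.b j + m) (z : ℂ) :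
    gammaTriple s q' z = (-1) ^ m * gammaTriple s q (z + m) := by
  have e1 : ∏ j ∈ s, Complex.Gamma (z + q'.a j) = ∏ j ∈ s, Complex.Gamma (z + m + q.a j) :=
    Finset.prod_congr rfl fun j hj => by rw [ha j hj]; congr 1; push_cast; ring
  have e2 : ∏ j ∈ s, Complex.Gamma (z + q'.b j) = ∏ j ∈ s, Complex.Gamma (z + m + q.b j) :=
    Finset.prod_congr rfl fun j hj => by rw [hb j hj]; congr 1; push_cast; ring
  rw [gammaTriple, gammaTriple, e1, e2, pi_div_sin_add_int, mul_pow]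
  have h := neg_one_zpow_mul_self m
  linear_combination -((∏ j ∈ s, Complex.Gamma (z + m + q.a j)) *
    (∏ j ∈ s, Complex.Gamma (z + m + q.b j))⁻¹ * (Real.pi / Complex.sin (Real.pi * z)) ^ 3) *
    (((-1 : ℂ) ^ m * (-1) ^ m) + 1) * h

theorem coupling_shift {q q' : ABParams} {m : ℤ} (ha : q'.a 0 = q.a 0 + m)
    (hb : q'.b 0 = q.b 0 + m) (w : ℂ) : coupling q' w = (-1) ^ m * coupling q (w + m) := by
  have h := neg_one_zpow_mul_self m
  rw [coupling, coupling, ha, hb, show q.b 0 + m - (q.a 0 + m) = q.b 0 - q.a 0 by ring,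
    add_comm w m, sin_pi_mul_int_add]
  push_cast
  rw [show w + ((q.a 0 : ℂ) + m) = m + w + q.a 0 by ring]
  linear_combination -(fact (q.b 0 - q.a 0 - 1) / poch (m + w + q.a 0) (q.b 0 - q.a 0) *
    (Complex.sin (Real.pi * w) / Real.pi)) * h

theorem isLeast_image_shift {s : Finset (Fin 7)} {f g : Fin 7 → ℤ} {m n : ℤ}
    (h : ∀ j ∈ s, g j = f j + m) (hf : IsLeast (f '' s) n) : IsLeast (g '' s) (n + m) := by
  obtain ⟨⟨j, hj, hjn⟩, hl⟩ := hf
  refine ⟨⟨j, hj, by rw [h j hj, hjn]⟩, ?_⟩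
  rintro _ ⟨k, hk, rfl⟩
  rw [h k hk]
  have := hl ⟨k, hk, rfl⟩
  linarith

theorem isLeast_image_congr {s : Finset (Fin 7)} {f g : Fin 7 → ℤ} {n : ℤ}
    (h : ∀ j ∈ s, g j = f j) (hf : IsLeast (f '' s) n) : IsLeast (g '' s) n := by
  simpa using isLeast_image_shift (m := 0) (by simpa using h) hf

theorem preservesNormG_shift_odd (m : ℤ) : PreservesNormG (abShift {0, 1, 3, 5} m) := by
  intro q
  set q' := abShift {0, 1, 3, 5} m q with hq'
  have o : ∀ j ∈ oddIdx, j ∈ ({0, 1, 3, 5} : Finset (Fin 7)) := by decide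
  have e : ∀ j ∈ evenIdx, j ∉ ({0, 1, 3, 5} : Finset (Fin 7)) := by decide
  have sa : ∀ j ∈ ({0, 1, 3, 5} : Finset (Fin 7)), q'.a j = q.a j + m := fun j hj => if_pos hj
  have sb : ∀ j ∈ ({0, 1, 3, 5} : Finset (Fin 7)), q'.b j = q.b j + m := fun j hj => if_pos hj
  have oa : ∀ j ∈ oddIdx, q'.a j = q.a j + m := fun j hj => sa j (o j hj)
  have ob : ∀ j ∈ oddIdx, q'.b j = q.b j + m := fun j hj => sb j (o j hj)
  have ea : ∀ j ∈ evenIdx, q'.a j = q.a j := fun j hj => if_neg (e j hj)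
  have eb : ∀ j ∈ evenIdx, q'.b j = q.b j := fun j hj => if_neg (e j hj)
  have a0 : q'.a 0 = q.a 0 + m := sa 0 (by decide)
  have b0 : q'.b 0 = q.b 0 + m := sb 0 (by decide)
  have h1 : q'.Admissible ↔ q.Admissible := by
    rw [ABParams.admissible_iff, ABParams.admissible_iff, Finset.sum_congr rfl oa,
      Finset.sum_congr rfl ob, Finset.sum_congr rfl ea, Finset.sum_congr rfl eb,
      Finset.sum_add_distrib, Finset.sum_add_distrib, a0, b0]
    have h1 : (∀ j ∈ oddIdx, ∀ k ∈ oddIdx, q'.b j ≤ q'.a k) ↔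
        ∀ j ∈ oddIdx, ∀ k ∈ oddIdx, q.b j ≤ q.a k :=
      forall₂_congr fun j hj => forall₂_congr fun k hk => by rw [oa k hk, ob j hj]; omega
    have h2 : (∀ j ∈ evenIdx, ∀ k ∈ evenIdx, q'.b j ≤ q'.a k) ↔
        ∀ j ∈ evenIdx, ∀ k ∈ evenIdx, q.b j ≤ q.a k :=
      forall₂_congr fun j hj => forall₂_congr fun k hk => by rw [ea k hk, eb j hj]
    rw [h1, h2, show ∀ x y z u v : ℤ, (x + z - (y + z) ≤ u + m - (v + m) - 2 ↔ x - y ≤ u - v - 2)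
      by omega, show ∀ x y u v : ℤ, (x - y ≤ u + m - (v + m) - 2 ↔ x - y ≤ u - v - 2) by omega]
  refine ⟨h1, fun hq => ?_⟩
  obtain ⟨m₁, hm₁⟩ := exists_isLeast_odd q
  obtain ⟨m₂, hm₂⟩ := exists_isLeast_even q
  rw [normG_eq_doubleInt hq hm₁ hm₂, normG_eq_doubleInt (h1.2 hq) (isLeast_image_shift oa hm₁)
    (isLeast_image_congr ea hm₂)]
  refine vline_congr fun t _ => ?_
  rw [gammaTriple_congr (q' := q) 1 1 (fun _ => Iff.rfl) (fun _ => Iff.rfl) ea eb]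
  congr 1
  have hl : (1 / 3 - (m₁ : ℝ)) = 1 / 3 - ((m₁ + m : ℤ) : ℝ) + (m : ℝ) := by push_cast; ring
  rw [hl, ← vline_comp_add]
  refine vline_congr fun s _ => ?_
  rw [gammaTriple_shift oa ob, coupling_shift a0 b0, Complex.ofReal_intCast,
    show s + t + m = s + m + t by ring]
  linear_combination (gammaTriple oddIdx q (s + m) * coupling q (s + m + t)) *
    neg_one_zpow_mul_self m

theorem preservesNormG_inv {τ : Perm ABParams} (h : PreservesNormG τ) : PreservesNormG τ⁻¹ := by
  intro q
  obtain ⟨h1, h2⟩ := h (τ⁻¹ q)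
  have e : τ (τ⁻¹ q) = q := τ.apply_symm_apply q
  rw [e] at h1 h2
  exact ⟨h1.symm, fun hq => (h2 (h1.1 hq)).symm⟩

theorem preservesNormG_mul {τ τ' : Perm ABParams} (h : PreservesNormG τ) (h' : PreservesNormG τ') :
    PreservesNormG (τ * τ') := fun q =>
  ⟨(h (τ' q)).1.trans (h' q).1, fun hq => ((h (τ' q)).2 ((h' q).1.2 hq)).trans ((h' q).2 hq)⟩

theorem preservesNormG_one : PreservesNormG 1 := fun _ => ⟨Iff.rfl, fun _ => rfl⟩

/-- The shift of the even indices is the conjugate by the involution of that of the odd indices. -/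
theorem abShift_even (m : ℤ) : abShift {0, 2, 4, 6} m =
    (aPerm flipIdx * bPerm flipIdx) * abShift {0, 1, 3, 5} m * (aPerm flipIdx * bPerm flipIdx) := by
  have hs : flipIdx.symm = flipIdx := by decide
  have h1 : ∀ j, flipIdx (flipIdx j) = j := by decide
  have h2 : ∀ j, flipIdx j ∈ ({0, 1, 3, 5} : Finset (Fin 7)) ↔
      j ∈ ({0, 2, 4, 6} : Finset (Fin 7)) := by decide
  ext q j
  · simp only [Perm.mul_apply, aPerm, bPerm, abShift, Equiv.coe_fn_mk, Function.comp_apply, hs, h1,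
      h2]
  · simp only [Perm.mul_apply, aPerm, bPerm, abShift, Equiv.coe_fn_mk, Function.comp_apply, hs, h1,
      h2]

theorem preservesNormG_of_mem {τ : Perm ABParams} (h : τ ∈ abTrivial) : PreservesNormG τ := by
  have hid : KeepsParity 1 := ⟨rfl, fun _ h => h, fun _ h => h⟩
  have ha1 : aPerm 1 = 1 := rfl
  have hb1 : bPerm 1 = 1 := rfl
  induction h using Subgroup.closure_induction with
  | mem τ hτ =>
    rcases hτ with (⟨σ, hσ, rfl | rfl⟩ | hτ) | ⟨m, rfl | rfl⟩
    · have := preservesNormG_perm hσ hid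
      rwa [hb1, mul_one] at this
    · have := preservesNormG_perm hid hσ
      rwa [ha1, one_mul] at this
    · rw [mem_singleton_iff.1 hτ]
      exact preservesNormG_flip
    · exact preservesNormG_shift_odd m
    · rw [abShift_even]
      exact preservesNormG_mul (preservesNormG_mul preservesNormG_flip (preservesNormG_shift_odd m))
        preservesNormG_flip
  | one => exact preservesNormG_one
  | mul _ _ _ _ h1 h2 => exact preservesNormG_mul h1 h2
  | inv _ _ h => exact preservesNormG_inv h

/-! ### The 27 numbers and the transformations of the parameters -/

theorem perm_apply_inv {α : Type*} (g : Perm α) (x : α) : g (g⁻¹ x) = x := g.apply_symm_apply x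

theorem perm_inv_apply {α : Type*} (g : Perm α) (x : α) : g⁻¹ (g x) = x := g.symm_apply_apply x

theorem BParams.ext_h {p q : BParams} (h : p.1.h = q.1.h) : p = q := by
  refine Subtype.ext (HParams.ext ?_ h)
  rw [p.2, q.2, h]

/-- The 27 numbers determine the parameters. -/
theorem eVal_injective {p q : BParams} (h : eVal p.1 = eVal q.1) : p = q := by
  have h1 : ∀ j : Fin 7, j ≠ 0 → p.1.h j = q.1.h j := fun j hj => by
    have := congrFun h (.e 0 j (Fin.pos_iff_ne_zero.2 hj))
    simp only [eVal, if_true] at this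
    omega
  refine BParams.ext_h (funext fun j => ?_)
  rcases eq_or_ne j 0 with rfl | hj
  · have := congrFun h (.e 1 2 (by decide))
    simp only [eVal, if_neg (by decide : ¬(1 : Fin 7) = 0), h1 1 (by decide),
      h1 2 (by decide)] at this
    omega
  · exact h1 j hj

/-- The labels as a disjoint union of pairs and of single indices. -/
def labelEquiv : {x : Fin 7 × Fin 7 // x.1 < x.2} ⊕ {j : Fin 7 // j ≠ 0} ≃ Label where
  toFun
    | .inl x => .e x.1.1 x.1.2 x.2
    | .inr j => .ebar j.1 j.2
  invFun
    | .e j k h => .inl ⟨(j, k), h⟩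
    | .ebar j h => .inr ⟨j, h⟩
  left_inv x := by rcases x with x | x <;> rfl
  right_inv x := by cases x <;> rfl

instance : Fintype Label := Fintype.ofEquiv _ labelEquiv

/-- Parameters for which the 27 numbers are distinct. -/
def genericPoint : BParams := ⟨⟨2939, ![1002, 2, 3, 5, 9, 17, 33]⟩, by
  unfold HParams.Balanced; decide⟩

theorem genericPoint_injective : Function.Injective (eVal genericPoint.1) := by
  have : ∀ x y : Label, eVal genericPoint.1 x = eVal genericPoint.1 y → x = y := by decide +kernel
  exact fun x y => this x y

theorem induces_one : Induces 1 1 := fun _ _ => rfl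

theorem Induces.mul {g g' : Perm BParams} {π π' : Perm Label} (h : Induces g π)
    (h' : Induces g' π') : Induces (g * g') (π * π') := fun p x => by
  rw [Perm.mul_apply, Perm.mul_apply, h, h']

theorem Induces.inv {g : Perm BParams} {π : Perm Label} (h : Induces g π) : Induces g⁻¹ π⁻¹ :=
  fun p x => by
    have := h (g⁻¹ p) (π⁻¹ x)
    rw [perm_apply_inv, perm_apply_inv] at this
    exact this.symm

theorem Induces.unique {g : Perm BParams} {π π' : Perm Label} (h : Induces g π)
    (h' : Induces g π') : π = π' := by
  ext1 x
  apply genericPoint_injective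
  have h1 := h (g⁻¹ genericPoint) x
  have h2 := h' (g⁻¹ genericPoint) x
  rw [perm_apply_inv] at h1 h2
  rw [h1, h2]

theorem Induces.unique_left {g g' : Perm BParams} {π : Perm Label} (h : Induces g π)
    (h' : Induces g' π) : g = g' := by
  ext1 p
  refine eVal_injective (funext fun x => ?_)
  have h1 := h p (π⁻¹ x)
  have h2 := h' p (π⁻¹ x)
  rw [perm_apply_inv] at h1 h2
  rw [h1, h2]

/-- A transformation that maps each of the 27 numbers to one of them permutes them. -/
theorem exists_induces {g : Perm BParams} (h : ∀ x, ∃ y, ∀ p : BParams, eVal (g p).1 y =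
    eVal p.1 x) :
    ∃ π, Induces g π := by
  choose f hf using h
  have hinj : Function.Injective f := fun x y hxy => by
    apply genericPoint_injective
    rw [← hf x, ← hf y, hxy]
  exact ⟨Equiv.ofBijective f (Finite.injective_iff_bijective.1 hinj), fun p x => hf x p⟩

theorem relabel_h (σ : {σ : Perm (Fin 7) // σ 0 = 0}) (p : BParams) (j : Fin 7) :
    (relabel σ p).1.h (σ.1 j) = p.1.h j := by
  change p.1.h (σ.1.symm (σ.1 j)) = _
  rw [Equiv.symm_apply_apply]

theorem relabel_h_zero (σ : {σ : Perm (Fin 7) // σ 0 = 0}) (p : BParams) :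
    (relabel σ p).1.h 0 = p.1.h 0 := by
  have := relabel_h σ p 0
  rwa [σ.2] at this

theorem relabel_exists_induces (σ : {σ : Perm (Fin 7) // σ 0 = 0}) : ∃ π, Induces (relabel σ) π :=
    by
  have hne : ∀ j, j ≠ 0 → σ.1 j ≠ 0 := fun j hj h => hj (σ.1.injective (h.trans σ.2.symm))
  refine exists_induces fun x => ?_
  rcases x with ⟨j, k, hjk⟩ | ⟨j, hj⟩
  · have hk : k ≠ 0 := Fin.pos_iff_ne_zero.1 (lt_of_le_of_lt (Fin.zero_le j) hjk)
    rcases eq_or_ne j 0 with rfl | hj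
    · refine ⟨.e 0 (σ.1 k) (Fin.pos_iff_ne_zero.2 (hne k hk)), fun p => ?_⟩
      simp only [eVal, if_true, relabel_h]
    · rcases lt_or_gt_of_ne (fun h => hjk.ne (σ.1.injective h) : σ.1 j ≠ σ.1 k) with h | h
      · refine ⟨.e _ _ h, fun p => ?_⟩
        simp only [eVal, if_neg hj, if_neg (hne j hj), relabel_h, relabel_h_zero]
      · refine ⟨.e _ _ h, fun p => ?_⟩
        simp only [eVal, if_neg hj, if_neg (hne k hk), relabel_h, relabel_h_zero]
        ring
  · refine ⟨.ebar (σ.1 j) (hne j hj), fun p => ?_⟩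
    simp only [eVal, relabel_h, relabel_h_zero]
    rfl

/-- The coefficients of the 27 numbers as linear forms in `h₀ - 2, h₁ - 1, …, h₆ - 1`. -/
def labelForm : Label → Fin 7 → ℤ
  | .e j k _ => fun i => if j = 0 then (if i = k then 1 else 0) else
      (if i = 0 then 1 else if i = j ∨ i = k then -1 else 0)
  | .ebar j _ => fun i => if i = 0 then 2 else if i = j then 0 else -1

/-- The coordinates `h₀ - 2, h₁ - 1, …, h₆ - 1`, on which the group acts linearly. -/
def linCoord (p : BParams) (i : Fin 7) : ℤ := if i = 0 then p.1.h 0 - 2 else p.1.h i - 1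

theorem eVal_eq_sum (p : BParams) (x : Label) :
    eVal p.1 x = ∑ i, labelForm x i * linCoord p i := by
  have hp := p.2
  rw [HParams.Balanced, Finset.sum_erase_eq_sub (Finset.mem_univ _), Fin.sum_univ_seven] at hp
  rcases x with ⟨j, k, hjk⟩ | ⟨j, hj⟩
  · rw [Fin.sum_univ_seven]
    fin_cases j <;> fin_cases k <;> first | (exact absurd hjk (by decide)) |
      (simp [eVal, labelForm, linCoord]; try ring)
  · rw [Fin.sum_univ_seven]
    fin_cases j <;> first | (exact absurd rfl hj) |
      (simp [eVal, labelForm, linCoord, hp]; ring)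

theorem linCoord_b135 (p : BParams) (i : Fin 7) : linCoord (b135 p) i = linCoord p i +
    if i ∈ ({0, 1, 3, 5} : Finset (Fin 7)) then
      linCoord p 0 - linCoord p 1 - linCoord p 3 - linCoord p 5 else 0 := by
  have h : ∀ i, (b135 p).1.h i = if i ∈ ({0, 1, 3, 5} : Finset (Fin 7)) then
      p.1.h i + (1 + p.1.h 0 - ∑ j ∈ ({1, 3, 5} : Finset (Fin 7)), p.1.h j) else p.1.h i :=
    fun i => rfl
  have hs : ∑ j ∈ ({1, 3, 5} : Finset (Fin 7)), p.1.h j = p.1.h 1 + p.1.h 3 + p.1.h 5 := by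
    rw [Finset.sum_insert (by decide), Finset.sum_pair (by decide), add_assoc]
  simp only [hs] at h
  fin_cases i <;> simp [linCoord, h] <;> ring

theorem b135_induces : Induces b135 bLabel := by
  have key : ∀ x : Label, ∀ i : Fin 7, labelForm (bLabel x) i +
      (if i = 0 then 1 else if i = 1 ∨ i = 3 ∨ i = 5 then -1 else 0) *
        (labelForm (bLabel x) 0 + labelForm (bLabel x) 1 + labelForm (bLabel x) 3 +
          labelForm (bLabel x) 5) = labelForm x i := by decide +kernel
  intro p x
  rw [eVal_eq_sum, eVal_eq_sum]
  simp only [linCoord_b135, ← key x]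
  rw [Fin.sum_univ_seven, Fin.sum_univ_seven]
  simp
  ring

/-! ### The group generated by permutations and Bailey's transformations -/

/-- The permutations of the indices `0, …, 6` that fix `0`. -/
abbrev IdxPerm : Type := {σ : Perm (Fin 7) // σ 0 = 0}

/-- The inverse permutation, which also fixes `0`. -/
def IdxPerm.inv (σ : IdxPerm) : IdxPerm :=
  ⟨σ.1⁻¹, by rw [Perm.inv_eq_iff_eq]; exact σ.2.symm⟩

/-- The composition of two permutations fixing `0`. -/
def IdxPerm.mul (σ τ : IdxPerm) : IdxPerm := ⟨σ.1 * τ.1, by rw [Perm.mul_apply, τ.2, σ.2]⟩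

theorem relabel_mul (σ τ : IdxPerm) : relabel σ * relabel τ = relabel (σ.mul τ) := by
  ext1 p
  exact BParams.ext_h rfl

theorem relabel_inv (σ : IdxPerm) : (relabel σ)⁻¹ = relabel σ.inv := by
  rw [inv_eq_iff_mul_eq_one, relabel_mul]
  ext1 p
  refine BParams.ext_h ?_
  change p.1.h ∘ (σ.1 * σ.1⁻¹).symm = p.1.h
  rw [mul_inv_cancel]
  rfl

theorem relabel_injective : Function.Injective relabel := by
  intro σ τ h
  refine Subtype.ext (Equiv.ext fun j => ?_)
  have hg : Function.Injective genericPoint.1.h := by decide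
  apply hg
  have h1 := relabel_h σ ((relabel σ)⁻¹ genericPoint) j
  have h2 := relabel_h τ ((relabel τ)⁻¹ genericPoint) j
  rw [perm_apply_inv] at h1 h2
  rw [h1, h2, h]

theorem bailey_inv (s : Triple) : (bailey s)⁻¹ = bailey s := rfl

theorem bailey_h (s : Triple) (p : BParams) (j : Fin 7) : (bailey s p).1.h j =
    if j ∈ insert 0 s.1 then p.1.h j + (1 + p.1.h 0 - ∑ i ∈ s.1, p.1.h i) else p.1.h j := rfl

/-- All the transformations `𝔟_s` are conjugate under the permutations of the parameters. -/
theorem bailey_conj (s : Triple) : ∃ σ : IdxPerm, bailey s = relabel σ * b135 * (relabel σ)⁻¹ := by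
  obtain ⟨ρ, hρ⟩ : ∃ ρ : Perm (Fin 7), ∀ j, j ∈ ({1, 3, 5} : Finset (Fin 7)) ↔ ρ j ∈ s.1 := by
    have hc : Fintype.card {x // x ∈ ({1, 3, 5} : Finset (Fin 7))} = Fintype.card {x // x ∈ s.1} :=
      by
      rw [Fintype.card_coe, Fintype.card_coe, s.2.2]; rfl
    let e := Fintype.equivOfCardEq hc
    refine ⟨e.extendSubtype, fun j => ⟨fun h => e.extendSubtype_mem j h, fun h => ?_⟩⟩
    by_contra hj
    exact e.extendSubtype_not_mem j hj h
  have h0 : ρ 0 ∉ s.1 := fun h => absurd ((hρ 0).2 h) (by decide)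
  have hσ0 : (swap (ρ 0) 0 * ρ) 0 = 0 := by simp
  have hσ : ∀ j, j ∈ ({1, 3, 5} : Finset (Fin 7)) ↔ (swap (ρ 0) 0 * ρ) j ∈ s.1 := by
    intro j
    rw [hρ, Perm.mul_apply]
    by_cases h1 : ρ j = ρ 0
    · rw [h1, swap_apply_left]
      exact iff_of_false h0 s.2.1
    by_cases h2 : ρ j = 0
    · rw [h2, swap_apply_right]
      exact iff_of_false s.2.1 h0
    rw [swap_apply_of_ne_of_ne h1 h2]
  refine ⟨⟨_, hσ0⟩, ?_⟩
  generalize swap (ρ 0) 0 * ρ = σ at hσ0 hσ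
  rw [eq_mul_inv_iff_mul_eq]
  ext1 p
  refine BParams.ext_h (funext fun j => ?_)
  obtain ⟨k, rfl⟩ := σ.surjective j
  have hm : ∀ k, σ k ∈ insert 0 s.1 ↔ k ∈ insert 0 ({1, 3, 5} : Finset (Fin 7)) := by
    intro k
    rw [Finset.mem_insert, Finset.mem_insert, ← hσ]
    refine or_congr ⟨fun h => σ.injective (h.trans hσ0.symm), ?_⟩ Iff.rfl
    rintro rfl
    exact hσ0
  have hs : ∑ i ∈ s.1, (relabel ⟨σ, hσ0⟩ p).1.h i = ∑ i ∈ ({1, 3, 5} : Finset (Fin 7)), p.1.h i :=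
    (Finset.sum_equiv σ hσ fun i _ => (relabel_h ⟨σ, hσ0⟩ p i).symm).symm
  have e1 := relabel_h ⟨σ, hσ0⟩ p
  have e2 := relabel_h ⟨σ, hσ0⟩ (b135 p)
  simp only at e1 e2
  rw [Perm.mul_apply, Perm.mul_apply, bailey_h, e1, e2, hs, relabel_h_zero, b135, bailey_h]
  simp only [hm]

theorem bailey_exists_induces (s : Triple) : ∃ π, Induces (bailey s) π := by
  obtain ⟨σ, h⟩ := bailey_conj s
  obtain ⟨π, hπ⟩ := relabel_exists_induces σ
  rw [h]
  exact ⟨_, (hπ.mul b135_induces).mul hπ.inv⟩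

theorem relabel_mem (σ : IdxPerm) : relabel σ ∈ transGroup :=
  Subgroup.subset_closure (Or.inl ⟨σ, rfl⟩)

theorem bailey_mem (s : Triple) : bailey s ∈ transGroup :=
  Subgroup.subset_closure (Or.inr ⟨s, rfl⟩)

theorem closure_relabel_b135 : Subgroup.closure (Set.range relabel ∪ {b135}) = transGroup := by
  refine le_antisymm ?_ ?_
  · rw [Subgroup.closure_le]
    rintro g (⟨σ, rfl⟩ | rfl)
    · exact relabel_mem σ
    · exact bailey_mem _
  · rw [transGroup, Subgroup.closure_le]
    rintro g (⟨σ, rfl⟩ | ⟨s, rfl⟩)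
    · exact Subgroup.subset_closure (Or.inl ⟨σ, rfl⟩)
    · obtain ⟨σ, h⟩ := bailey_conj s
      rw [h]
      have h1 : relabel σ ∈ Subgroup.closure (Set.range relabel ∪ {b135}) :=
        Subgroup.subset_closure (Or.inl ⟨σ, rfl⟩)
      exact mul_mem (mul_mem h1 (Subgroup.subset_closure (Or.inr rfl))) (inv_mem h1)

theorem closure_hLabels_bLabel : Subgroup.closure (hLabels ∪ {bLabel}) = permGroup := by
  refine le_antisymm ?_ ?_
  · rw [Subgroup.closure_le]
    rintro π (h | h)
    · exact Subgroup.subset_closure (Or.inl h)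
    · rw [mem_singleton_iff.1 h]
      exact Subgroup.subset_closure (Or.inr ⟨_, b135_induces⟩)
  · rw [permGroup, Subgroup.closure_le]
    rintro π (h | ⟨s, h⟩)
    · exact Subgroup.subset_closure (Or.inl h)
    · obtain ⟨σ, hs⟩ := bailey_conj s
      obtain ⟨π', hπ'⟩ := relabel_exists_induces σ
      rw [hs] at h
      rw [h.unique ((hπ'.mul b135_induces).mul hπ'.inv)]
      have h1 : π' ∈ Subgroup.closure (hLabels ∪ {bLabel}) :=
        Subgroup.subset_closure (Or.inl ⟨σ, hπ'⟩)
      exact mul_mem (mul_mem h1 (Subgroup.subset_closure (Or.inr rfl))) (inv_mem h1)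

theorem exists_induces_of_mem {g : Perm BParams} (hg : g ∈ transGroup) :
    ∃ π ∈ permGroup, Induces g π := by
  induction hg using Subgroup.closure_induction with
  | mem g h =>
    rcases h with ⟨σ, rfl⟩ | ⟨s, rfl⟩
    · obtain ⟨π, hπ⟩ := relabel_exists_induces σ
      exact ⟨π, Subgroup.subset_closure (Or.inl ⟨σ, hπ⟩), hπ⟩
    · obtain ⟨π, hπ⟩ := bailey_exists_induces s
      exact ⟨π, Subgroup.subset_closure (Or.inr ⟨s, hπ⟩), hπ⟩
  | one => exact ⟨1, one_mem _, induces_one⟩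
  | mul _ _ _ _ h1 h2 =>
    obtain ⟨π₁, m₁, i₁⟩ := h1
    obtain ⟨π₂, m₂, i₂⟩ := h2
    exact ⟨_, mul_mem m₁ m₂, i₁.mul i₂⟩
  | inv _ _ h =>
    obtain ⟨π, m, i⟩ := h
    exact ⟨_, inv_mem m, i.inv⟩

theorem exists_trans_of_mem {π : Perm Label} (hπ : π ∈ permGroup) :
    ∃ g ∈ transGroup, Induces g π := by
  induction hπ using Subgroup.closure_induction with
  | mem π h =>
    rcases h with ⟨σ, h⟩ | ⟨s, h⟩
    · exact ⟨_, relabel_mem σ, h⟩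
    · exact ⟨_, bailey_mem s, h⟩
  | one => exact ⟨1, one_mem _, induces_one⟩
  | mul _ _ _ _ h1 h2 =>
    obtain ⟨g₁, m₁, i₁⟩ := h1
    obtain ⟨g₂, m₂, i₂⟩ := h2
    exact ⟨_, mul_mem m₁ m₂, i₁.mul i₂⟩
  | inv _ _ h =>
    obtain ⟨g, m, i⟩ := h
    exact ⟨_, inv_mem m, i.inv⟩

theorem exists_mulEquiv : ∃ Φ : transGroup ≃* permGroup, ∀ g : transGroup, Induces g (Φ g) := by
  have h : ∀ g : transGroup, ∃ π : permGroup, Induces g π := fun g => by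
    obtain ⟨π, m, i⟩ := exists_induces_of_mem g.2
    exact ⟨⟨π, m⟩, i⟩
  choose f hf using h
  let F : transGroup →* permGroup := MonoidHom.mk' f fun g g' =>
    Subtype.ext ((hf (g * g')).unique ((hf g).mul (hf g')))
  refine ⟨MulEquiv.ofBijective F ⟨fun g g' hgg' => ?_, fun π => ?_⟩, hf⟩
  · have h1 := hf g
    rw [show f g = f g' from hgg'] at h1
    exact Subtype.ext (h1.unique_left (hf g'))
  · obtain ⟨g, m, i⟩ := exists_trans_of_mem π.2
    exact ⟨⟨g, m⟩, Subtype.ext ((hf ⟨g, m⟩).unique i)⟩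

/-- The stabiliser of a parameter set whose 27 numbers are distinct is trivial. -/
theorem eq_of_apply_eq {g g' : Perm BParams} (hg : g ∈ transGroup) (hg' : g' ∈ transGroup)
    {p : BParams} (hp : Function.Injective (eVal p.1)) (h : g p = g' p) : g = g' := by
  obtain ⟨π, _, i⟩ := exists_induces_of_mem (mul_mem (inv_mem hg') hg)
  have h1 : π = 1 := by
    ext1 x
    apply hp
    have h2 := i p x
    rw [Perm.mul_apply, h, perm_inv_apply] at h2
    exact h2
  rw [h1] at i
  exact (inv_mul_eq_one.1 (i.unique_left induces_one)).symm

theorem trans_hm {g : Perm BParams} (hg : g ∈ transGroup) : ∀ p, (g p).1.hm = p.1.hm := by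
  induction hg using Subgroup.closure_induction with
  | mem g h =>
    rcases h with ⟨σ, rfl⟩ | ⟨s, rfl⟩
    · exact fun _ => rfl
    · exact fun _ => rfl
  | one => exact fun _ => rfl
  | mul _ _ _ _ h1 h2 => exact fun p => (h1 _).trans (h2 p)
  | inv g _ h => exact fun p => by rw [← h, perm_apply_inv]

/-! ### The order of the group -/

/-- The linear form `v₀ (h₀ - 2) - ∑ v_j (h_j - 1)`. -/
def classForm (v : Fin 7 → ℤ) (p : BParams) : ℤ :=
  v 0 * (p.1.h 0 - 2) - ∑ j ∈ Finset.univ.erase 0, v j * (p.1.h j - 1)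

/-- The coefficient vectors in the orbit of the form `h₀ - 2`: those with `∑ v_j = 3 v₀ - 3` and
`∑ v_j² = v₀² - 1`. In the Picard lattice of a cubic surface they are the classes of
self-intersection `1` and degree `3`, that is, the classes of a line of the plane pulled back by one
of the 72 contractions of the surface to the plane. -/
def IsLineClass (v : Fin 7 → ℤ) : Prop :=
  ∑ j ∈ Finset.univ.erase 0, v j = 3 * v 0 - 3 ∧ ∑ j ∈ Finset.univ.erase 0, v j ^ 2 = v 0 ^ 2 - 1

/-- The action of Bailey's transformation on coefficient vectors. -/
def baileyVec (s : Triple) (v : Fin 7 → ℤ) (j : Fin 7) : ℤ :=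
  if j ∈ insert 0 s.1 then v j + (v 0 - ∑ i ∈ s.1, v i) else v j

theorem triple_subset (s : Triple) : s.1 ⊆ Finset.univ.erase 0 := fun i hi =>
  Finset.mem_erase.2 ⟨fun h => s.2.1 (h ▸ hi), Finset.mem_univ _⟩

/-- Splits a sum over `1, …, 6` of values that depend on membership in `s`. -/
theorem sum_erase_split (s : Triple) {f g k : Fin 7 → ℤ} (h1 : ∀ j ∈ s.1, f j = g j + k j)
    (h2 : ∀ j, j ≠ 0 → j ∉ s.1 → f j = g j) :
    ∑ j ∈ Finset.univ.erase 0, f j = ∑ j ∈ Finset.univ.erase 0, g j + ∑ j ∈ s.1, k j := by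
  rw [← Finset.sum_sdiff (triple_subset s), ← Finset.sum_sdiff (triple_subset s) (f := g),
    Finset.sum_congr rfl h1, Finset.sum_add_distrib, Finset.sum_congr rfl (g := g)]
  · ring
  · intro j hj
    rw [Finset.mem_sdiff, Finset.mem_erase] at hj
    exact h2 j hj.1.1 hj.2

theorem classForm_bailey (s : Triple) (v : Fin 7 → ℤ) (p : BParams) :
    classForm v (bailey s p) = classForm (baileyVec s v) p := by
  set δ := 1 + p.1.h 0 - ∑ i ∈ s.1, p.1.h i with hδ
  set c := v 0 - ∑ i ∈ s.1, v i with hc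
  have e1 := sum_erase_split s (f := fun j => v j * ((bailey s p).1.h j - 1))
    (g := fun j => v j * (p.1.h j - 1)) (k := fun j => v j * δ)
    (fun j hj => by simp only [bailey_h, if_pos (Finset.mem_insert_of_mem hj)]; ring)
    (fun j h0 hj => by
      simp only [bailey_h, if_neg (fun h => (Finset.mem_insert.1 h).elim h0 hj)])
  have e2 := sum_erase_split s (f := fun j => baileyVec s v j * (p.1.h j - 1))
    (g := fun j => v j * (p.1.h j - 1)) (k := fun j => c * (p.1.h j - 1))
    (fun j hj => by simp only [baileyVec, if_pos (Finset.mem_insert_of_mem hj)]; ring)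
    (fun j h0 hj => by
      simp only [baileyVec, if_neg (fun h => (Finset.mem_insert.1 h).elim h0 hj)])
  have e3 : (bailey s p).1.h 0 = p.1.h 0 + δ := by
    rw [bailey_h, if_pos (Finset.mem_insert_self _ _)]
  have e4 : baileyVec s v 0 = v 0 + c := by
    rw [baileyVec, if_pos (Finset.mem_insert_self _ _)]
  rw [← Finset.sum_mul] at e1
  rw [← Finset.mul_sum, Finset.sum_sub_distrib, Finset.sum_const, s.2.2] at e2
  rw [classForm, classForm, e1, e2, e3, e4]
  simp only [nsmul_eq_mul, mul_one, Nat.cast_ofNat]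
  have e5 : ∑ i ∈ s.1, v i = v 0 - c := by rw [hc]; ring
  have e6 : ∑ i ∈ s.1, p.1.h i = 1 + p.1.h 0 - δ := by rw [hδ]; ring
  rw [e5, e6]
  ring

theorem isLineClass_baileyVec (s : Triple) {v : Fin 7 → ℤ} (h : IsLineClass v) :
    IsLineClass (baileyVec s v) := by
  set c := v 0 - ∑ i ∈ s.1, v i with hc
  have e1 := sum_erase_split s (f := baileyVec s v) (g := v) (k := fun _ => c)
    (fun j hj => by simp only [baileyVec, if_pos (Finset.mem_insert_of_mem hj)]; rfl)
    (fun j h0 hj => by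
      simp only [baileyVec, if_neg (fun h => (Finset.mem_insert.1 h).elim h0 hj)])
  have e2 := sum_erase_split s (f := fun j => baileyVec s v j ^ 2) (g := fun j => v j ^ 2)
    (k := fun j => 2 * c * v j + c ^ 2)
    (fun j hj => by simp only [baileyVec, if_pos (Finset.mem_insert_of_mem hj)]; ring)
    (fun j h0 hj => by
      simp only [baileyVec, if_neg (fun h => (Finset.mem_insert.1 h).elim h0 hj)])
  have e4 : baileyVec s v 0 = v 0 + c := by
    rw [baileyVec, if_pos (Finset.mem_insert_self _ _)]
  rw [Finset.sum_const, s.2.2] at e1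
  rw [Finset.sum_add_distrib, ← Finset.mul_sum, Finset.sum_const, s.2.2] at e2
  have e5 : ∑ i ∈ s.1, v i = v 0 - c := by rw [hc]; ring
  obtain ⟨h1, h2⟩ := h
  refine ⟨?_, ?_⟩
  · rw [e1, h1, e4]; simp; ring
  · rw [e2, h2, e4, e5]; simp; ring

theorem baileyVec_involutive (s : Triple) (v : Fin 7 → ℤ) : baileyVec s (baileyVec s v) = v := by
  have h1 : ∑ i ∈ s.1, baileyVec s v i = ∑ i ∈ s.1, v i + 3 * (v 0 - ∑ i ∈ s.1, v i) := by
    have hi : ∀ i ∈ s.1, baileyVec s v i = v i + (v 0 - ∑ i ∈ s.1, v i) := fun i hi =>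
      if_pos (Finset.mem_insert_of_mem hi)
    rw [Finset.sum_congr rfl hi, Finset.sum_add_distrib, Finset.sum_const, s.2.2]
    simp
  have h3 : baileyVec s v 0 = v 0 + (v 0 - ∑ i ∈ s.1, v i) := if_pos (Finset.mem_insert_self _ _)
  funext j
  rw [baileyVec, h1, h3]
  by_cases hj : j ∈ insert 0 s.1
  · rw [if_pos hj, baileyVec, if_pos hj]
    ring
  · rw [if_neg hj, baileyVec, if_neg hj]

theorem idxPerm_mem_erase (σ : IdxPerm) (j : Fin 7) :
    j ∈ Finset.univ.erase 0 ↔ σ.1 j ∈ Finset.univ.erase 0 := by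
  rw [Finset.mem_erase, Finset.mem_erase, and_iff_left (Finset.mem_univ _),
    and_iff_left (Finset.mem_univ _), not_iff_not]
  exact ⟨fun h => h ▸ σ.2, fun h => σ.1.injective (h.trans σ.2.symm)⟩

theorem classForm_relabel (σ : IdxPerm) (v : Fin 7 → ℤ) (p : BParams) :
    classForm v (relabel σ p) = classForm (v ∘ σ.1) p := by
  rw [classForm, classForm, relabel_h_zero, Function.comp_apply, σ.2]
  congr 1
  exact (Finset.sum_equiv σ.1 (idxPerm_mem_erase σ) fun j _ => by rw [relabel_h]; rfl).symm

theorem isLineClass_comp (σ : IdxPerm) {v : Fin 7 → ℤ} (h : IsLineClass v) :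
    IsLineClass (v ∘ σ.1) := by
  obtain ⟨h1, h2⟩ := h
  refine ⟨?_, ?_⟩
  · rw [Function.comp_apply, σ.2, ← h1]
    exact Finset.sum_equiv σ.1 (idxPerm_mem_erase σ) fun j _ => rfl
  · rw [Function.comp_apply, σ.2, ← h2]
    exact Finset.sum_equiv σ.1 (idxPerm_mem_erase σ) fun j _ => rfl

/-- The group permutes the forms given by `IsLineClass`. -/
theorem exists_classForm {g : Perm BParams} (hg : g ∈ transGroup) :
    ∀ v, IsLineClass v → ∃ v', IsLineClass v' ∧ ∀ p, classForm v (g p) = classForm v' p := by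
  suffices h : (∀ v, IsLineClass v → ∃ v', IsLineClass v' ∧ ∀ p, classForm v (g p) = classForm v' p)
      ∧ ∀ v, IsLineClass v → ∃ v', IsLineClass v' ∧ ∀ p, classForm v (g⁻¹ p) = classForm v' p from
    h.1
  induction hg using Subgroup.closure_induction with
  | mem g h =>
    rcases h with ⟨σ, rfl⟩ | ⟨s, rfl⟩
    · rw [relabel_inv]
      exact ⟨fun v hv => ⟨_, isLineClass_comp σ hv, classForm_relabel σ v⟩,
        fun v hv => ⟨_, isLineClass_comp _ hv, classForm_relabel _ v⟩⟩
    · rw [bailey_inv]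
      exact ⟨fun v hv => ⟨_, isLineClass_baileyVec s hv, classForm_bailey s v⟩,
        fun v hv => ⟨_, isLineClass_baileyVec s hv, classForm_bailey s v⟩⟩
  | one => exact ⟨fun v hv => ⟨v, hv, fun _ => rfl⟩, fun v hv => ⟨v, hv, fun _ => rfl⟩⟩
  | mul g₁ g₂ _ _ h1 h2 =>
    refine ⟨fun v hv => ?_, fun v hv => ?_⟩
    · obtain ⟨v₁, w₁, k₁⟩ := h1.1 v hv
      obtain ⟨v₂, w₂, k₂⟩ := h2.1 v₁ w₁
      exact ⟨v₂, w₂, fun p => (k₁ _).trans (k₂ p)⟩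
    · rw [mul_inv_rev]
      obtain ⟨v₁, w₁, k₁⟩ := h2.2 v hv
      obtain ⟨v₂, w₂, k₂⟩ := h1.2 v₁ w₁
      exact ⟨v₂, w₂, fun p => (k₁ _).trans (k₂ p)⟩
  | inv g _ h => exact ⟨h.2, by rw [inv_inv]; exact h.1⟩

theorem sum_erase_zero (f : Fin 7 → ℤ) :
    ∑ j ∈ Finset.univ.erase 0, f j = f 1 + f 2 + f 3 + f 4 + f 5 + f 6 := by
  rw [Finset.sum_erase_eq_sub (Finset.mem_univ _), Fin.sum_univ_seven]
  ring

/-- The bounds come from the Cauchy–Schwarz inequality. -/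
theorem IsLineClass.bounds {v : Fin 7 → ℤ} (h : IsLineClass v) :
    (1 ≤ v 0 ∧ v 0 ≤ 5) ∧ ∀ j, j ≠ 0 → 0 ≤ v j ∧ v j ≤ 2 := by
  obtain ⟨h1, h2⟩ := h
  rw [sum_erase_zero] at h1 h2
  have key : ∀ d a b c e f g : ℤ, a + b + c + e + f + g = 3 * d - 3 →
      a ^ 2 + b ^ 2 + c ^ 2 + e ^ 2 + f ^ 2 + g ^ 2 = d ^ 2 - 1 →
      (1 ≤ d ∧ d ≤ 5) ∧ 0 ≤ a ∧ a ≤ 2 := by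
    intro d a b c e f g k1 k2
    have c5 : (3 * d - 3 - a) ^ 2 ≤ 5 * (d ^ 2 - 1 - a ^ 2) := by
      have : 3 * d - 3 - a = b + c + e + f + g := by linarith
      rw [this, show d ^ 2 - 1 - a ^ 2 = b ^ 2 + c ^ 2 + e ^ 2 + f ^ 2 + g ^ 2 by linarith]
      nlinarith [sq_nonneg (b - c), sq_nonneg (b - e), sq_nonneg (b - f), sq_nonneg (b - g),
        sq_nonneg (c - e), sq_nonneg (c - f), sq_nonneg (c - g), sq_nonneg (e - f),
        sq_nonneg (e - g), sq_nonneg (f - g)]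
    clear k1 k2
    have c6 : (d - 1) * (d - 5) ≤ 0 := by nlinarith [sq_nonneg (2 * a - (d - 1))]
    have hd : 1 ≤ d ∧ d ≤ 5 := by constructor <;> nlinarith
    refine ⟨hd, ?_⟩
    obtain ⟨h1, h2⟩ := hd
    clear c6
    by_contra hcon
    rw [not_and_or, not_le, not_le] at hcon
    rcases hcon with h | h
    · have h' : a + 1 ≤ 0 := h
      interval_cases d <;> nlinarith [mul_nonneg_of_nonpos_of_nonpos h' h']
    · have h' : 0 ≤ a - 3 := by linarith
      interval_cases d <;> nlinarith [mul_nonneg h' h']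
  have k1 := key _ _ _ _ _ _ _ h1 h2
  refine ⟨k1.1, fun j hj => ?_⟩
  fin_cases j
  · exact absurd rfl hj
  · exact k1.2
  · exact (key (v 0) (v 2) (v 1) (v 3) (v 4) (v 5) (v 6) (by linarith) (by linarith)).2
  · exact (key (v 0) (v 3) (v 1) (v 2) (v 4) (v 5) (v 6) (by linarith) (by linarith)).2
  · exact (key (v 0) (v 4) (v 1) (v 2) (v 3) (v 5) (v 6) (by linarith) (by linarith)).2
  · exact (key (v 0) (v 5) (v 1) (v 2) (v 3) (v 4) (v 6) (by linarith) (by linarith)).2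
  · exact (key (v 0) (v 6) (v 1) (v 2) (v 3) (v 4) (v 5) (by linarith) (by linarith)).2

/-- The coefficient vectors of line classes, with entries in the range found in
`IsLineClass.bounds`. -/
abbrev LineCode : Type := {x : Fin 6 × Fin 3 × Fin 3 × Fin 3 × Fin 3 × Fin 3 × Fin 3 //
  (x.2.1.1 + x.2.2.1.1 + x.2.2.2.1.1 + x.2.2.2.2.1.1 + x.2.2.2.2.2.1.1 + x.2.2.2.2.2.2.1 + 3 =
    3 * x.1.1) ∧
  (x.2.1.1 ^ 2 + x.2.2.1.1 ^ 2 + x.2.2.2.1.1 ^ 2 + x.2.2.2.2.1.1 ^ 2 + x.2.2.2.2.2.1.1 ^ 2 +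
    x.2.2.2.2.2.2.1 ^ 2 + 1 = x.1.1 ^ 2)}

theorem card_lineCode : Fintype.card LineCode = 72 := by decide +kernel

/-- The coefficient vector encoded by an element of `LineCode`. -/
def lineCodeVec (x : LineCode) : Fin 7 → ℤ :=
  ![(x.1.1.1 : ℤ), (x.1.2.1.1 : ℤ), (x.1.2.2.1.1 : ℤ), (x.1.2.2.2.1.1 : ℤ), (x.1.2.2.2.2.1.1 : ℤ),
    (x.1.2.2.2.2.2.1.1 : ℤ), (x.1.2.2.2.2.2.2.1 : ℤ)]

theorem card_isLineClass : Nat.card {v : Fin 7 → ℤ // IsLineClass v} = 72 := by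
  rw [← card_lineCode, ← Nat.card_eq_fintype_card]
  symm
  refine Nat.card_eq_of_bijective (fun x => ⟨lineCodeVec x, ?_⟩) ⟨?_, ?_⟩
  · obtain ⟨h1, h2⟩ := x.2
    refine ⟨?_, ?_⟩
    · rw [sum_erase_zero]
      have := congrArg (fun n : ℕ => (n : ℤ)) h1
      push_cast at this
      simp only [lineCodeVec]
      exact eq_sub_of_add_eq this
    · rw [sum_erase_zero]
      have := congrArg (fun n : ℕ => (n : ℤ)) h2
      push_cast at this
      simp only [lineCodeVec]
      exact eq_sub_of_add_eq this
  · intro x y h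
    have h' := congrArg Subtype.val h
    have e : ∀ i, lineCodeVec x i = lineCodeVec y i := fun i => congrFun h' i
    refine Subtype.ext ?_
    have e0 := e 0
    have e1 := e 1
    have e2 := e 2
    have e3 := e 3
    have e4 := e 4
    have e5 := e 5
    have e6 := e 6
    simp only [lineCodeVec] at e0 e1 e2 e3 e4 e5 e6
    refine Prod.ext (Fin.ext (Int.ofNat.inj e0)) (Prod.ext (Fin.ext (Int.ofNat.inj e1))
      (Prod.ext (Fin.ext (Int.ofNat.inj e2)) (Prod.ext (Fin.ext (Int.ofNat.inj e3))
      (Prod.ext (Fin.ext (Int.ofNat.inj e4)) (Prod.ext (Fin.ext (Int.ofNat.inj e5))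
        (Fin.ext (Int.ofNat.inj e6)))))))
  · rintro ⟨v, hv⟩
    obtain ⟨hd, hm⟩ := hv.bounds
    obtain ⟨d, hd'⟩ : ∃ d : Fin 6, v 0 = (d.1 : ℤ) := ⟨⟨(v 0).toNat, by omega⟩, by simp; omega⟩
    have hm' : ∀ j, j ≠ 0 → ∃ m : Fin 3, v j = (m.1 : ℤ) := fun j hj =>
      ⟨⟨(v j).toNat, by have := hm j hj; omega⟩, by have := hm j hj; simp; omega⟩
    obtain ⟨m1, h1⟩ := hm' 1 (by decide)
    obtain ⟨m2, h2⟩ := hm' 2 (by decide)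
    obtain ⟨m3, h3⟩ := hm' 3 (by decide)
    obtain ⟨m4, h4⟩ := hm' 4 (by decide)
    obtain ⟨m5, h5⟩ := hm' 5 (by decide)
    obtain ⟨m6, h6⟩ := hm' 6 (by decide)
    obtain ⟨k1, k2⟩ := hv
    rw [sum_erase_zero, hd', h1, h2, h3, h4, h5, h6] at k1 k2
    refine ⟨⟨(d, m1, m2, m3, m4, m5, m6), ⟨by zify; linarith, by zify; linarith⟩⟩,
      Subtype.ext (funext fun j => ?_)⟩
    fin_cases j
    · exact hd'.symm
    · exact h1.symm
    · exact h2.symm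
    · exact h3.symm
    · exact h4.symm
    · exact h5.symm
    · exact h6.symm

/-- Unless `v₀ = 1`, some Bailey transformation lowers `v₀`. -/
theorem IsLineClass.exists_lt {v : Fin 7 → ℤ} (hv : IsLineClass v) (h : v 0 ≠ 1) :
    ∃ s : Triple, v 0 < ∑ i ∈ s.1, v i := by
  have key : ∀ (d : Fin 6) (m1 m2 m3 m4 m5 m6 : Fin 3),
      m1.1 + m2.1 + m3.1 + m4.1 + m5.1 + m6.1 + 3 = 3 * d.1 →
      m1.1 ^ 2 + m2.1 ^ 2 + m3.1 ^ 2 + m4.1 ^ 2 + m5.1 ^ 2 + m6.1 ^ 2 + 1 = d.1 ^ 2 → d.1 ≠ 1 →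
      ∃ i j k : Fin 7, i ≠ 0 ∧ j ≠ 0 ∧ k ≠ 0 ∧ i ≠ j ∧ i ≠ k ∧ j ≠ k ∧
        d.1 < ![0, m1.1, m2.1, m3.1, m4.1, m5.1, m6.1] i +
          ![0, m1.1, m2.1, m3.1, m4.1, m5.1, m6.1] j +
          ![0, m1.1, m2.1, m3.1, m4.1, m5.1, m6.1] k := by decide +kernel
  obtain ⟨hd, hm⟩ := hv.bounds
  obtain ⟨d, hd'⟩ : ∃ d : Fin 6, v 0 = (d.1 : ℤ) := ⟨⟨(v 0).toNat, by omega⟩, by simp; omega⟩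
  have hm' : ∀ j, j ≠ 0 → ∃ m : Fin 3, v j = (m.1 : ℤ) := fun j hj =>
    ⟨⟨(v j).toNat, by have := hm j hj; omega⟩, by have := hm j hj; simp; omega⟩
  obtain ⟨m1, h1⟩ := hm' 1 (by decide)
  obtain ⟨m2, h2⟩ := hm' 2 (by decide)
  obtain ⟨m3, h3⟩ := hm' 3 (by decide)
  obtain ⟨m4, h4⟩ := hm' 4 (by decide)
  obtain ⟨m5, h5⟩ := hm' 5 (by decide)
  obtain ⟨m6, h6⟩ := hm' 6 (by decide)
  obtain ⟨k1, k2⟩ := hv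
  rw [sum_erase_zero, hd', h1, h2, h3, h4, h5, h6] at k1 k2
  obtain ⟨i, j, k, i0, j0, k0, ij, ik, jk, hlt⟩ := key d m1 m2 m3 m4 m5 m6 (by zify; linarith)
    (by zify; linarith) (fun h1 => h (by rw [hd', h1]; rfl))
  have hf : ∀ i : Fin 7, i ≠ 0 → v i = ((![0, m1.1, m2.1, m3.1, m4.1, m5.1, m6.1] i : ℕ) : ℤ) := by
    intro i hi
    fin_cases i
    · exact absurd rfl hi
    · exact h1
    · exact h2
    · exact h3
    · exact h4
    · exact h5
    · exact h6
  refine ⟨⟨{i, j, k}, ?_, Finset.card_eq_three.2 ⟨i, j, k, ij, ik, jk, rfl⟩⟩, ?_⟩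
  · simp only [Finset.mem_insert, Finset.mem_singleton, not_or]
    exact ⟨i0.symm, j0.symm, k0.symm⟩
  · rw [Finset.sum_insert (by simp [ij, ik]), Finset.sum_pair jk, hf i i0, hf j j0, hf k k0, hd']
    exact_mod_cast (by omega)

/-- Every line class is in the orbit of `h₀ - 2`. -/
theorem IsLineClass.exists_trans (n : ℕ) : ∀ v : Fin 7 → ℤ, IsLineClass v → v 0 ≤ n →
    ∃ g ∈ transGroup, ∀ p, (g p).1.h 0 - 2 = classForm v p := by
  induction n with
  | zero => intro v hv hn; exact absurd hv.bounds.1.1 (by push_cast at hn; omega)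
  | succ n ih =>
    intro v hv hn
    by_cases h : v 0 = 1
    · refine ⟨1, one_mem _, fun p => ?_⟩
      have h0 : ∀ j ∈ Finset.univ.erase (0 : Fin 7), v j = 0 := by
        have := hv.2
        rw [h, one_pow, sub_self, Finset.sum_eq_zero_iff_of_nonneg fun j _ => sq_nonneg _] at this
        exact fun j hj => pow_eq_zero_iff two_ne_zero |>.1 (this j hj)
      rw [classForm, h, Finset.sum_eq_zero fun j hj => by rw [h0 j hj, zero_mul]]
      simp
    · obtain ⟨s, hs⟩ := hv.exists_lt h
      have e4 : baileyVec s v 0 = v 0 + (v 0 - ∑ i ∈ s.1, v i) :=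
        if_pos (Finset.mem_insert_self _ _)
      obtain ⟨g, hg, k⟩ := ih (baileyVec s v) (isLineClass_baileyVec s hv)
        (by rw [e4]; push_cast at hn; omega)
      refine ⟨g * bailey s, mul_mem hg (bailey_mem s), fun p => ?_⟩
      rw [Perm.mul_apply, k, classForm_bailey, baileyVec_involutive]

/-- Parameters with prescribed `h₀, …, h₆`. -/
def BParams.ofH (h : Fin 7 → ℤ) : BParams :=
  ⟨⟨2 + 3 * h 0 - ∑ j ∈ Finset.univ.erase (0 : Fin 7), h j, h⟩, rfl⟩

theorem classForm_injective {v w : Fin 7 → ℤ} (h : ∀ p, classForm v p = classForm w p) : v = w := by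
  funext i
  have h0 := h (BParams.ofH fun j => if j = 0 then 3 else 1)
  have hi := h (BParams.ofH fun j => if j = 0 then 2 else if j = i then 2 else 1)
  simp only [classForm, BParams.ofH, sum_erase_zero] at h0 hi
  fin_cases i <;> simp at h0 hi ⊢ <;> omega

/-- The stabiliser of the form `h₀ - 2` consists of the permutations of `h₁, …, h₆`: at the point
where `h₀` is large and the `h_j` are `1`, the only zeros among the 27 numbers are the
`h_j - 1`. -/
theorem exists_relabel {g : Perm BParams} (hg : g ∈ transGroup)
    (h : ∀ p, (g p).1.h 0 = p.1.h 0) : ∃ σ, g = relabel σ := by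
  obtain ⟨π, -, i⟩ := exists_induces_of_mem hg
  set P : BParams := BParams.ofH fun j => if j = 0 then 102 else 1 with hP
  have hP0 : P.1.h 0 = 102 := rfl
  have hPj : ∀ j : Fin 7, j ≠ 0 → P.1.h j = 1 := fun j hj => if_neg hj
  have hPm : P.1.hm = 302 := by decide +kernel
  have hPx : ∀ x : Label, 0 ≤ eVal P.1 x := by
    rintro (⟨j, k, hjk⟩ | ⟨j, hj⟩)
    · have hk : k ≠ 0 := Fin.pos_iff_ne_zero.1 (lt_of_le_of_lt (Fin.zero_le j) hjk)
      rcases eq_or_ne j 0 with rfl | hj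
      · simp [eVal, hPj k hk]
      · simp [eVal, hj, hPj k hk, hPj j hj, hP0]
    · simp [eVal, hPj j hj, hP0, hPm]
  set q := g⁻¹ P with hq
  have hgq : g q = P := perm_apply_inv g P
  have hq0 : q.1.h 0 = 102 := by rw [← h q, hgq, hP0]
  have hqm : q.1.hm = 302 := by rw [← trans_hm hg q, hgq, hPm]
  have hqx : ∀ j : Fin 7, ∀ hj : 0 < j, 1 ≤ q.1.h j := by
    intro j hj
    have h1 := i q (.e 0 j hj)
    have h2 := hPx (π (.e 0 j hj))
    rw [hgq] at h1
    rw [h1] at h2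
    simpa [eVal] using h2
  -- the balancing condition fixes the sum of the six numbers `h_j ≥ 1`
  have hqj : ∀ j : Fin 7, ∀ hj : 0 < j, q.1.h j = 1 := by
    have hb := q.2
    rw [HParams.Balanced, sum_erase_zero, hq0, hqm] at hb
    have h1 := hqx 1 (by decide)
    have h2 := hqx 2 (by decide)
    have h3 := hqx 3 (by decide)
    have h4 := hqx 4 (by decide)
    have h5 := hqx 5 (by decide)
    have h6 := hqx 6 (by decide)
    intro j hj
    fin_cases j
    · exact absurd hj (by decide)
    all_goals simp only [Fin.reduceFinMk]; omega
  have key : ∀ j : Fin 7, ∀ hj : 0 < j, ∃ k : Fin 7, ∃ hk : 0 < k, π (.e 0 j hj) = .e 0 k hk := by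
    intro j hj
    have h1 := i q (.e 0 j hj)
    rw [hgq] at h1
    have h2 : eVal q.1 (.e 0 j hj) = 0 := by simp [eVal, hqj j hj]
    rw [h2] at h1
    rcases hx : π (.e 0 j hj) with ⟨a, b, hab⟩ | ⟨a, ha⟩
    · rw [hx] at h1
      have hb : b ≠ 0 := Fin.pos_iff_ne_zero.1 (lt_of_le_of_lt (Fin.zero_le a) hab)
      rcases eq_or_ne a 0 with rfl | ha
      · exact ⟨b, hab, rfl⟩
      · simp [eVal, ha, hPj b hb, hPj a ha, hP0] at h1
    · rw [hx] at h1
      simp [eVal, hPj a ha, hP0, hPm] at h1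
  choose f hf0 hf using key
  set F : Fin 7 → Fin 7 := fun j => if hj : 0 < j then f j hj else 0 with hF
  have hFj : ∀ j : Fin 7, ∀ hj : 0 < j, F j = f j hj := fun j hj => dif_pos hj
  have hF0 : F 0 = 0 := dif_neg (by decide)
  have hinj : Function.Injective F := by
    intro j k hjk
    rcases (Fin.zero_le j).eq_or_lt with rfl | hj
    · rcases (Fin.zero_le k).eq_or_lt with rfl | hk
      · rfl
      · rw [hF0, hFj k hk] at hjk
        exact absurd hjk (hf0 k hk).ne
    · rcases (Fin.zero_le k).eq_or_lt with rfl | hk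
      · rw [hF0, hFj j hj] at hjk
        exact absurd hjk.symm (hf0 j hj).ne
      · have h1 : π (.e 0 j hj) = π (.e 0 k hk) := by
          rw [hf, hf]
          congr 1
          rw [← hFj j hj, ← hFj k hk, hjk]
        have := π.injective h1
        simpa using this
  refine ⟨⟨Equiv.ofBijective F (Finite.injective_iff_bijective.1 hinj), hF0⟩, ?_⟩
  ext1 p
  refine BParams.ext_h (funext fun j => ?_)
  obtain ⟨k, rfl⟩ := (Finite.injective_iff_bijective.1 hinj).2 j
  have e1 := relabel_h ⟨Equiv.ofBijective F (Finite.injective_iff_bijective.1 hinj), hF0⟩ p k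
  simp only [Equiv.ofBijective_apply] at e1
  rw [e1]
  rcases (Fin.zero_le k).eq_or_lt with rfl | hk
  · rw [hF0, h]
  · have := i p (.e 0 k hk)
    rw [hf] at this
    simp only [eVal, if_true] at this
    rw [hFj k hk]
    omega

theorem card_idxPerm : Nat.card IdxPerm = 720 := by
  have e : IdxPerm ≃ Perm {j : Fin 7 // j ≠ 0} :=
    (Equiv.subtypeEquivRight fun σ => by simp).trans
      (Equiv.Perm.subtypeEquivSubtypePerm fun j : Fin 7 => j ≠ 0).symm
  rw [Nat.card_congr e, Nat.card_eq_fintype_card, Fintype.card_perm]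
  rfl

theorem card_transGroup : Nat.card transGroup = 51840 := by
  have h : ∀ v : {v : Fin 7 → ℤ // IsLineClass v},
      ∃ g ∈ transGroup, ∀ p, (g p).1.h 0 - 2 = classForm v.1 p := fun v =>
    IsLineClass.exists_trans (v.1 0).toNat v.1 v.2
      (by rw [Int.toNat_of_nonneg]; linarith [v.2.bounds.1.1])
  -- `r v` represents the coset of the transformations that carry `h₀ - 2` to the form of `v`
  choose r hr hrv using h
  have hone : IsLineClass fun j => if j = 0 then 1 else 0 := by
    refine ⟨?_, ?_⟩ <;> rw [sum_erase_zero] <;> simp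
  have hform : ∀ p : BParams, classForm (fun j => if j = 0 then 1 else 0) p = p.1.h 0 - 2 := by
    intro p
    rw [classForm, sum_erase_zero]
    simp
  have hcard : Nat.card ({v : Fin 7 → ℤ // IsLineClass v} × IdxPerm) = Nat.card transGroup := by
    refine Nat.card_eq_of_bijective
      (fun x => ⟨relabel x.2 * r x.1, mul_mem (relabel_mem _) (hr _)⟩) ⟨?_, ?_⟩
    · rintro ⟨v, σ⟩ ⟨w, τ⟩ hvw
      have h1 : relabel σ * r v = relabel τ * r w := congrArg Subtype.val hvw
      have h2 : v = w := by
        refine Subtype.ext (classForm_injective fun p => ?_)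
        have h3 := congrArg (fun g : Perm BParams => (g p).1.h 0) h1
        simp only [Perm.mul_apply, relabel_h_zero] at h3
        rw [← hrv, ← hrv, h3]
      subst h2
      rw [relabel_injective (mul_right_cancel h1)]
    · rintro ⟨g, hg⟩
      obtain ⟨v, hv, k⟩ := exists_classForm hg _ hone
      obtain ⟨σ, hσ⟩ := exists_relabel (mul_mem hg (inv_mem (hr ⟨v, hv⟩))) fun p => by
        have h1 := k ((r ⟨v, hv⟩)⁻¹ p)
        have h2 := hrv ⟨v, hv⟩ ((r ⟨v, hv⟩)⁻¹ p)
        rw [perm_apply_inv] at h2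
        rw [hform, ← h2] at h1
        rw [Perm.mul_apply]
        linarith
      refine ⟨(⟨v, hv⟩, σ), Subtype.ext ?_⟩
      simp only
      rw [← hσ, inv_mul_cancel_right]
  rw [← hcard, Nat.card_prod, card_isLineClass, card_idxPerm]

theorem card_permGroup : Nat.card permGroup = 51840 := by
  obtain ⟨Φ, -⟩ := exists_mulEquiv
  rw [← Nat.card_congr Φ.toEquiv, card_transGroup]

/-! ### The trivial subgroup as a semidirect product -/

/-- The odd indices in increasing order. -/
def oi : Fin 3 → Fin 7 := ![1, 3, 5]

/-- The even indices in decreasing order, so that `ei i = 7 - oi i`. -/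
def ei : Fin 3 → Fin 7 := ![6, 4, 2]

/-- The parameters with given `h₀`, given `h₁, h₃, h₅` and given `h₆, h₄, h₂`. -/
def ofCoords (n : ℤ) (A B : Fin 3 → ℤ) : BParams :=
  BParams.ofH ![n, A 0, B 2, A 1, B 1, A 2, B 0]

@[simp] theorem ofCoords_zero (n : ℤ) (A B : Fin 3 → ℤ) : (ofCoords n A B).1.h 0 = n := rfl

@[simp] theorem ofCoords_oi (n : ℤ) (A B : Fin 3 → ℤ) (i : Fin 3) :
    (ofCoords n A B).1.h (oi i) = A i := by fin_cases i <;> rfl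

@[simp] theorem ofCoords_ei (n : ℤ) (A B : Fin 3 → ℤ) (i : Fin 3) :
    (ofCoords n A B).1.h (ei i) = B i := by fin_cases i <;> rfl

theorem BParams.ext_coords {p q : BParams} (h0 : p.1.h 0 = q.1.h 0)
    (ho : ∀ i, p.1.h (oi i) = q.1.h (oi i)) (he : ∀ i, p.1.h (ei i) = q.1.h (ei i)) : p = q := by
  refine BParams.ext_h (funext fun j => ?_)
  fin_cases j
  exacts [h0, ho 0, he 2, ho 1, he 1, ho 2, he 0]

/-- The numbers `0, α, α + β`, where `α = 1 + h₀ - h₁ - h₃ - h₅` and `β = 1 + h₀ - h₂ - h₄ - h₆`.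
Up to shifts they are both `-b₁, -b₃, -b₅` and `b₆, b₄, b₂`. -/
def shiftVec (p : BParams) : Fin 3 → ℤ :=
  ![0, 1 + p.1.h 0 - (p.1.h 1 + p.1.h 3 + p.1.h 5),
    2 + 2 * p.1.h 0 - (p.1.h 1 + p.1.h 3 + p.1.h 5) - (p.1.h 2 + p.1.h 4 + p.1.h 6)]

theorem sum_perm_three (x : Perm (Fin 3)) (f : Fin 3 → ℤ) :
    f (x 0) + f (x 1) + f (x 2) = f 0 + f 1 + f 2 := by
  rw [← Fin.sum_univ_three, ← Fin.sum_univ_three (fun i => f (x i))]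
  exact Equiv.sum_comp x f

theorem shiftVec_ofCoords (n : ℤ) (A B : Fin 3 → ℤ) : shiftVec (ofCoords n A B) =
    ![0, 1 + n - (A 0 + A 1 + A 2), 2 + 2 * n - (A 0 + A 1 + A 2) - (B 0 + B 1 + B 2)] := by
  funext i
  fin_cases i
  · rfl
  · rfl
  · change 2 + 2 * n - (A 0 + A 1 + A 2) - (B 2 + B 1 + B 0) = _
    simp
    ring

/-- The transformation which permutes `h₁, h₃, h₅` by `x`, `h₆, h₄, h₂` by `y`,
    and the three numbers
`shiftVec` by `z`, up to a common shift. -/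
def tri (w : Perm (Fin 3) × Perm (Fin 3) × Perm (Fin 3)) (p : BParams) : BParams :=
  ofCoords (p.1.h 0 + shiftVec p (w.2.2⁻¹ 0) + (shiftVec p 2 - shiftVec p (w.2.2⁻¹ 2)))
    (fun i => p.1.h (oi (w.1⁻¹ i)) + shiftVec p (w.2.2⁻¹ 0))
    (fun i => p.1.h (ei (w.2.1⁻¹ i)) + (shiftVec p 2 - shiftVec p (w.2.2⁻¹ 2)))

theorem shiftVec_tri (w : Perm (Fin 3) × Perm (Fin 3) × Perm (Fin 3)) (p : BParams) (i : Fin 3) :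
    shiftVec (tri w p) i = shiftVec p (w.2.2⁻¹ i) - shiftVec p (w.2.2⁻¹ 0) := by
  have h1 := sum_perm_three w.1⁻¹ fun i => p.1.h (oi i)
  have h2 := sum_perm_three w.2.1⁻¹ fun i => p.1.h (ei i)
  have h3 := sum_perm_three w.2.2⁻¹ (shiftVec p)
  have h4 : shiftVec p 0 + shiftVec p 1 + shiftVec p 2 = shiftVec p 1 + shiftVec p 2 := by
    simp [shiftVec]
  have h5 : shiftVec p 1 = 1 + p.1.h 0 - (p.1.h (oi 0) + p.1.h (oi 1) + p.1.h (oi 2)) := rfl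
  have h6 : shiftVec p 2 = 2 + 2 * p.1.h 0 - (p.1.h (oi 0) + p.1.h (oi 1) + p.1.h (oi 2)) -
      (p.1.h (ei 0) + p.1.h (ei 1) + p.1.h (ei 2)) := by
    simp [shiftVec, oi, ei]; ring
  rw [tri, shiftVec_ofCoords]
  fin_cases i
  · exact (sub_self _).symm
  · simp only [Fin.mk_one, Matrix.cons_val]
    linarith
  · simp only [Fin.reduceFinMk, Matrix.cons_val]
    linarith

theorem tri_mul (w w' : Perm (Fin 3) × Perm (Fin 3) × Perm (Fin 3)) (p : BParams) :
    tri (w * w') p = tri w (tri w' p) := by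
  refine BParams.ext_coords ?_ (fun i => ?_) fun i => ?_
  · rw [tri, tri]
    simp only [ofCoords_zero, shiftVec_tri, Prod.snd_mul, mul_inv_rev, Perm.mul_apply]
    rw [tri, ofCoords_zero]
    ring
  · rw [tri, tri]
    simp only [ofCoords_oi, shiftVec_tri, Prod.fst_mul, Prod.snd_mul, mul_inv_rev, Perm.mul_apply]
    rw [tri, ofCoords_oi]
    ring
  · rw [tri, tri]
    simp only [ofCoords_ei, shiftVec_tri, Prod.fst_mul, Prod.snd_mul, mul_inv_rev, Perm.mul_apply]
    rw [tri, ofCoords_ei]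
    ring

theorem tri_one (p : BParams) : tri 1 p = p := by
  refine BParams.ext_coords ?_ (fun i => ?_) fun i => ?_ <;> simp [tri] <;> rfl

/-- The action of `𝔖₃³` on the parameters. -/
def triHom : Perm (Fin 3) × Perm (Fin 3) × Perm (Fin 3) →* Perm BParams where
  toFun w := ⟨tri w, tri w⁻¹, fun p => by rw [← tri_mul, inv_mul_cancel, tri_one],
    fun p => by rw [← tri_mul, mul_inv_cancel, tri_one]⟩
  map_one' := Equiv.ext tri_one
  map_mul' w w' := Equiv.ext (tri_mul w w')

theorem triHom_apply (w : Perm (Fin 3) × Perm (Fin 3) × Perm (Fin 3)) (p : BParams) :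
    triHom w p = tri w p := rfl

theorem hSwap_h {j k : Fin 7} (hj : 0 ≠ j) (hk : 0 ≠ k) (p : BParams) (i : Fin 7) :
    (hSwap j k hj hk p).1.h i = p.1.h (swap j k i) := rfl

theorem hFlip_oi (p : BParams) (i : Fin 3) : (hFlip p).1.h (oi i) = p.1.h (ei i) := by
  fin_cases i <;> rfl

theorem hFlip_ei (p : BParams) (i : Fin 3) : (hFlip p).1.h (ei i) = p.1.h (oi i) := by
  fin_cases i <;> rfl

theorem hFlip_zero (p : BParams) : (hFlip p).1.h 0 = p.1.h 0 := rfl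

theorem hFlip_hFlip (p : BParams) : hFlip (hFlip p) = p :=
  BParams.ext_coords rfl (fun i => by rw [hFlip_oi, hFlip_ei]) fun i => by rw [hFlip_ei, hFlip_oi]

theorem shiftVec_hFlip (p : BParams) (i : Fin 3) :
    shiftVec (hFlip p) i = shiftVec p 2 - shiftVec p (swap 0 2 i) := by
  have h (j k : Fin 7) (hj : flipIdx j = k) : (hFlip p).1.h k = p.1.h j := by
    subst hj; exact relabel_h _ p j
  have e0 := h 0 0 (by decide)
  have e1 := h 6 1 (by decide)
  have e2 := h 5 2 (by decide)
  have e3 := h 4 3 (by decide)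
  have e4 := h 3 4 (by decide)
  have e5 := h 2 5 (by decide)
  have e6 := h 1 6 (by decide)
  have t : (swap 0 2 : Perm (Fin 3)) 0 = 2 ∧ (swap 0 2 : Perm (Fin 3)) 1 = 1 ∧
      (swap 0 2 : Perm (Fin 3)) 2 = 0 := by decide
  fin_cases i <;> simp [shiftVec, e0, e1, e2, e3, e4, e5, e6, t] <;> ring

theorem hFlip_tri (x y z : Perm (Fin 3)) (p : BParams) :
    hFlip (tri (x, y, z) p) = tri (y, x, swap 0 2 * z * swap 0 2) (hFlip p) := by
  have h0 : shiftVec p 0 = 0 := rfl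
  refine BParams.ext_coords ?_ (fun i => ?_) fun i => ?_
  · rw [hFlip_zero, tri, tri]
    simp [shiftVec_hFlip, hFlip_zero, h0]
    ring
  · rw [hFlip_oi, tri, tri]
    simp [shiftVec_hFlip, hFlip_oi]
  · rw [hFlip_ei, tri, tri]
    simp [shiftVec_hFlip, hFlip_ei, h0]

theorem triHom_swap (x y : Perm (Fin 3)) (p : BParams) : triHom (x, y, 1) p =
    ofCoords (p.1.h 0) (fun i => p.1.h (oi (x⁻¹ i))) fun i => p.1.h (ei (y⁻¹ i)) := by
  have : shiftVec p 0 = 0 := rfl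
  rw [triHom_apply, tri]
  simp [this]

theorem triHom_odd_fst : triHom (swap 0 1, 1, 1) = hSwap 1 3 (by decide) (by decide) := by
  ext1 p
  rw [triHom_swap]
  exact BParams.ext_h (funext fun j => by fin_cases j <;> rfl)

theorem triHom_odd_snd : triHom (swap 1 2, 1, 1) = hSwap 3 5 (by decide) (by decide) := by
  ext1 p
  rw [triHom_swap]
  exact BParams.ext_h (funext fun j => by fin_cases j <;> rfl)

theorem triHom_even_fst : triHom (1, swap 0 1, 1) = hSwap 6 4 (by decide) (by decide) := by
  ext1 p
  rw [triHom_swap]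
  exact BParams.ext_h (funext fun j => by fin_cases j <;> rfl)

theorem triHom_even_snd : triHom (1, swap 1 2, 1) = hSwap 4 2 (by decide) (by decide) := by
  ext1 p
  rw [triHom_swap]
  exact BParams.ext_h (funext fun j => by fin_cases j <;> rfl)

theorem triHom_b135 : triHom (1, 1, swap 0 1) = b135 := by
  ext1 p
  have hs : ∑ i ∈ ({1, 3, 5} : Finset (Fin 7)), p.1.h i = p.1.h 1 + p.1.h 3 + p.1.h 5 := by
    rw [Finset.sum_insert (by decide), Finset.sum_pair (by decide), add_assoc]
  have t : (swap 0 1 : Perm (Fin 3)) 0 = 1 ∧ (swap 0 1 : Perm (Fin 3)) 2 = 2 := by decide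
  refine BParams.ext_coords ?_ (fun i => ?_) fun i => ?_
  · rw [triHom_apply, tri, b135, bailey_h, hs]
    simp [t, shiftVec]
  · rw [triHom_apply, tri, b135, bailey_h, hs]
    have : oi i ∈ insert 0 ({1, 3, 5} : Finset (Fin 7)) := by fin_cases i <;> decide
    rw [if_pos this]
    simp [t, shiftVec]
  · rw [triHom_apply, tri, b135, bailey_h, hs]
    have : ei i ∉ insert 0 ({1, 3, 5} : Finset (Fin 7)) := by fin_cases i <;> decide
    rw [if_neg this]
    simp [t]

theorem triHom_b246 : triHom (1, 1, swap 1 2) = b246 := by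
  ext1 p
  have hs : ∑ i ∈ ({2, 4, 6} : Finset (Fin 7)), p.1.h i = p.1.h 2 + p.1.h 4 + p.1.h 6 := by
    rw [Finset.sum_insert (by decide), Finset.sum_pair (by decide), add_assoc]
  have t : (swap 1 2 : Perm (Fin 3)) 0 = 0 ∧ (swap 1 2 : Perm (Fin 3)) 2 = 1 := by decide
  refine BParams.ext_coords ?_ (fun i => ?_) fun i => ?_
  · rw [triHom_apply, tri, b246, bailey_h, hs]
    simp [t, shiftVec]
    ring
  · rw [triHom_apply, tri, b246, bailey_h, hs]
    have : oi i ∉ insert 0 ({2, 4, 6} : Finset (Fin 7)) := by fin_cases i <;> decide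
    rw [if_neg this]
    simp [t, shiftVec]
  · rw [triHom_apply, tri, b246, bailey_h, hs]
    have : ei i ∈ insert 0 ({2, 4, 6} : Finset (Fin 7)) := by fin_cases i <;> decide
    rw [if_pos this]
    simp [t, shiftVec]
    ring

theorem perm_two (σ : Perm (Fin 2)) : σ = 1 ∨ σ = swap 0 1 := by revert σ; decide

/-- An element `m` with `m² = 1` as the image of the transposition under a homomorphism from
`𝔖₂`. -/
def homPermTwo {M : Type*} [Group M] (m : M) (hm : m * m = 1) : Perm (Fin 2) →* M where
  toFun σ := if σ = 1 then 1 else m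
  map_one' := if_pos rfl
  map_mul' σ τ := by
    have h1 : (swap 0 1 : Perm (Fin 2)) ≠ 1 := by decide
    have h2 : (swap 0 1 : Perm (Fin 2)) * swap 0 1 = 1 := by decide
    rcases perm_two σ with rfl | rfl <;> rcases perm_two τ with rfl | rfl <;> simp [h1, h2, hm]

theorem homPermTwo_swap {M : Type*} [Group M] (m : M) (hm : m * m = 1) :
    homPermTwo m hm (swap 0 1) = m :=
  (if_neg (by decide) : (if (swap 0 1 : Perm (Fin 2)) = 1 then 1 else m) = m)

/-- The automorphism `(x, y, z) ↦ (y, x, τ z τ⁻¹)` of `𝔖₃³`, where `τ` exchanges the first and the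
last point. -/
def flipAut : MulAut (Perm (Fin 3) × Perm (Fin 3) × Perm (Fin 3)) where
  toFun w := (w.2.1, w.1, swap 0 2 * w.2.2 * swap 0 2)
  invFun w := (w.2.1, w.1, swap 0 2 * w.2.2 * swap 0 2)
  left_inv w := by simp [mul_assoc]
  right_inv w := by simp [mul_assoc]
  map_mul' w w' := by simp [mul_assoc]

theorem flipAut_mul_self : flipAut * flipAut = 1 := MulEquiv.ext flipAut.left_inv

theorem hFlip_mul_self : hFlip * hFlip = 1 := Equiv.ext hFlip_hFlip

/-- The action of `𝔖₂` on `𝔖₃³`. -/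
def flipAction : Perm (Fin 2) →* MulAut (Perm (Fin 3) × Perm (Fin 3) × Perm (Fin 3)) :=
  homPermTwo flipAut flipAut_mul_self

/-- The action of the semidirect product `𝔖₃³ ⋊ 𝔖₂` on the parameters. -/
def semiHom : SemidirectProduct (Perm (Fin 3) × Perm (Fin 3) × Perm (Fin 3)) (Perm (Fin 2))
    flipAction →* Perm BParams :=
  SemidirectProduct.lift triHom (homPermTwo hFlip hFlip_mul_self) fun σ => by
    rcases perm_two σ with rfl | rfl
    · rw [map_one, map_one, map_one]
      rfl
    · ext1 w
      change triHom (flipAction (swap 0 1) w) =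
        MulAut.conj (homPermTwo hFlip hFlip_mul_self (swap 0 1)) (triHom w)
      rw [homPermTwo_swap, flipAction, homPermTwo_swap, MulAut.conj_apply, eq_mul_inv_iff_mul_eq]
      ext1 p
      exact (hFlip_tri w.1 w.2.1 w.2.2 p).symm

theorem semiHom_inl (w) : semiHom (.inl w) = triHom w :=
  SemidirectProduct.lift_inl _ _ _ _

theorem semiHom_inr : semiHom (.inr (swap 0 1)) = hFlip :=
  (SemidirectProduct.lift_inr _ _ _ _).trans (homPermTwo_swap _ _)

/-! ### The trivial elements of the group -/

/-- The words in two adjacent transpositions that represent the elements of `𝔖₃`. -/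
theorem perm_three (x : Perm (Fin 3)) : x = 1 ∨ x = swap 0 1 ∨ x = swap 1 2 ∨
    x = swap 0 1 * swap 1 2 ∨ x = swap 1 2 * swap 0 1 ∨ x = swap 0 1 * swap 1 2 * swap 0 1 := by
  revert x; decide

theorem map_perm_three_mem {M : Type*} [Group M] (f : Perm (Fin 3) →* M) {K : Subgroup M}
    (h1 : f (swap 0 1) ∈ K) (h2 : f (swap 1 2) ∈ K) (x : Perm (Fin 3)) : f x ∈ K := by
  rcases perm_three x with rfl | rfl | rfl | rfl | rfl | rfl
  · rw [map_one]; exact one_mem K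
  · exact h1
  · exact h2
  · rw [map_mul]; exact mul_mem h1 h2
  · rw [map_mul]; exact mul_mem h2 h1
  · rw [map_mul, map_mul]; exact mul_mem (mul_mem h1 h2) h1

theorem hSwap_comm (j k : Fin 7) (hj : 0 ≠ j) (hk : 0 ≠ k) : hSwap j k hj hk = hSwap k j hk hj := by
  ext1 p
  refine BParams.ext_h (funext fun i => ?_)
  rw [hSwap_h, hSwap_h, swap_comm]

theorem b246_eq : b246 = hFlip * b135 * hFlip := by
  rw [← triHom_b246, ← triHom_b135]
  ext1 p
  rw [Perm.mul_apply, Perm.mul_apply, triHom_apply, triHom_apply, hFlip_tri, hFlip_hFlip,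
    show (swap 0 2 * swap 0 1 * swap 0 2 : Perm (Fin 3)) = swap 1 2 by decide]

/-- The generators of the group of trivial elements. -/
def trivialGens : Set (Perm BParams) :=
  {hSwap 1 3 (by decide) (by decide), hSwap 3 5 (by decide) (by decide),
    hSwap 2 4 (by decide) (by decide), hSwap 4 6 (by decide) (by decide), b135, hFlip}

theorem closure_trivialGens : Subgroup.closure trivialGens = semiHom.range := by
  have hmem : ∀ g ∈ trivialGens, g ∈ Subgroup.closure trivialGens :=
    fun g hg => Subgroup.subset_closure hg
  have m13 := hmem (hSwap 1 3 (by decide) (by decide)) (by simp [trivialGens])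
  have m35 := hmem (hSwap 3 5 (by decide) (by decide)) (by simp [trivialGens])
  have m24 := hmem (hSwap 2 4 (by decide) (by decide)) (by simp [trivialGens])
  have m46 := hmem (hSwap 4 6 (by decide) (by decide)) (by simp [trivialGens])
  have mb := hmem b135 (by simp [trivialGens])
  have mf := hmem hFlip (by simp [trivialGens])
  refine le_antisymm ?_ ?_
  · rw [Subgroup.closure_le]
    rintro g (rfl | rfl | rfl | rfl | rfl | rfl)
    · exact ⟨_, (semiHom_inl _).trans triHom_odd_fst⟩
    · exact ⟨_, (semiHom_inl _).trans triHom_odd_snd⟩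
    · rw [hSwap_comm]
      exact ⟨_, (semiHom_inl _).trans triHom_even_snd⟩
    · rw [hSwap_comm]
      exact ⟨_, (semiHom_inl _).trans triHom_even_fst⟩
    · exact ⟨_, (semiHom_inl _).trans triHom_b135⟩
    · exact ⟨_, semiHom_inr⟩
  · have h1 : ∀ w, triHom w ∈ Subgroup.closure trivialGens := by
      rintro ⟨x, y, z⟩
      have e : ((x, y, z) : Perm (Fin 3) × Perm (Fin 3) × Perm (Fin 3)) =
          (x, 1, 1) * (1, y, 1) * (1, 1, z) := by simp
      rw [e, map_mul, map_mul]
      refine mul_mem (mul_mem ?_ ?_) ?_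
      · refine map_perm_three_mem (triHom.comp (MonoidHom.inl _ _)) ?_ ?_ x
        · exact triHom_odd_fst ▸ m13
        · exact triHom_odd_snd ▸ m35
      · refine map_perm_three_mem (triHom.comp ((MonoidHom.inr _ _).comp (MonoidHom.inl _ _)))
          ?_ ?_ y
        · rw [hSwap_comm] at m46
          exact triHom_even_fst ▸ m46
        · rw [hSwap_comm] at m24
          exact triHom_even_snd ▸ m24
      · refine map_perm_three_mem (triHom.comp ((MonoidHom.inr _ _).comp (MonoidHom.inr _ _)))
          ?_ ?_ z
        · exact triHom_b135 ▸ mb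
        · have := mul_mem (mul_mem mf mb) mf
          rw [← b246_eq, ← triHom_b246] at this
          exact this
    rintro _ ⟨⟨w, σ⟩, rfl⟩
    rw [← SemidirectProduct.inl_left_mul_inr_right ⟨w, σ⟩, map_mul, semiHom_inl]
    refine mul_mem (h1 w) ?_
    rcases perm_two σ with rfl | rfl
    · rw [map_one, map_one]
      exact one_mem _
    · rw [semiHom_inr]
      exact mf

/-- The semidirect product acts faithfully: its action on one generic parameter set is free. -/
theorem semiHom_injective : Function.Injective semiHom := by
  have c1 : shiftVec genericPoint = ![0, 979, 1937] := by decide +kernel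
  have c2 : shiftVec (hFlip genericPoint) = ![0, 958, 1937] := by decide +kernel
  have ho : ∀ i, genericPoint.1.h (oi i) = ![2, 5, 17] i := by decide +kernel
  have he : ∀ i, genericPoint.1.h (ei i) = ![33, 9, 3] i := by decide +kernel
  have kz : ∀ z : Perm (Fin 3), (∀ i, (![0, 979, 1937] i : ℤ) =
      ![0, 979, 1937] (z i) - ![0, 979, 1937] (z 0)) → z = 1 := by decide +kernel
  have kf : ∀ z : Perm (Fin 3), ¬∀ i, (![0, 979, 1937] i : ℤ) =
      ![0, 958, 1937] (z i) - ![0, 958, 1937] (z 0) := by decide +kernel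
  have ko : ∀ x : Perm (Fin 3), (∀ i, (![2, 5, 17] i : ℤ) = ![2, 5, 17] (x i)) → x = 1 := by
    decide +kernel
  have ke : ∀ x : Perm (Fin 3), (∀ i, (![33, 9, 3] i : ℤ) = ![33, 9, 3] (x i)) → x = 1 := by
    decide +kernel
  rw [injective_iff_map_eq_one]
  rintro ⟨⟨x, y, z⟩, σ⟩ h
  rw [← SemidirectProduct.inl_left_mul_inr_right ⟨(x, y, z), σ⟩, map_mul, semiHom_inl] at h
  rcases perm_two σ with rfl | rfl
  · rw [map_one, map_one, mul_one] at h
    have hp : genericPoint = triHom (x, y, z) genericPoint := by simp only [h]; rfl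
    have hz := kz z⁻¹ fun i => by
      rw [← c1, ← shiftVec_tri (x, y, z) genericPoint i, ← triHom_apply, ← hp]
    obtain rfl := inv_eq_one.1 hz
    rw [triHom_swap] at hp
    have hx := ko x⁻¹ fun i => by rw [← ho, ← ho, hp, ofCoords_oi, ← hp]
    have hy := ke y⁻¹ fun i => by rw [← he, ← he, hp, ofCoords_ei, ← hp]
    rw [inv_eq_one] at hx hy
    rw [hx, hy]
    rfl
  · rw [semiHom_inr] at h
    have hp : genericPoint = triHom (x, y, z) (hFlip genericPoint) := by
      rw [← Perm.mul_apply]; simp only [h]; rfl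
    refine absurd (fun i => ?_) (kf z⁻¹)
    rw [← c1, ← c2, ← shiftVec_tri (x, y, z) (hFlip genericPoint) i, ← triHom_apply, ← hp]

/-- The relation between `(𝐚, 𝐛)` and `(𝐚', 𝐛')` generated by the trivial transformations other
than the involution. -/
def ABRel (q q' : ABParams) : Prop :=
  ∃ (m n : ℤ) (x y z w : Perm (Fin 3)), q'.a 0 = q.a 0 + m + n ∧ q'.b 0 = q.b 0 + m + n ∧
    ∀ i, q'.a (oi i) = q.a (oi (x i)) + m ∧ q'.a (ei i) = q.a (ei (y i)) + n ∧
      q'.b (oi i) = q.b (oi (z i)) + m ∧ q'.b (ei i) = q.b (ei (w i)) + n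

theorem ABRel.refl (q : ABParams) : ABRel q q :=
  ⟨0, 0, 1, 1, 1, 1, by simp, by simp, fun i => by simp⟩

theorem ABRel.symm {q q' : ABParams} (h : ABRel q q') : ABRel q' q := by
  obtain ⟨m, n, x, y, z, w, ha, hb, h⟩ := h
  refine ⟨-m, -n, x⁻¹, y⁻¹, z⁻¹, w⁻¹, by linarith, by linarith, fun i => ⟨?_, ?_, ?_, ?_⟩⟩
  · have := (h (x⁻¹ i)).1
    rw [perm_apply_inv] at this
    linarith
  · have := (h (y⁻¹ i)).2.1
    rw [perm_apply_inv] at this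
    linarith
  · have := (h (z⁻¹ i)).2.2.1
    rw [perm_apply_inv] at this
    linarith
  · have := (h (w⁻¹ i)).2.2.2
    rw [perm_apply_inv] at this
    linarith

theorem ABRel.trans {q q' q'' : ABParams} (h : ABRel q q') (h' : ABRel q' q'') : ABRel q q'' := by
  obtain ⟨m, n, x, y, z, w, ha, hb, h⟩ := h
  obtain ⟨m', n', x', y', z', w', ha', hb', h'⟩ := h'
  refine ⟨m + m', n + n', x * x', y * y', z * z', w * w', by linarith, by linarith,
    fun i => ⟨?_, ?_, ?_, ?_⟩⟩
  · rw [(h' i).1, (h (x' i)).1, Perm.mul_apply]; ring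
  · rw [(h' i).2.1, (h (y' i)).2.1, Perm.mul_apply]; ring
  · rw [(h' i).2.2.1, (h (z' i)).2.2.1, Perm.mul_apply]; ring
  · rw [(h' i).2.2.2, (h (w' i)).2.2.2, Perm.mul_apply]; ring

/-- The involution `a_j ↔ a_{7-j}`, `b_j ↔ b_{7-j}`. -/
def abFlip (q : ABParams) : ABParams := ⟨q.a ∘ flipIdx, q.b ∘ flipIdx⟩

theorem abFlip_abFlip (q : ABParams) : abFlip (abFlip q) = q := by
  have h1 : ∀ j, flipIdx (flipIdx j) = j := by decide
  ext j <;> simp [abFlip, h1]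

theorem flipIdx_oi (i : Fin 3) : flipIdx (oi i) = ei i := by revert i; decide

theorem flipIdx_ei (i : Fin 3) : flipIdx (ei i) = oi i := by revert i; decide

theorem flipIdx_zero : flipIdx 0 = 0 := by decide

theorem ABRel.flip {q q' : ABParams} (h : ABRel q q') : ABRel (abFlip q) (abFlip q') := by
  obtain ⟨m, n, x, y, z, w, ha, hb, h⟩ := h
  refine ⟨n, m, y, x, w, z, ?_, ?_, fun i => ?_⟩
  · simp only [abFlip, Function.comp_apply, flipIdx_zero]; linarith
  · simp only [abFlip, Function.comp_apply, flipIdx_zero]; linarith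
  · simp only [abFlip, Function.comp_apply, flipIdx_oi, flipIdx_ei]
    obtain ⟨h1, h2, h3, h4⟩ := h i
    exact ⟨h2, h1, h4, h3⟩

theorem oi_injective : Function.Injective oi := by decide

theorem ei_injective : Function.Injective ei := by decide

theorem KeepsParity.exists_perm {σ : Perm (Fin 7)} (h : KeepsParity σ) :
    (∃ x : Perm (Fin 3), ∀ i, σ (oi i) = oi (x i)) ∧ ∃ y : Perm (Fin 3), ∀ i, σ (ei i) = ei (y i) :=
      by
  have ho : ∀ j : Fin 7, j ∈ ({1, 3, 5} : Finset (Fin 7)) ↔ ∃ i, j = oi i := by decide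
  have he : ∀ j : Fin 7, j ∈ ({2, 4, 6} : Finset (Fin 7)) ↔ ∃ i, j = ei i := by decide
  have h1 := fun i => (ho _).1 (h.2.1 _ ((ho (oi i)).2 ⟨i, rfl⟩))
  have h2 := fun i => (he _).1 (h.2.2 _ ((he (ei i)).2 ⟨i, rfl⟩))
  choose f hf using h1
  choose g hg using h2
  have i1 : Function.Injective f := fun i j hij => by
    apply oi_injective
    apply σ.injective
    rw [hf, hf, hij]
  have i2 : Function.Injective g := fun i j hij => by
    apply ei_injective
    apply σ.injective
    rw [hg, hg, hij]
  exact ⟨⟨Equiv.ofBijective f (Finite.injective_iff_bijective.1 i1), hf⟩,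
    ⟨Equiv.ofBijective g (Finite.injective_iff_bijective.1 i2), hg⟩⟩

/-- A normal form for the trivial transformations. -/
theorem abRel_of_mem {τ : Perm ABParams} (h : τ ∈ abTrivial) (q : ABParams) :
    ABRel q (τ q) ∨ ABRel (abFlip q) (τ q) := by
  induction h using Subgroup.closure_induction generalizing q with
  | mem τ hτ =>
    rcases hτ with (⟨σ, hσ, rfl | rfl⟩ | hτ) | ⟨m, rfl | rfl⟩
    · obtain ⟨⟨x, hx⟩, ⟨y, hy⟩⟩ := hσ.symm.exists_perm
      refine Or.inl ⟨0, 0, x, y, 1, 1, ?_, ?_, fun i => ?_⟩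
      · simp [aPerm, hσ.symm.1]
      · simp [aPerm]
      · simp [aPerm, hx, hy]
    · obtain ⟨⟨x, hx⟩, ⟨y, hy⟩⟩ := hσ.symm.exists_perm
      refine Or.inl ⟨0, 0, 1, 1, x, y, ?_, ?_, fun i => ?_⟩
      · simp [bPerm]
      · simp [bPerm, hσ.symm.1]
      · simp [bPerm, hx, hy]
    · rw [mem_singleton_iff.1 hτ]
      have hs : flipIdx.symm = flipIdx := by decide
      have : (aPerm flipIdx * bPerm flipIdx) q = abFlip q := by
        simp [aPerm, bPerm, abFlip, hs]
      rw [this]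
      exact Or.inr (ABRel.refl _)
    · refine Or.inl ⟨m, 0, 1, 1, 1, 1, ?_, ?_, fun i => ?_⟩
      · simp [abShift]
      · simp [abShift]
      · fin_cases i <;> simp [abShift, oi, ei]
    · refine Or.inl ⟨0, m, 1, 1, 1, 1, ?_, ?_, fun i => ?_⟩
      · simp [abShift]
      · simp [abShift]
      · fin_cases i <;> simp [abShift, oi, ei]
  | one => exact Or.inl (ABRel.refl q)
  | mul τ τ' _ _ h1 h2 =>
    rw [Perm.mul_apply]
    rcases h2 q with h2 | h2 <;> rcases h1 (τ' q) with h1 | h1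
    · exact Or.inl (h2.trans h1)
    · exact Or.inr (h2.flip.trans h1)
    · exact Or.inr (h2.trans h1)
    · have := h2.flip
      rw [abFlip_abFlip] at this
      exact Or.inl (this.trans h1)
  | inv τ _ h =>
    have h1 := h (τ⁻¹ q)
    rw [perm_apply_inv] at h1
    rcases h1 with h1 | h1
    · exact Or.inl h1.symm
    · have := h1.symm.flip
      rw [abFlip_abFlip] at this
      exact Or.inr this

theorem toAB_a (p : BParams) (i : Fin 3) : (toAB p.1).a (oi i) = p.1.h (oi i) ∧
    (toAB p.1).a (ei i) = p.1.h (ei i) := by fin_cases i <;> exact ⟨rfl, rfl⟩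

theorem hm_eq (p : BParams) : p.1.hm = 2 + 3 * p.1.h 0 - (p.1.h 1 + p.1.h 2 + p.1.h 3 + p.1.h 4 +
    p.1.h 5 + p.1.h 6) := by
  have := p.2
  rw [HParams.Balanced, sum_erase_zero] at this
  exact this

/-- The balancing condition makes `b₁, b₃, b₅` and `b₆, b₄, b₂` two copies of the same three numbers
up to a shift and a sign. -/
theorem toAB_b (p : BParams) (i : Fin 3) : (toAB p.1).b (oi i) = 1 - shiftVec p i ∧
    (toAB p.1).b (ei i) = 1 - (shiftVec p 2 - shiftVec p i) := by
  have := hm_eq p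
  fin_cases i <;> simp [toAB, oi, ei, shiftVec] <;> omega

theorem eq_tri_of_abRel {p p' : BParams} (h : ABRel (toAB p.1) (toAB p'.1)) :
    ∃ w, p' = triHom w p := by
  obtain ⟨m, n, x, y, z, w, -, hb, h⟩ := h
  refine ⟨(x⁻¹, y⁻¹, z⁻¹), ?_⟩
  have hb' : p'.1.h 0 = p.1.h 0 + m + n := by
    have : (1 + p'.1.h 0 : ℤ) = 1 + p.1.h 0 + m + n := hb
    linarith
  have ho : ∀ i, p'.1.h (oi i) = p.1.h (oi (x i)) + m := fun i => by
    rw [← (toAB_a p' i).1, ← (toAB_a p _).1, (h i).1]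
  have he : ∀ i, p'.1.h (ei i) = p.1.h (ei (y i)) + n := fun i => by
    rw [← (toAB_a p' i).2, ← (toAB_a p _).2, (h i).2.1]
  have hc : ∀ i, shiftVec p' i = shiftVec p (z i) - m := fun i => by
    have := (h i).2.2.1
    rw [(toAB_b p' i).1, (toAB_b p _).1] at this
    linarith
  have hc0 : shiftVec p' 0 = 0 := rfl
  -- the sum of the first two relations determines the last entry of the vector
  have hc2 : shiftVec p' 2 = shiftVec p 2 - m - n := by
    have h1 := sum_perm_three x fun i => p.1.h (oi i)
    have h2 := sum_perm_three y fun i => p.1.h (ei i)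
    have e : ∀ p : BParams, shiftVec p 2 = 2 + 2 * p.1.h 0 -
        (p.1.h (oi 0) + p.1.h (oi 1) + p.1.h (oi 2)) -
        (p.1.h (ei 0) + p.1.h (ei 1) + p.1.h (ei 2)) := fun p => by
      simp [shiftVec, oi, ei]; ring
    rw [e p', e p, hb']
    simp only [ho, he]
    linarith
  have hm : m = shiftVec p (z 0) := by linarith [hc 0]
  have hn : n = shiftVec p 2 - shiftVec p (z 2) := by linarith [hc 2]
  refine BParams.ext_coords ?_ (fun i => ?_) fun i => ?_
  · rw [hb', triHom_apply, tri, ofCoords_zero, inv_inv, hm, hn]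
  · rw [ho, triHom_apply, tri, ofCoords_oi, inv_inv, inv_inv, hm]
  · rw [he, triHom_apply, tri, ofCoords_ei, inv_inv, inv_inv, hn]

theorem hFlip_hm (p : BParams) : (hFlip p).1.hm = p.1.hm := rfl

theorem abRel_hFlip (p : BParams) : ABRel (abFlip (toAB p.1)) (toAB (hFlip p).1) := by
  refine ⟨0, 0, 1, 1, swap 0 2, swap 0 2, ?_, ?_, fun i => ⟨?_, ?_, ?_, ?_⟩⟩
  · simp [abFlip, flipIdx_zero, toAB, hFlip_zero, hFlip_hm]
  · simp [abFlip, flipIdx_zero, toAB, hFlip_zero]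
  · rw [(toAB_a _ i).1, hFlip_oi, ← (toAB_a p i).2]
    simp [abFlip, flipIdx_oi]
  · rw [(toAB_a _ i).2, hFlip_ei, ← (toAB_a p i).1]
    simp [abFlip, flipIdx_ei]
  · rw [(toAB_b _ i).1, shiftVec_hFlip]
    simp only [abFlip, Function.comp_apply, flipIdx_oi, (toAB_b p _).2]
    ring
  · rw [(toAB_b _ i).2, shiftVec_hFlip, shiftVec_hFlip]
    have t : (swap 0 2 : Perm (Fin 3)) 2 = 0 := by decide
    have h0 : shiftVec p 0 = 0 := rfl
    simp only [abFlip, Function.comp_apply, flipIdx_ei, (toAB_b p _).1, t, h0]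
    ring

/-- Parameter sets whose `(𝐚, 𝐛)` are in the same class differ by an element of the
semidirect product. -/
theorem eq_semiHom_of_abTrivial {p p' : BParams} {τ : Perm ABParams} (hτ : τ ∈ abTrivial)
    (h : toAB p'.1 = τ (toAB p.1)) : ∃ g ∈ semiHom.range, p' = g p := by
  rcases abRel_of_mem hτ (toAB p.1) with h1 | h1
  · rw [← h] at h1
    obtain ⟨w, hw⟩ := eq_tri_of_abRel h1
    exact ⟨_, ⟨.inl w, semiHom_inl w⟩, hw⟩
  · rw [← h] at h1
    obtain ⟨w, hw⟩ := eq_tri_of_abRel ((abRel_hFlip p).symm.trans h1)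
    refine ⟨triHom w * hFlip, ⟨.inl w * .inr (swap 0 1), ?_⟩, hw⟩
    rw [map_mul, semiHom_inl, semiHom_inr]

theorem toAB_b135 (p : BParams) : toAB (b135 p).1 = bPerm (swap 1 3 * swap 4 6)
    (abShift {0, 1, 3, 5} (1 + p.1.h 0 - p.1.h 1 - p.1.h 3 - p.1.h 5) (toAB p.1)) := by
  have hs : ∑ i ∈ ({1, 3, 5} : Finset (Fin 7)), p.1.h i = p.1.h 1 + p.1.h 3 + p.1.h 5 := by
    rw [Finset.sum_insert (by decide), Finset.sum_pair (by decide), add_assoc]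
  have hh := fun j => bailey_h ⟨{1, 3, 5}, by decide⟩ p j
  simp only [hs] at hh
  have hm : (b135 p).1.hm = p.1.hm := rfl
  have hp := hm_eq p
  have hσ : ∀ j, (swap 1 3 * swap 4 6 : Perm (Fin 7)).symm j = ![0, 3, 2, 1, 6, 5, 4] j := by decide
  ext j
  · fin_cases j <;> simp [toAB, bPerm, abShift, b135, hh] <;>
      first | done | (rw [← b135, hm]; ring) | ring
  · simp only [bPerm, Equiv.coe_fn_mk, Function.comp_apply, hσ]
    fin_cases j <;> simp [toAB, abShift, b135, hh] <;>
      first | done | (rw [← b135, hm]; omega) | omega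

theorem aPerm_mem {σ : Perm (Fin 7)} (h : KeepsParity σ) : aPerm σ ∈ abTrivial :=
  Subgroup.subset_closure (Or.inl (Or.inl ⟨σ, h, Or.inl rfl⟩))

theorem bPerm_mem {σ : Perm (Fin 7)} (h : KeepsParity σ) : bPerm σ ∈ abTrivial :=
  Subgroup.subset_closure (Or.inl (Or.inl ⟨σ, h, Or.inr rfl⟩))

theorem b135_mem_trivialSubgroup : b135 ∈ trivialSubgroup :=
  ⟨bailey_mem _, fun p => ⟨_, mul_mem (bPerm_mem (by unfold KeepsParity; decide))
    (Subgroup.subset_closure (Or.inr ⟨_, Or.inl rfl⟩)), toAB_b135 p⟩⟩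

theorem toAB_hFlip (p : BParams) : toAB (hFlip p).1 =
    (bPerm (swap 1 5 * swap 2 6) * (aPerm flipIdx * bPerm flipIdx)) (toAB p.1) := by
  have hh : ∀ j k, flipIdx k = j → (hFlip p).1.h j = p.1.h k := fun j k h => by
    subst h; exact relabel_h _ p k
  have hf : ∀ j, flipIdx.symm j = ![0, 6, 5, 4, 3, 2, 1] j := by decide
  have hσ : ∀ j, (swap 1 5 * swap 2 6 : Perm (Fin 7)).symm j = ![0, 5, 6, 3, 4, 1, 2] j := by
    decide
  simp only [toAB, Perm.mul_apply, aPerm, bPerm, Equiv.coe_fn_mk, hFlip_hm, hFlip_zero,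
    hh 1 6 (by decide), hh 2 5 (by decide), hh 3 4 (by decide), hh 4 3 (by decide),
    hh 5 2 (by decide), hh 6 1 (by decide)]
  refine ABParams.ext (funext fun j => ?_) (funext fun j => ?_)
  · simp only [Function.comp_apply, hf]
    fin_cases j <;> simp
  · simp only [Function.comp_apply, hf, hσ]
    fin_cases j <;> simp <;> ring

/-- The involution also exchanges `b₁` with `b₅` and `b₂` with `b₆`. -/
theorem hFlip_mem_trivialSubgroup : hFlip ∈ trivialSubgroup :=
  ⟨relabel_mem _, fun p => ⟨_, mul_mem (bPerm_mem (by unfold KeepsParity; decide))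
    (Subgroup.subset_closure (Or.inl (Or.inr rfl))), toAB_hFlip p⟩⟩

theorem trivialGens_subset : trivialGens ⊆ trivialSubgroup := by
  have hs (j k : Fin 7) (hj : 0 ≠ j) (hk : 0 ≠ k) (hσ : KeepsParity (swap j k))
      (ho : ∀ h : Fin 7 → ℤ, h (swap j k 1) + h (swap j k 3) + h (swap j k 5) = h 1 + h 3 + h 5)
      (he : ∀ h : Fin 7 → ℤ, h (swap j k 2) + h (swap j k 4) + h (swap j k 6) = h 2 + h 4 + h 6) :
      hSwap j k hj hk ∈ trivialSubgroup := by
    refine ⟨relabel_mem _, fun p => ⟨_, aPerm_mem hσ, ?_⟩⟩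
    have h0 : swap j k 0 = 0 := hσ.1
    have hm : (hSwap j k hj hk p).1.hm = p.1.hm := rfl
    simp only [toAB, aPerm, Equiv.coe_fn_mk, symm_swap, hSwap_h, hm, ho p.1.h, he p.1.h, h0]
    refine ABParams.ext (funext fun i => ?_) rfl
    have hA : ∀ i, (![1 + p.1.h 0 - p.1.hm, p.1.h 1, p.1.h 2, p.1.h 3, p.1.h 4, p.1.h 5, p.1.h 6] :
        Fin 7 → ℤ) i = if i = 0 then 1 + p.1.h 0 - p.1.hm else p.1.h i := fun i => by
      fin_cases i <;> rfl
    simp only [Function.comp_apply]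
    rw [hA (swap j k i)]
    fin_cases i
    · rw [Fin.zero_eta, h0]; rfl
    all_goals
      rw [if_neg fun h => by rw [swap_apply_eq_iff, h0] at h; exact absurd h (by decide)]
      rfl
  rintro g (rfl | rfl | rfl | rfl | rfl | rfl)
  · exact hs 1 3 _ _ (by unfold KeepsParity; decide) (fun h => by simp [swap_apply_def]; ring)
      (fun h => by simp [swap_apply_def])
  · exact hs 3 5 _ _ (by unfold KeepsParity; decide) (fun h => by simp [swap_apply_def]; ring)
      (fun h => by simp [swap_apply_def])
  · exact hs 2 4 _ _ (by unfold KeepsParity; decide) (fun h => by simp [swap_apply_def])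
      (fun h => by simp [swap_apply_def]; ring)
  · exact hs 4 6 _ _ (by unfold KeepsParity; decide) (fun h => by simp [swap_apply_def])
      (fun h => by simp [swap_apply_def]; ring)
  · exact b135_mem_trivialSubgroup
  · exact hFlip_mem_trivialSubgroup

theorem trivialSubgroup_eq : trivialSubgroup = semiHom.range := by
  refine le_antisymm ?_ ?_
  · rintro g ⟨hg, h⟩
    obtain ⟨τ, hτ, h1⟩ := h genericPoint
    obtain ⟨k, hk, h2⟩ := eq_semiHom_of_abTrivial hτ h1
    have hk' : k ∈ transGroup := by
      rw [← closure_trivialGens] at hk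
      exact (((Subgroup.closure_le _).2 trivialGens_subset) hk).1
    rw [eq_of_apply_eq hg hk' genericPoint_injective h2]
    exact hk
  · rw [← closure_trivialGens, Subgroup.closure_le]
    exact trivialGens_subset

theorem exists_semidirectProduct_equiv : ∃ ψ : SemidirectProduct
    (Perm (Fin 3) × Perm (Fin 3) × Perm (Fin 3)) (Perm (Fin 2)) flipAction ≃* trivialSubgroup,
    ∀ x, (ψ x : Perm BParams) = semiHom x :=
  ⟨(MonoidHom.ofInjective semiHom_injective).trans
    (MulEquiv.subgroupCongr trivialSubgroup_eq.symm), fun _ => rfl⟩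

theorem card_trivialSubgroup : Nat.card trivialSubgroup = 432 := by
  obtain ⟨ψ, -⟩ := exists_semidirectProduct_equiv
  rw [← Nat.card_congr ψ.toEquiv, Nat.card_congr SemidirectProduct.equivProd]
  simp [Nat.card_eq_fintype_card, Fintype.card_perm, Nat.factorial]

theorem trivialSubgroup_le : trivialSubgroup ≤ transGroup := fun _ h => h.1

theorem relIndex_trivialSubgroup : trivialSubgroup.relIndex transGroup = 120 := by
  have h := Subgroup.relIndex_mul_relIndex _ _ _ (bot_le : ⊥ ≤ trivialSubgroup) trivialSubgroup_le
  rw [Subgroup.relIndex_bot_left, Subgroup.relIndex_bot_left, card_trivialSubgroup,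
    card_transGroup] at h
  omega

/-! ### Invariance of `H(𝐞) / Π(𝐞)` -/

theorem hOf_eVal (p : HParams) : hOf (eVal p) = p := by
  refine HParams.ext ?_ (funext fun j => ?_)
  · simp [hOf, eVal]
    ring
  · rcases eq_or_ne j 0 with rfl | hj
    · simp [hOf, eVal]
      ring
    · simp [hOf, eVal, Fin.pos_iff_ne_zero.2 hj]

theorem H_eVal (p : HParams) : H (eVal p) = F p := by rw [H, hOf_eVal]

theorem admissible_iff_of_mem {g : Perm BParams} (hg : g ∈ transGroup) (p : BParams) :
    (g p).1.Admissible ↔ p.1.Admissible := by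
  obtain ⟨π, -, i⟩ := exists_induces_of_mem hg
  refine ⟨fun h x => by rw [← i]; exact h _, fun h x => ?_⟩
  have := i p (π⁻¹ x)
  rw [perm_apply_inv] at this
  rw [this]
  exact h _

theorem IdxPerm.exists_succ (σ : IdxPerm) :
    ∃ ρ : Perm (Fin 6), ∀ j, σ.1.symm j.succ = (ρ j).succ := by
  have h : ∀ j : Fin 6, ∃ k : Fin 6, σ.1.symm j.succ = k.succ := fun j => by
    have : σ.1.symm j.succ ≠ 0 := fun h => by
      rw [Equiv.symm_apply_eq, σ.2] at h
      exact Fin.succ_ne_zero j h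
    obtain ⟨k, hk⟩ := Fin.exists_succ_eq.2 this
    exact ⟨k, hk.symm⟩
  choose f hf using h
  have hi : Function.Injective f := fun i j hij => by
    apply Fin.succ_injective
    apply σ.1.symm.injective
    rw [hf, hf, hij]
  exact ⟨Equiv.ofBijective f (Finite.injective_iff_bijective.1 hi), hf⟩

theorem F6'_relabel (σ : IdxPerm) (p : BParams) : F6' (relabel σ p).1 = F6' p.1 := by
  obtain ⟨ρ, hρ⟩ := σ.exists_succ
  have hs : ∀ j : Fin 6, (relabel σ p).1.h j.succ = p.1.h (ρ j).succ := fun j =>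
    congrArg p.1.h (hρ j)
  have hmin : hMin (relabel σ p).1 = hMin p.1 := by
    refine le_antisymm (Finset.le_inf' _ _ fun j _ => ?_) (Finset.le_inf' _ _ fun j _ => ?_)
    · have := hMin_le (relabel σ p).1 (ρ⁻¹ j)
      rwa [hs, perm_apply_inv] at this
    · rw [hs]
      exact hMin_le p.1 (ρ j)
  have h7 : ∀ f : ℤ → ℂ, ∏ j : Fin 7, f ((relabel σ p).1.h j) = ∏ j : Fin 7, f (p.1.h j) := fun f =>
    Equiv.prod_comp σ.1.symm fun j => f (p.1.h j)
  have h6 : ∀ f : ℤ → ℂ, ∏ j : Fin 6, f (p.1.h (ρ j).succ) = ∏ j : Fin 6, f (p.1.h j.succ) :=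
    fun f => Equiv.prod_comp ρ fun j : Fin 6 => f (p.1.h j.succ)
  have hm : (relabel σ p).1.hm = p.1.hm := rfl
  rw [F6', F6', hmin, hm, relabel_h_zero]
  refine congrArg _ (funext fun t => ?_)
  rw [h7 fun x => Complex.Gamma ((x : ℂ) + t)]
  simp only [hs]
  rw [h6 fun x => Complex.Gamma (1 + (p.1.h 0 : ℂ) - (x : ℂ) + t)]

/-- In the quotient the unsymmetric factors of `γ` and `Π` cancel. -/
theorem F_div_bigPi (p : HParams) : F p / bigPi (eVal p) =
    F6' p / ∏ j : Fin 6, (fact (p.h j.succ - 1) * fact (p.h j.succ + p.hm - p.h 0 - 1)) := by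
  have hp : ∏ j : Fin 6, (fact (p.h j.succ - 1) * fact (p.h j.succ + p.hm - p.h 0 - 1)) =
      (fact (p.h 1 - 1) * fact (p.h 1 + p.hm - p.h 0 - 1)) *
      (fact (p.h 2 - 1) * fact (p.h 2 + p.hm - p.h 0 - 1)) *
      (fact (p.h 3 - 1) * fact (p.h 3 + p.hm - p.h 0 - 1)) *
      (fact (p.h 4 - 1) * fact (p.h 4 + p.hm - p.h 0 - 1)) *
      (fact (p.h 5 - 1) * fact (p.h 5 + p.hm - p.h 0 - 1)) *
      (fact (p.h 6 - 1) * fact (p.h 6 + p.hm - p.h 0 - 1)) := Fin.prod_univ_six _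
  rw [hp, F, gammaFactor, bigPi]
  simp only [eVal, if_true, if_neg (by decide : ¬(1 : Fin 7) = 0),
    if_neg (by decide : ¬(2 : Fin 7) = 0), if_neg (by decide : ¬(3 : Fin 7) = 0),
    if_neg (by decide : ¬(4 : Fin 7) = 0)]
  have n := fact_ne_zero
  field_simp [n]

theorem F_div_bigPi_relabel (σ : IdxPerm) (p : BParams) :
    F (relabel σ p).1 / bigPi (eVal (relabel σ p).1) = F p.1 / bigPi (eVal p.1) := by
  obtain ⟨ρ, hρ⟩ := σ.exists_succ
  have hs : ∀ j : Fin 6, (relabel σ p).1.h j.succ = p.1.h (ρ j).succ := fun j =>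
    congrArg p.1.h (hρ j)
  have hm : (relabel σ p).1.hm = p.1.hm := rfl
  rw [F_div_bigPi, F_div_bigPi, F6'_relabel, hm, relabel_h_zero]
  simp only [hs]
  rw [Equiv.prod_comp ρ fun j : Fin 6 =>
    fact (p.1.h j.succ - 1) * fact (p.1.h j.succ + p.1.hm - p.1.h 0 - 1)]

theorem eVal_b135 (p : BParams) (x : Label) : eVal (b135 p).1 x = eVal p.1 (bLabel x) := by
  have h : ∀ x, bLabel (bLabel x) = x := by decide
  rw [← b135_induces p, h]

theorem prod_fact_toAB (p : BParams) : ∏ j : Fin 6,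
    fact ((toAB p.1).a j.succ - (toAB p.1).b j.succ) =
    fact (eVal p.1 (.e 0 1 (by decide))) * fact (eVal p.1 (.e 0 2 (by decide))) *
    fact (eVal p.1 (.e 1 5 (by decide))) * fact (eVal p.1 (.e 2 6 (by decide))) *
    fact (eVal p.1 (.ebar 5 (by decide))) * fact (eVal p.1 (.ebar 6 (by decide))) := by
  have e3 : p.1.h 3 - (p.1.h 1 + p.1.h 3 + p.1.h 5 - p.1.h 0) = p.1.h 0 - p.1.h 1 - p.1.h 5 := by
    ring
  have e4 : p.1.h 4 - (p.1.h 2 + p.1.h 4 + p.1.h 6 - p.1.h 0) = p.1.h 0 - p.1.h 2 - p.1.h 6 := by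
    ring
  have e5 : p.1.h 5 - (1 + p.1.h 0 - p.1.hm) = p.1.h 5 + p.1.hm - p.1.h 0 - 1 := by ring
  have e6 : p.1.h 6 - (1 + p.1.h 0 - p.1.hm) = p.1.h 6 + p.1.hm - p.1.h 0 - 1 := by ring
  rw [Fin.prod_univ_six]
  change fact (p.1.h 1 - 1) * fact (p.1.h 2 - 1) *
    fact (p.1.h 3 - (p.1.h 1 + p.1.h 3 + p.1.h 5 - p.1.h 0)) *
    fact (p.1.h 4 - (p.1.h 2 + p.1.h 4 + p.1.h 6 - p.1.h 0)) *
    fact (p.1.h 5 - (1 + p.1.h 0 - p.1.hm)) * fact (p.1.h 6 - (1 + p.1.h 0 - p.1.hm)) = _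
  rw [e3, e4, e5, e6]
  rfl

theorem bigPi_ne_zero (e : Label → ℤ) : bigPi e ≠ 0 := by
  simp only [bigPi, ne_eq, mul_eq_zero, fact_ne_zero, or_self, not_false_eq_true]

theorem F_div_bigPi_b135 {p : BParams} (hp : p.1.Admissible) :
    F (b135 p).1 / bigPi (eVal (b135 p).1) = F p.1 / bigPi (eVal p.1) := by
  have hb : (b135 p).1.Admissible := (admissible_iff_of_mem (bailey_mem _) p).2 hp
  obtain ⟨τ, hτ, h⟩ := b135_mem_trivialSubgroup.2 p
  have h1 := (preservesNormG_of_mem hτ (toAB p.1)).2 (toAB_admissible hp)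
  rw [← h, normG, normG, prod_fact_toAB, prod_fact_toAB] at h1
  rw [F_eq_neg_G hp p.2, F_eq_neg_G (p := (b135 p).1) hb (b135 p).2,
    div_eq_div_iff (bigPi_ne_zero _) (bigPi_ne_zero _)]
  rw [bigPi, bigPi]
  simp only [eVal_b135,
    show bLabel (.e 0 1 (by decide)) = .e 3 5 (by decide) by decide,
    show bLabel (.e 0 2 (by decide)) = .e 0 2 (by decide) by decide,
    show bLabel (.e 0 3 (by decide)) = .e 1 5 (by decide) by decide,
    show bLabel (.e 0 4 (by decide)) = .e 0 4 (by decide) by decide,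
    show bLabel (.e 0 5 (by decide)) = .e 1 3 (by decide) by decide,
    show bLabel (.e 0 6 (by decide)) = .e 0 6 (by decide) by decide,
    show bLabel (.e 1 3 (by decide)) = .e 0 5 (by decide) by decide,
    show bLabel (.e 1 5 (by decide)) = .e 0 3 (by decide) by decide,
    show bLabel (.e 2 4 (by decide)) = .ebar 6 (by decide) by decide,
    show bLabel (.e 2 6 (by decide)) = .ebar 4 (by decide) by decide,
    show bLabel (.e 3 5 (by decide)) = .e 0 1 (by decide) by decide,
    show bLabel (.e 4 6 (by decide)) = .ebar 2 (by decide) by decide,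
    show bLabel (.ebar 1 (by decide)) = .ebar 1 (by decide) by decide,
    show bLabel (.ebar 2 (by decide)) = .e 4 6 (by decide) by decide,
    show bLabel (.ebar 3 (by decide)) = .ebar 3 (by decide) by decide,
    show bLabel (.ebar 4 (by decide)) = .e 2 6 (by decide) by decide,
    show bLabel (.ebar 5 (by decide)) = .ebar 5 (by decide) by decide,
    show bLabel (.ebar 6 (by decide)) = .e 2 4 (by decide) by decide] at h1 ⊢
  -- the two identities have a common factor
  have hne : fact (eVal p.1 (.e 0 2 (by decide))) * fact (eVal p.1 (.ebar 5 (by decide))) ≠ 0 :=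
    mul_ne_zero (fact_ne_zero _) (fact_ne_zero _)
  refine mul_right_cancel₀ hne ?_
  linear_combination -(fact (eVal p.1 (.e 0 4 (by decide))) * fact (eVal p.1 (.e 0 5 (by decide))) *
    fact (eVal p.1 (.e 0 6 (by decide))) * fact (eVal p.1 (.ebar 1 (by decide))) *
    fact (eVal p.1 (.ebar 2 (by decide))) * fact (eVal p.1 (.ebar 3 (by decide))) *
    fact (eVal p.1 (.e 1 3 (by decide))) * fact (eVal p.1 (.e 4 6 (by decide)))) * h1

theorem F_div_bigPi_of_mem {g : Perm BParams} (hg : g ∈ transGroup) {p : BParams}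
    (hp : p.1.Admissible) : F (g p).1 / bigPi (eVal (g p).1) = F p.1 / bigPi (eVal p.1) := by
  have hg' := hg
  rw [← closure_relabel_b135] at hg'
  induction hg' using Subgroup.closure_induction generalizing p with
  | mem g h =>
    rcases h with ⟨σ, rfl⟩ | h
    · exact F_div_bigPi_relabel σ p
    · rw [mem_singleton_iff.1 h]
      exact F_div_bigPi_b135 hp
  | one => rfl
  | mul g g' m m' h h' =>
    rw [closure_relabel_b135] at m m'
    rw [Perm.mul_apply, h m ((admissible_iff_of_mem m' p).2 hp), h' m' hp]
  | inv g m h =>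
    rw [closure_relabel_b135] at m
    have := h m ((admissible_iff_of_mem (inv_mem m) p).2 hp)
    rw [perm_apply_inv] at this
    exact this.symm

theorem H_div_bigPi_of_mem {π : Perm Label} (hπ : π ∈ permGroup) {p : BParams}
    (hp : p.1.Admissible) :
    H (eVal p.1 ∘ π) / bigPi (eVal p.1 ∘ π) = H (eVal p.1) / bigPi (eVal p.1) := by
  obtain ⟨g, hg, i⟩ := exists_trans_of_mem hπ
  have h : eVal p.1 ∘ π = eVal (g⁻¹ p).1 := funext fun x => by
    have := i (g⁻¹ p) x
    rwa [perm_apply_inv] at this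
  rw [h, H_eVal, H_eVal, F_div_bigPi_of_mem (inv_mem hg) hp]

/-! ### The 120 classes -/

/-- The 27 numbers as polynomials in `h₀, …, h₆`, with `h₋₁` eliminated by the balancing
condition. -/
noncomputable def labelPoly : Label → MvPolynomial (Fin 7) ℤ
  | .e j k _ => if j = 0 then .X k - 1 else .X 0 - .X j - .X k
  | .ebar j _ => .X j + (2 + 3 * .X 0 - ∑ i ∈ Finset.univ.erase (0 : Fin 7), .X i) - .X 0 - 1

theorem eval_labelPoly (p : BParams) (x : Label) :
    MvPolynomial.eval p.1.h (labelPoly x) = eVal p.1 x := by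
  rcases x with ⟨j, k, hjk⟩ | ⟨j, hj⟩
  · rw [labelPoly, eVal]
    split_ifs <;> simp
  · have := p.2
    rw [HParams.Balanced] at this
    rw [labelPoly, eVal, this]
    simp

/-- The product of the differences of the 27 numbers. -/
noncomputable def discPoly : MvPolynomial (Fin 7) ℤ :=
  ∏ x : Label × Label, if x.1 = x.2 then 1 else labelPoly x.1 - labelPoly x.2

theorem eval_discPoly_ne_zero (p : BParams) :
    MvPolynomial.eval p.1.h discPoly ≠ 0 ↔ Function.Injective (eVal p.1) := by
  rw [discPoly, map_prod, Finset.prod_ne_zero_iff]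
  refine ⟨fun h x y hxy => ?_, fun h x _ => ?_⟩
  · by_contra hne
    refine h (x, y) (Finset.mem_univ _) ?_
    rw [if_neg hne, map_sub, eval_labelPoly, eval_labelPoly, hxy, sub_self]
  · split_ifs with hx
    · simp
    · rw [map_sub, eval_labelPoly, eval_labelPoly, sub_ne_zero]
      exact fun he => hx (h he)

theorem discPoly_ne_zero : discPoly ≠ 0 := fun h => by
  have := (eval_discPoly_ne_zero genericPoint).2 genericPoint_injective
  rw [h, map_zero] at this
  exact this rfl

theorem abClass_eq_iff (q q' : ABParams) : abClass q = abClass q' ↔ ∃ τ ∈ abTrivial, q' = τ q := by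
  refine ⟨fun h => ?_, ?_⟩
  · have : q' ∈ abClass q' := ⟨1, one_mem _, rfl⟩
    rw [← h] at this
    exact this
  · rintro ⟨τ, hτ, rfl⟩
    ext r
    constructor
    · rintro ⟨ρ, hρ, rfl⟩
      exact ⟨ρ * τ⁻¹, mul_mem hρ (inv_mem hτ), by rw [Perm.mul_apply, perm_inv_apply]⟩
    · rintro ⟨ρ, hρ, rfl⟩
      exact ⟨ρ * τ, mul_mem hρ hτ, rfl⟩

/-- For generic parameters the classes correspond to the cosets of the trivial subgroup. -/
theorem abClass_toAB_eq_iff {p : BParams} (hp : Function.Injective (eVal p.1)) {g g' : Perm BParams}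
    (hg : g ∈ transGroup) (hg' : g' ∈ transGroup) :
    abClass (toAB (g p).1) = abClass (toAB (g' p).1) ↔ g' * g⁻¹ ∈ trivialSubgroup := by
  rw [abClass_eq_iff]
  constructor
  · rintro ⟨τ, hτ, h⟩
    obtain ⟨k, hk, h1⟩ := eq_semiHom_of_abTrivial hτ h
    rw [← trivialSubgroup_eq] at hk
    rw [eq_of_apply_eq hg' (mul_mem hk.1 hg) hp h1, mul_inv_cancel_right]
    exact hk
  · intro h
    have := h.2 (g p)
    rwa [Perm.mul_apply, perm_inv_apply] at this

theorem ncard_abClass {p : BParams} (hp : Function.Injective (eVal p.1)) :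
    {C : Set ABParams | ∃ g ∈ transGroup, C = abClass (toAB (g p).1)}.ncard = 120 := by
  let T := trivialSubgroup.subgroupOf transGroup
  let f : transGroup ⧸ T → Set ABParams := fun c => abClass (toAB ((c.out : Perm BParams)⁻¹ p).1)
  have hf : ∀ (c : transGroup ⧸ T) (g : transGroup),
      f c = abClass (toAB ((g : Perm BParams)⁻¹ p).1) ↔ c = g := fun c g => by
    conv_rhs => rw [← QuotientGroup.out_eq' c, eq_comm, QuotientGroup.eq]
    rw [abClass_toAB_eq_iff hp (inv_mem (Subtype.property _)) (inv_mem g.2), inv_inv]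
    exact (Subgroup.mem_subgroupOf (h := g⁻¹ * c.out)).symm
  have hr : {C : Set ABParams | ∃ g ∈ transGroup, C = abClass (toAB (g p).1)} = Set.range f := by
    ext C
    constructor
    · rintro ⟨g, hg, rfl⟩
      refine ⟨((⟨g⁻¹, inv_mem hg⟩ : transGroup) : transGroup ⧸ T), ?_⟩
      rw [(hf _ _).2 rfl, inv_inv]
    · rintro ⟨c, rfl⟩
      exact ⟨_, inv_mem (Subtype.property _), rfl⟩
  have hi : Function.Injective f := fun c c' h => by
    rw [(hf c c'.out).1 h, QuotientGroup.out_eq']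
  rw [hr, Set.ncard_range_of_injective hi, ← relIndex_trivialSubgroup]
  rfl

end ZetaFour

theorem mainTheorem5 :
    -- `F(𝐡) = ± G(𝐚, 𝐛)`, and the sign is `-` under the balancing condition
    (∀ p : HParams, p.Admissible → (toAB p).Admissible ∧
      F p = (-1 : ℂ) ^ (1 + p.hm + ∑ j : Fin 7, p.h j) * G (toAB p) ∧
      (p.Balanced → F p = -G (toAB p))) ∧
    -- the normalised integral does not change under `(𝐚, 𝐛)`-trivial transformations
    (∀ q : ABParams, q.Admissible → ∀ τ ∈ abTrivial,
      (τ q).Admissible ∧ normG (τ q) = normG q) ∧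
    -- `𝔟₁₃₅` is `(𝐚, 𝐛)`-trivial, and the permutation of the numbers `e` that it induces
    (∀ p : BParams, toAB (b135 p).1 =
      bPerm (Equiv.swap 1 3 * Equiv.swap 4 6)
        (abShift {0, 1, 3, 5} (1 + p.1.h 0 - p.1.h 1 - p.1.h 3 - p.1.h 5) (toAB p.1))) ∧
    b135 ∈ trivialSubgroup ∧
    Induces b135 bLabel ∧
    -- together with the permutations of `h₁, …, h₆` it generates the group `𝔊` of order 51840
    Subgroup.closure (Set.range relabel ∪ {b135}) = transGroup ∧
    Subgroup.closure (hLabels ∪ {bLabel}) = permGroup ∧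
    (∃ Φ : transGroup ≃* permGroup, ∀ g : transGroup, Induces g (Φ g)) ∧
    Nat.card permGroup = 51840 ∧
    -- `H(𝐞) / Π(𝐞)` is invariant under `𝔊`
    (∀ p : HParams, H (eVal p) = F p) ∧
    (∀ π ∈ permGroup, ∀ p : BParams, p.1.Admissible →
      H (eVal p.1 ∘ π) / bigPi (eVal p.1 ∘ π) = H (eVal p.1) / bigPi (eVal p.1)) ∧
    -- the subgroup of the `(𝐚, 𝐛)`-trivial elements of `𝔊`
    Nat.card trivialSubgroup = 432 ∧
    Subgroup.closure {hSwap 1 3 (by decide) (by decide), hSwap 3 5 (by decide) (by decide),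
      hSwap 2 4 (by decide) (by decide), hSwap 4 6 (by decide) (by decide), b135, hFlip}
        = trivialSubgroup ∧
    (∃ φ : Equiv.Perm (Fin 2) →*
        MulAut (Equiv.Perm (Fin 3) × Equiv.Perm (Fin 3) × Equiv.Perm (Fin 3)),
      (∀ x y z, φ (Equiv.swap 0 1) (x, y, z) =
        (y, x, Equiv.swap 0 2 * z * Equiv.swap 0 2)) ∧
      ∃ ψ : SemidirectProduct (Equiv.Perm (Fin 3) × Equiv.Perm (Fin 3) × Equiv.Perm (Fin 3))
          (Equiv.Perm (Fin 2)) φ ≃* trivialSubgroup,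
        (ψ (.inl (Equiv.swap 0 1, 1, 1)) : Equiv.Perm BParams)
          = hSwap 1 3 (by decide) (by decide) ∧
        (ψ (.inl (Equiv.swap 1 2, 1, 1)) : Equiv.Perm BParams)
          = hSwap 3 5 (by decide) (by decide) ∧
        (ψ (.inl (1, Equiv.swap 0 1, 1)) : Equiv.Perm BParams)
          = hSwap 6 4 (by decide) (by decide) ∧
        (ψ (.inl (1, Equiv.swap 1 2, 1)) : Equiv.Perm BParams)
          = hSwap 4 2 (by decide) (by decide) ∧
        (ψ (.inl (1, 1, Equiv.swap 0 1)) : Equiv.Perm BParams) = b135 ∧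
        (ψ (.inl (1, 1, Equiv.swap 1 2)) : Equiv.Perm BParams) = b246 ∧
        (ψ (.inr (Equiv.swap 0 1)) : Equiv.Perm BParams) = hFlip) ∧
    -- there are 120 representatives modulo the `(𝐚, 𝐛)`-trivial transformations
    trivialSubgroup.relIndex transGroup = 120 ∧
    (∃ P : MvPolynomial (Fin 7) ℤ, P ≠ 0 ∧
      ∀ p : BParams, MvPolynomial.eval p.1.h P ≠ 0 →
        {C : Set ABParams | ∃ g ∈ transGroup, C = abClass (toAB (g p).1)}.ncard = 120) := by
  have e4 : trivialSubgroup = Subgroup.closure trivialGens :=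
    trivialSubgroup_eq.trans closure_trivialGens.symm
  obtain ⟨ψ, hψ⟩ := exists_semidirectProduct_equiv
  have hψl : ∀ w, (ψ (.inl w) : Perm BParams) = triHom w := fun w => (hψ _).trans (semiHom_inl w)
  refine ⟨fun p hp => ⟨toAB_admissible hp, F_eq_G hp, F_eq_neg_G hp⟩, fun q hq τ hτ => ?_,
    toAB_b135, b135_mem_trivialSubgroup, b135_induces, closure_relabel_b135,
    closure_hLabels_bLabel, exists_mulEquiv, card_permGroup, H_eVal,
    fun π hπ p hp => H_div_bigPi_of_mem hπ hp, card_trivialSubgroup, e4.symm,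
    ⟨flipAction, fun x y z => ?_, ψ, ?_⟩, relIndex_trivialSubgroup,
    ⟨discPoly, discPoly_ne_zero, fun p hp => ncard_abClass ((eval_discPoly_ne_zero p).1 hp)⟩⟩
  · exact ⟨(preservesNormG_of_mem hτ q).1.2 hq, (preservesNormG_of_mem hτ q).2 hq⟩
  · rw [flipAction, homPermTwo_swap]
    rfl
  · exact ⟨(hψl _).trans triHom_odd_fst, (hψl _).trans triHom_odd_snd,
      (hψl _).trans triHom_even_fst, (hψl _).trans triHom_even_snd, (hψl _).trans triHom_b135,
      (hψl _).trans triHom_b246, (hψ _).trans semiHom_inr⟩
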